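/- Let $\mathcal H$ be the Fock space of the charged free fermions $\psi_n,\psi^*_n$ ($n\in\mathbf Z$), $\psi_m\psi^*_n+\psi^*_n\psi_m=\delta_{m+n,0}$, $\psi_m\psi_n+\psi_n\psi_m=\psi^*_m\psi^*_n+\psi^*_n\psi^*_m=0$, where $\psi_{-n}$ creates and $\psi^*_n$ annihilates a particle at energy level $n$. It has the basis of states $\psi_{-s_1}\psi_{-s_2}\cdots|{-\infty}\rangle$ with occupied levels $s_1>s_2>\cdots$ (almost all levels $\le 0$ and only finitely many levels $>0$ are occupied); $|s\rangle=\psi_{-s}\psi_{-s+1}\cdots|{-\infty}\rangle$ is the ground state of charge $s\in\mathbf Z$, in which exactly the levels $\le s$ are occupied, and $\langle s|$ is the coordinate functional dual to it. Coefficients are formal power series over $\mathbf C$ in $\boldsymbol t=(t_1,t_2,\dots)$ and $\bar{\boldsymbol t}=(\bar t_1,\bar t_2,\dots)$; infinite combinations of basis states are allowed, and all series converge coefficientwise. With ${:}\psi_m\psi^*_n{:}=\psi_m\psi^*_n-\langle 0|\psi_m\psi^*_n|0\rangle$ put $$J_m=\sum_{n\in\mathbf Z}{:}\psi_{-n+m}\psi^*_n{:},\quad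 L_0=\sum_{n\in\mathbf Z}n\,{:}\psi_{-n}\psi^*_n{:},\quad W_0=\sum_{n\in\mathbf Z}n^2\,{:}\psi_{-n}\psi^*_n{:},\quad J_\pm[\boldsymbol t]=\sum_{k\ge1}t_kJ_{\pm k}.$$ Let $h_m[\boldsymbol t]$ be defined by $\sum_{m\ge0}h_m[\boldsymbol t]z^m=\exp\bigl(\sum_{k\ge1}t_kz^k\bigr)$, with $h_m=0$ for $m<0$; for a partition $\lambda$ with $l$ parts let $s_\lambda[\boldsymbol t]=\det(h_{\lambda_i-i+j}[\boldsymbol t])_{i,j=1}^{l}$ and $\kappa_\lambda=\sum_{i=1}^l\lambda_i(\lambda_i-2i+1)$. For partitions $\mu,\bar\mu$ of $d$ and $r\ge0$ let $H_d(\bar\mu,(1^{d-2}2)^r,\mu)$ be the double Hurwitz number, i.e. $1/d!$ times the number of tuples $(\rho,\tau_1,\dots,\tau_r,\sigma)$ of elements of the symmetric group $S_d$ with $\rho\tau_1\cdots\tau_r\sigma=1$, $\rho$ of cycle type $\bar\mu$, $\sigma$ of cycle type $\mu$, and all $\tau_i$ transpositions. **Theorem.** Let $\beta,Q\in\mathbf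 C$, $Q\ne0$, $s\in\mathbf Z$, and $g=e^{\beta W_0/2}Q^{L_0}$. Then the exponential series of $J_+[\boldsymbol t]$, $-J_-[\bar{\boldsymbol t}]$, $\beta W_0/2$ and $(\log Q)L_0$, and the sums over $k$ defining $J_+[\boldsymbol t]$ and $J_-[\bar{\boldsymbol t}]$, converge, and $$\langle s|e^{J_+[\boldsymbol t]}\,g\,e^{-J_-[\bar{\boldsymbol t}]}|s\rangle=e^{\beta s(s+1)(2s+1)/12}\,Q^{s(s+1)/2}\sum_{\lambda}e^{\beta\kappa_\lambda/2}\bigl(e^{\beta(s+1/2)}Q\bigr)^{|\lambda|}s_\lambda[\boldsymbol t]\,s_\lambda[-\bar{\boldsymbol t}],$$ the sum being over all partitions. Moreover, the sum over $\lambda$ is the generating function of double Hurwitz numbers with $Q$ replaced by $e^{\beta(s+1/2)}Q$: it equals $$\sum_{d,r\ge0}\ \sum_{|\mu|=|\bar\mu|=d}H_d(\bar\mu,(1^{d-2}2)^r,\mu)\,\frac{\beta^r}{r!}\bigl(e^{\beta(s+1/2)}Q\bigr)^d\,p_\mu\,\bar p_{\bar\mu},$$ where $p_\mu=\prod_ip_{\mu_i}$,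 $\bar p_{\bar\mu}=\prod_i\bar p_{\bar\mu_i}$, $p_k=kt_k$ and $\bar p_k=-k\bar t_k$. Both series converge coefficientwise. -/

import Mathlib

open scoped MvPowerSeries.WithPiTopology

namespace TodaHurwitz

noncomputable section

/-! ### Coefficient ring: formal power series in the two sets of time variables -/

/-- The ring of formal power series over `ℂ` in `t₁, t₂, …` and `t̄₁, t̄₂, …`. It carries the topology
of coefficientwise convergence. -/
abbrev TimeSeries : Type := MvPowerSeries (ℕ+ ⊕ ℕ+) ℂ

/-- The variables `t₁, t₂, …`. -/
def tVar (k : ℕ+) : TimeSeries := MvPowerSeries.X (Sum.inl k)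

/-- The variables `t̄₁, t̄₂, …`. -/
def tbarVar (k : ℕ+) : TimeSeries := MvPowerSeries.X (Sum.inr k)

/-- A constant regarded as a power series. -/
abbrev const (c : ℂ) : TimeSeries := MvPowerSeries.C c

/-! ### Schur functions in the time variables -/

section Schur

variable {R : Type*} [CommRing R] [Algebra ℚ R]

/-- A sequence indexed by the positive integers, extended by `0` to the index `0`. -/
def extendZero (t : ℕ+ → R) (k : ℕ) : R := if h : 0 < k then t ⟨k, h⟩ else 0

/-- `h_m[t]`, where `∑_{m ≥ 0} h_m[t] z^m = exp (∑_{k ≥ 1} t_k z^k)`. -/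
def completeSym (t : ℕ+ → R) (m : ℕ) : R :=
  PowerSeries.coeff m
    (PowerSeries.subst (PowerSeries.mk (extendZero t)) (PowerSeries.exp R) : PowerSeries R)

/-- `h_m[t]` for an integer index, zero for `m < 0`. -/
def completeSymInt (t : ℕ+ → R) (m : ℤ) : R := if 0 ≤ m then completeSym t m.toNat else 0

/-- `s_λ[t] = det (h_{λ_i - i + j}[t])`, of size the number of parts of `λ`. -/
def schur (t : ℕ+ → R) (lam : YoungDiagram) : R :=
  (Matrix.of fun i j : Fin (lam.colLen 0) =>
    completeSymInt t ((lam.rowLen i : ℤ) - (i : ℤ) + (j : ℤ))).det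

/-- `p_μ = ∏_i p_{μ_i}` in the time variables, where `p_k = k t_k`. -/
def powerSum (t : ℕ+ → R) {d : ℕ} (mu : d.Partition) : R :=
  (mu.parts.map fun k : ℕ => (k : R) * extendZero t k).prod

end Schur

/-- `κ_λ = ∑_{i ≥ 1} λ_i (λ_i - 2 i + 1)`; here the rows are numbered from `0`. -/
def kappa (lam : YoungDiagram) : ℤ :=
  ∑ i ∈ Finset.range (lam.colLen 0),
    (lam.rowLen i : ℤ) * ((lam.rowLen i : ℤ) - 2 * ((i : ℤ) + 1) + 1)

/-! ### The fermionic Fock space -/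

/-- Maya diagrams: sets of occupied energy levels that contain all but finitely many of the
levels `≤ 0` and only finitely many of the levels `> 0`. -/
def Maya : Type := {S : Set ℤ // (S \ Set.Iic 0).Finite ∧ (Set.Iic 0 \ S).Finite}

namespace Maya

/-- The Maya diagram of the ground state of charge `s`: the levels `≤ s` are occupied. -/
def ground (s : ℤ) : Maya :=
  ⟨Set.Iic s, (Set.finite_Ioc 0 s).subset fun x hx => by
      simp only [Set.mem_sdiff, Set.mem_Iic, not_le, Set.mem_Ioc] at hx ⊢; omega,
    (Set.finite_Ioc s 0).subset fun x hx => by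
      simp only [Set.mem_sdiff, Set.mem_Iic, not_le, Set.mem_Ioc] at hx ⊢; omega⟩

/-- Occupy the level `n`. -/
def add (S : Maya) (n : ℤ) : Maya :=
  ⟨insert n S.1, (S.2.1.insert n).subset fun x hx => by
      simp only [Set.mem_sdiff, Set.mem_insert_iff] at hx ⊢; tauto,
    S.2.2.subset fun x hx => by
      simp only [Set.mem_sdiff, Set.mem_insert_iff] at hx ⊢; tauto⟩

/-- Empty the level `n`. -/
def remove (S : Maya) (n : ℤ) : Maya :=
  ⟨S.1 \ {n}, S.2.1.subset fun x hx => by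
      simp only [Set.mem_sdiff, Set.mem_singleton_iff] at hx ⊢; tauto,
    (S.2.2.insert n).subset fun x hx => by
      simp only [Set.mem_sdiff, Set.mem_insert_iff, Set.mem_singleton_iff] at hx ⊢; tauto⟩

/-- The fermionic sign `(-1) ^ #{x ∈ S : x > n}`. -/
def sign (S : Maya) (n : ℤ) : TimeSeries := (-1) ^ Set.ncard {x ∈ S.1 | n < x}

end Maya

/-- The (completed) Fock space over the ring of time series. A vector `v` is the possibly infinite
combination `∑_S v(S) |S⟩` of the basis vectors
`|S⟩ = ψ_{-s₁} ψ_{-s₂} ⋯ |-∞⟩`, `S = {s₁ > s₂ > ⋯}`. -/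
abbrev Fock : Type := Maya → TimeSeries

open Classical in
/-- The ket `|s⟩`. -/
def ketGround (s : ℤ) : Fock := fun S => if S = Maya.ground s then 1 else 0

/-- The bra `⟨s|`: the pairing `⟨s|v⟩`. -/
def braGround (s : ℤ) (v : Fock) : TimeSeries := v (Maya.ground s)

open Classical in
/-- `ψ_n`: it creates a particle at the level `-n`,
`ψ_n |S⟩ = (-1)^{#{x ∈ S : x > -n}} |S ∪ {-n}⟩` if `-n ∉ S`, and `ψ_n |S⟩ = 0` otherwise.
Written in terms of the coefficients of a vector. -/
def psi (n : ℤ) (v : Fock) : Fock := fun S =>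
  if -n ∈ S.1 then S.sign (-n) * v (S.remove (-n)) else 0

open Classical in
/-- `ψ*_n`: it annihilates a particle at the level `n`,
`ψ*_n |S⟩ = (-1)^{#{x ∈ S : x > n}} |S \ {n}⟩` if `n ∈ S`, and `ψ*_n |S⟩ = 0` otherwise. -/
def psiStar (n : ℤ) (v : Fock) : Fock := fun S =>
  if n ∈ S.1 then 0 else S.sign n * v (S.add n)

/-- The normal ordered bilinear `:ψ_m ψ*_n: = ψ_m ψ*_n - ⟨0|ψ_m ψ*_n|0⟩`. -/
def normalOrdered (m n : ℤ) (v : Fock) : Fock := fun S =>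
  psi m (psiStar n v) S - braGround 0 (psi m (psiStar n (ketGround 0))) * v S

/-- `J_m = ∑_n :ψ_{-n+m} ψ*_n:`. In each coefficient only finitely many terms are nonzero. -/
def J (m : ℤ) (v : Fock) : Fock := fun S => ∑ᶠ n : ℤ, normalOrdered (-n + m) n v S

/-- `L_0 = ∑_n n :ψ_{-n} ψ*_n:`. In each coefficient only finitely many terms are nonzero. -/
def L0 (v : Fock) : Fock := fun S => ∑ᶠ n : ℤ, (n : ℂ) • normalOrdered (-n) n v S

/-- `W_0 = ∑_n n² :ψ_{-n} ψ*_n:`. In each coefficient only finitely many terms are nonzero. -/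
def W0 (v : Fock) : Fock := fun S => ∑ᶠ n : ℤ, ((n : ℂ) ^ 2) • normalOrdered (-n) n v S

/-- `J_+[x] = ∑_{k ≥ 1} x_k J_k`. -/
def Jplus (x : ℕ+ → TimeSeries) (v : Fock) : Fock := fun S => ∑' k : ℕ+, x k * J (k : ℤ) v S

/-- `J_-[x] = ∑_{k ≥ 1} x_k J_{-k}`. -/
def Jminus (x : ℕ+ → TimeSeries) (v : Fock) : Fock := fun S => ∑' k : ℕ+, x k * J (-(k : ℤ)) v S

/-- The exponential `e^A v = ∑_{n ≥ 0} A^n v / n!` of an operator, summed coefficientwise. -/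
def opExp (A : Fock → Fock) (v : Fock) : Fock := fun S =>
  ∑' n : ℕ, ((n.factorial : ℂ)⁻¹) • (A^[n] v) S

/-- The exponential series of `A` converges on every vector. -/
def OpExpConverges (A : Fock → Fock) : Prop :=
  ∀ (v : Fock) (S : Maya), Summable fun n : ℕ => ((n.factorial : ℂ)⁻¹) • (A^[n] v) S

/-- `Q^A = e^{(log Q) A}`. -/
def opPow (Q : ℂ) (A : Fock → Fock) : Fock → Fock := opExp (Complex.log Q • A)

/-- `g = e^{β W_0 / 2} Q^{L_0}`. -/
def hurwitzElement (β Q : ℂ) (v : Fock) : Fock := opExp ((β / 2) • W0) (opPow Q L0 v)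

/-- The Toda tau function `τ(s, t, t̄) = ⟨s| e^{J_+[t]} g e^{-J_-[t̄]} |s⟩` of an operator `g`. -/
def todaTau (g : Fock → Fock) (s : ℤ) : TimeSeries :=
  braGround s (opExp (Jplus tVar) (g (opExp (-Jminus tbarVar) (ketGround s))))

/-- All the infinite sums that enter `⟨s| e^{J_+[t]} e^{β W_0 / 2} Q^{L_0} e^{-J_-[t̄]} |s⟩`
converge. -/
structure TauConverges (β Q : ℂ) : Prop where
  jplus : ∀ (v : Fock) (S : Maya), Summable fun k : ℕ+ => tVar k * J (k : ℤ) v S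
  jminus : ∀ (v : Fock) (S : Maya), Summable fun k : ℕ+ => tbarVar k * J (-(k : ℤ)) v S
  exp_jplus : OpExpConverges (Jplus tVar)
  exp_jminus : OpExpConverges (-Jminus tbarVar)
  exp_W0 : OpExpConverges ((β / 2) • W0)
  pow_L0 : OpExpConverges (Complex.log Q • L0)

/-! ### Double Hurwitz numbers -/

/-- The double Hurwitz number `H_d(μ̄, 1^{d-2}2, …, 1^{d-2}2, μ)` with `r` simple branch points:
the number of possibly disconnected `d`-fold coverings of the sphere with this ramification, each
weighted by the inverse order of its automorphism group, counted by monodromy: `1 / d!` times the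
number of factorizations `ρ τ₁ ⋯ τ_r σ = 1` in the symmetric group `S_d` with `ρ`, `σ` of
cycle type `μ̄`, `μ` and `τ₁, …, τ_r` transpositions. -/
def doubleHurwitz (d r : ℕ) (mubar mu : d.Partition) : ℚ :=
  (Set.ncard {x : Equiv.Perm (Fin d) × (Fin r → Equiv.Perm (Fin d)) × Equiv.Perm (Fin d) |
    x.1.partition.parts = mubar.parts ∧ (∀ i, (x.2.1 i).IsSwap) ∧
      x.2.2.partition.parts = mu.parts ∧ x.1 * (List.ofFn x.2.1).prod * x.2.2 = 1} : ℚ) /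
    (d.factorial : ℚ)

end

end TodaHurwitz

open TodaHurwitz

/-! Everything rests on Jacobi–Trudi determinants with arbitrary integer rows, `jt t f = det (h_{f_i
+ j})`. A state of charge `s` is a partition, with occupied levels `s + λ_i - i` (`i ≥ 0`), and the
vector `∑_λ s_λ[y] |λ, s⟩` (`schurVec`) has these determinants as components. A hop of a particle
changes one row index, and the fermionic sign is the sign of the row permutation that restores
decreasing order. A hop forbidden by the Pauli principle gives a determinant with two equal rows or
a zero row. Hence a component of `J_{∓k}` of this vector is the sum of the determinants with one row
index shifted by `∓k` (`sum_hop_schurVec`).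

Lowering an index by `k` is differentiation in the `k`-th time (`derivation_jt`), so `J_-[y]` acts
as `d/dz` on the vector with times `z y_k`. This gives `e^{J_-[y]} |s⟩ = ∑_λ s_λ[y] |λ, s⟩`. Since
`J_+[t]` is the transpose of `J_-[t]` (`exists_hasSum_adjoint`), also `⟨s| e^{J_+[t]} = ∑_λ s_λ[t]
⟨λ, s|`. As `g` is diagonal with the eigenvalues computed in `weight_L0` and `weight_W0`, the Schur
expansion of the tau function follows (`hasSum_todaTau`).

Raising an index by `k` multiplies by `p_k` (`jt_murnaghanNakayama`), so the Schur vector is a joint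
eigenvector of the `J_k`. Applying `⟨s| e^{J_+[t]}` to it yields the Cauchy identity graded by `|λ|`
(`sum_schur_mul_schur`). Its right side `h_d` is, by the cycle index of the symmetric group
(`sum_cycleProd_X`), the case `r = 0` of the Hurwitz side.

For general `r` one applies the cut-and-join operator repeatedly. On Schur functions it is diagonal
with eigenvalue `κ_λ / 2` (`cutJoin_schur`). On products of power sums over the cycles of a
permutation it is multiplication by the sum of all transpositions, because a transposition cuts or
joins cycles (`cutJoin_cycleProd`). Hence `∑_{|λ|=d} (κ_λ/2)^r s_λ s_λ` counts factorizations with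
`r` transpositions (`sum_kappa_pow_eq_sum_doubleHurwitz`).

Summing over `r` turns `(βκ_λ/2)^r / r!` into `e^{βκ_λ/2}`. The convergence is absolute for fixed
`d`, and weighted homogeneity in `t` lets only one `d` contribute to each coefficient
(`hasSum_hurwitzTerm`). -/

namespace TodaHurwitz

noncomputable section

set_option linter.unusedSectionVars false

/-! ### Newton's identities for the complete symmetric functions -/

section CompleteSym

variable {R : Type*} [CommRing R] [Algebra ℚ R]

/-- The power sum `p_k = k t_k` in the time variables, with `p_0 = 0`. -/
def psum (t : ℕ+ → R) (k : ℕ) : R := (k : R) * extendZero t k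

@[simp] lemma extendZero_zero (t : ℕ+ → R) : extendZero t 0 = 0 := by simp [extendZero]

lemma extendZero_pos (t : ℕ+ → R) (k : ℕ+) : extendZero t k = t k := by
  simp only [extendZero, k.pos, dif_pos]; rfl

@[simp] lemma psum_zero (t : ℕ+ → R) : psum t 0 = 0 := by simp [psum]

lemma extendZero_map {S : Type*} [CommRing S] [Algebra ℚ S] (φ : R →+* S) (t : ℕ+ → R) (k : ℕ) :
    extendZero (fun i => φ (t i)) k = φ (extendZero t k) := by
  unfold extendZero; split_ifs <;> simp

lemma psum_map {S : Type*} [CommRing S] [Algebra ℚ S] (φ : R →+* S) (t : ℕ+ → R) (k : ℕ) :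
    psum (fun i => φ (t i)) k = φ (psum t k) := by
  simp [psum, extendZero_map]

lemma hasSubst_extendZero (t : ℕ+ → R) :
    PowerSeries.HasSubst (PowerSeries.mk (extendZero t)) := by
  apply PowerSeries.HasSubst.of_constantCoeff_zero'
  simp [← PowerSeries.coeff_zero_eq_constantCoeff_apply]

lemma completeSym_zero (t : ℕ+ → R) : completeSym t 0 = 1 := by
  unfold completeSym
  have h := PowerSeries.constantCoeff_subst_eq_zero (a := PowerSeries.mk (extendZero t))
    (by
      change PowerSeries.constantCoeff (PowerSeries.mk (extendZero t)) = 0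
      simp [← PowerSeries.coeff_zero_eq_constantCoeff_apply]) (PowerSeries.exp R - 1) (by simp)
  rw [PowerSeries.subst_sub (hasSubst_extendZero t)] at h
  have h1 : PowerSeries.subst (PowerSeries.mk (extendZero t)) (1 : PowerSeries R)
      = (1 : PowerSeries R) := by
    rw [← PowerSeries.coe_substAlgHom (hasSubst_extendZero t), map_one]
  rw [h1, map_sub, sub_eq_zero] at h
  rw [PowerSeries.coeff_zero_eq_constantCoeff_apply]
  refine Eq.trans h ?_
  exact map_one _

/-- Newton's identity: the coefficient of `z^n` in `H' = H · ∑ (k + 1) t_{k+1} z^k`, where `H = exp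
(∑ t_k z^k)`. -/
lemma succ_mul_completeSym (t : ℕ+ → R) (n : ℕ) :
    ((n : R) + 1) * completeSym t (n + 1) =
      ∑ x ∈ Finset.HasAntidiagonal.antidiagonal n, completeSym t x.1 * psum t (x.2 + 1) := by
  have h := PowerSeries.derivative_subst (f := PowerSeries.exp R) (hasSubst_extendZero t)
  rw [PowerSeries.derivative_exp] at h
  have h2 := congrArg (PowerSeries.coeff n) h
  rw [PowerSeries.coeff_derivative, PowerSeries.coeff_mul] at h2
  rw [mul_comm]
  refine h2.trans (Finset.sum_congr rfl fun x _ => ?_)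
  rw [PowerSeries.coeff_derivative, PowerSeries.coeff_mk, psum, completeSym]
  push_cast
  ring

lemma completeSymInt_natCast (t : ℕ+ → R) (n : ℕ) : completeSymInt t n = completeSym t n := by
  simp [completeSymInt]

lemma completeSymInt_of_neg (t : ℕ+ → R) {n : ℤ} (h : n < 0) : completeSymInt t n = 0 := by
  simp [completeSymInt, h]

@[simp] lemma completeSymInt_zero (t : ℕ+ → R) : completeSymInt t 0 = 1 := by
  simp [completeSymInt, completeSym_zero]

/-- The sum `∑_{i ≤ M} c_i h_{n - i}` does not depend on `M ≥ n`. -/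
lemma sum_completeSymInt_eq (t : ℕ+ → R) (c : ℕ → R) {n : ℤ} {M N : ℕ} (hM : n ≤ M) (hN : n ≤ N) :
    ∑ i ∈ Finset.range (M + 1), c i * completeSymInt t (n - i) =
      ∑ i ∈ Finset.range (N + 1), c i * completeSymInt t (n - i) := by
  wlog h : M ≤ N generalizing M N
  · exact (this hN hM (by omega)).symm
  refine Finset.sum_subset (by intro x; simp; omega) fun x _ hx => ?_
  rw [completeSymInt_of_neg, mul_zero]
  simp only [Finset.mem_range, not_lt] at hx
  omega

/-- Newton's identity in a form uniform in `n`: the term `i = 0` is harmless because `psum t 0 = 0`,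
and the terms `i > n` vanish. The free bound `M` allows several indices `n` to share one range of
summation. -/
lemma mul_completeSymInt (t : ℕ+ → R) {n : ℤ} {M : ℕ} (hM : n ≤ M) :
    (n : R) * completeSymInt t n =
      ∑ i ∈ Finset.range (M + 1), psum t i * completeSymInt t (n - i) := by
  rcases lt_or_ge n 0 with hn | hn
  · rw [completeSymInt_of_neg t hn, mul_zero, Finset.sum_eq_zero]
    intro i _
    rw [completeSymInt_of_neg t (by omega), mul_zero]
  obtain ⟨n, rfl⟩ := Int.eq_ofNat_of_zero_le hn
  rw [sum_completeSymInt_eq t _ hM (le_refl (n : ℤ))]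
  cases n with
  | zero => simp
  | succ n =>
    rw [Finset.sum_range_succ', psum_zero, zero_mul, add_zero, completeSymInt_natCast]
    push_cast
    rw [succ_mul_completeSym, Finset.Nat.antidiagonal_eq_map', Finset.sum_map]
    refine Finset.sum_congr rfl fun i hi => ?_
    have : ((n : ℤ) + 1 - (i + 1)) = ((n - i : ℕ) : ℤ) := by
      simp only [Finset.mem_range] at hi; omega
    rw [this, completeSymInt_natCast, mul_comm]
    rfl

lemma completeSymInt_eq_of_mul_eq (t : ℕ+ → R) {n : ℤ} (hn : 0 < n) {x : R}
    (h : (n : R) * completeSymInt t n = (n : R) * x) : completeSymInt t n = x := by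
  have hu : IsUnit (n : R) := by
    have : (n : R) = algebraMap ℚ R (n : ℚ) := by simp
    rw [this]
    exact (IsUnit.mk0 (n : ℚ) (by exact_mod_cast hn.ne')).map _
  exact hu.mul_left_cancel h

/-- Over a `ℚ`-algebra Newton's recursion determines `h_n`, and ring homomorphisms respect the
recursion. -/
lemma completeSymInt_map {S : Type*} [CommRing S] [Algebra ℚ S] (φ : R →+* S) (t : ℕ+ → R)
    (n : ℤ) : completeSymInt (fun i => φ (t i)) n = φ (completeSymInt t n) := by
  rcases lt_or_ge n 0 with hn | hn
  · simp [completeSymInt_of_neg _ hn]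
  obtain ⟨n, rfl⟩ := Int.eq_ofNat_of_zero_le hn
  induction n using Nat.strong_induction_on with
  | _ n ih =>
    rcases Nat.eq_zero_or_pos n with rfl | hp
    · simp
    refine completeSymInt_eq_of_mul_eq _ (by exact_mod_cast hp) ?_
    have h2 := congrArg φ (mul_completeSymInt t (le_refl (n : ℤ)))
    rw [map_mul, map_intCast] at h2
    rw [mul_completeSymInt _ (le_refl (n : ℤ)), h2, map_sum]
    refine Finset.sum_congr rfl fun i hi => ?_
    rw [map_mul, psum_map]
    rcases Nat.eq_zero_or_pos i with rfl | hi0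
    · simp
    · simp only [Finset.mem_range] at hi
      have : ((n : ℤ) - i) = ((n - i : ℕ) : ℤ) := by omega
      rw [this, ih (n - i) (by omega) (by positivity)]

/-- The effect on `h_n` of scaling `t_k` by `z^k`. -/
lemma completeSymInt_scale (t : ℕ+ → R) (z : R) (n : ℕ) :
    completeSymInt (fun i => z ^ (i : ℕ) * t i) n = z ^ n * completeSymInt t n := by
  have hps : ∀ i : ℕ, psum (fun i => z ^ (i : ℕ) * t i) i = z ^ i * psum t i := by
    intro i
    unfold psum extendZero
    split_ifs <;> simp
    ring
  induction n using Nat.strong_induction_on with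
  | _ n ih =>
    rcases Nat.eq_zero_or_pos n with rfl | hp
    · simp
    refine completeSymInt_eq_of_mul_eq _ (by exact_mod_cast hp) ?_
    rw [mul_left_comm, mul_completeSymInt t (le_refl (n : ℤ)),
      mul_completeSymInt _ (le_refl (n : ℤ)), Finset.mul_sum]
    refine Finset.sum_congr rfl fun i hi => ?_
    rcases Nat.eq_zero_or_pos i with rfl | hi0
    · simp
    · simp only [Finset.mem_range] at hi
      have : ((n : ℤ) - i) = ((n - i : ℕ) : ℤ) := by omega
      rw [this, ih (n - i) (by omega), hps]
      have hz : z ^ n = z ^ i * z ^ (n - i) := by rw [← pow_add]; congr 1; omega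
      rw [hz]; ring

/-- A derivation acts on the complete symmetric functions by
`δ h_n = ∑_k δ(t_k) h_{n - k}`. -/
lemma derivation_completeSymInt {A : Type*} [CommRing A] [Algebra A R] (δ : Derivation A R R)
    (t : ℕ+ → R) {n : ℤ} {M : ℕ} (hM : n ≤ M) :
    δ (completeSymInt t n) =
      ∑ i ∈ Finset.range (M + 1), extendZero (fun k => δ (t k)) i * completeSymInt t (n - i) := by
  rcases lt_or_ge n 0 with hn | hn
  · rw [completeSymInt_of_neg t hn, map_zero, Finset.sum_eq_zero]
    intro i _
    rw [completeSymInt_of_neg t (by omega), mul_zero]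
  obtain ⟨n, rfl⟩ := Int.eq_ofNat_of_zero_le hn
  have hδp : ∀ i : ℕ, δ (psum t i) = (i : R) * extendZero (fun k => δ (t k)) i := by
    intro i
    unfold psum extendZero
    split_ifs <;> simp
  induction n using Nat.strong_induction_on generalizing M with
  | _ n ih =>
    rcases Nat.eq_zero_or_pos n with rfl | hp
    · rw [sum_completeSymInt_eq t _ hM (N := 0) (by simp)]
      simp
    have hu : IsUnit (n : R) := by
      have : (n : R) = algebraMap ℚ R (n : ℚ) := by simp
      rw [this]
      exact (IsUnit.mk0 (n : ℚ) (by exact_mod_cast hp.ne')).map _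
    refine hu.mul_left_cancel ?_
    -- Apply `δ` to Newton's identity. The induction hypothesis covers `h_{n-i}`, and Newton's
    -- identity for `h_{n-j}` then recombines the double sum.
    have h2 := congrArg δ (mul_completeSymInt t (le_refl (n : ℤ)))
    rw [Int.cast_natCast, Derivation.leibniz, Derivation.map_natCast, smul_zero, add_zero,
      smul_eq_mul, map_sum] at h2
    rw [sum_completeSymInt_eq t _ hM (le_refl (n : ℤ)), h2]
    have h3 : ∀ i ∈ Finset.range (n + 1), δ (psum t i * completeSymInt t ((n : ℤ) - i)) =
        (∑ j ∈ Finset.range (n + 1), extendZero (fun k => δ (t k)) j *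
          (psum t i * completeSymInt t ((n : ℤ) - j - i))) +
        (i : R) * extendZero (fun k => δ (t k)) i * completeSymInt t ((n : ℤ) - i) := by
      intro i hi
      rw [Derivation.leibniz, hδp, smul_eq_mul, smul_eq_mul]
      congr 1
      · rcases Nat.eq_zero_or_pos i with rfl | hi0
        · simp
        · simp only [Finset.mem_range] at hi
          have : ((n : ℤ) - i) = ((n - i : ℕ) : ℤ) := by omega
          rw [this, ih (n - i) (by omega) (M := n) (by omega) (by omega), Finset.mul_sum]
          refine Finset.sum_congr rfl fun j _ => ?_
          rw [← this, sub_right_comm]; ring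
      · ring
    rw [Finset.sum_congr rfl h3, Finset.sum_add_distrib, Finset.sum_comm, ← Finset.sum_add_distrib,
      Finset.mul_sum]
    refine Finset.sum_congr rfl fun j _ => ?_
    rw [← Finset.mul_sum, ← mul_completeSymInt t (n := (n : ℤ) - j) (by omega)]
    push_cast
    ring

end CompleteSym

/-! ### Derivatives of determinants and row/column replacement -/

section Det

lemma derivation_prod {A R ι : Type*} [CommRing A] [CommRing R] [Algebra A R] [DecidableEq ι]
    (δ : Derivation A R R) (s : Finset ι) (f : ι → R) :
    δ (∏ i ∈ s, f i) = ∑ i ∈ s, δ (f i) * ∏ j ∈ s.erase i, f j := by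
  induction s using Finset.induction_on with
  | empty => simp
  | insert a s ha ih =>
    rw [Finset.prod_insert ha, Derivation.leibniz, ih, Finset.sum_insert ha,
      Finset.erase_insert ha, smul_eq_mul, smul_eq_mul, Finset.mul_sum, add_comm]
    congr 1
    · ring
    refine Finset.sum_congr rfl fun i hi => ?_
    have hia : i ≠ a := fun h => ha (h ▸ hi)
    rw [Finset.erase_insert_of_ne hia.symm, Finset.prod_insert (by simp [ha])]
    ring

lemma derivation_det {A R n : Type*} [CommRing A] [CommRing R] [Algebra A R] [DecidableEq n]
    [Fintype n] (δ : Derivation A R R) (M : Matrix n n R) :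
    δ M.det = ∑ i, (M.updateRow i fun j => δ (M i j)).det := by
  rw [← Matrix.det_transpose M, Matrix.det_apply, map_sum]
  have h : ∀ i, (M.updateRow i fun j => δ (M i j)).det =
      ∑ σ : Equiv.Perm n, Equiv.Perm.sign σ •
        (δ (M i (σ i)) * ∏ j ∈ Finset.univ.erase i, M j (σ j)) := by
    intro i
    rw [← Matrix.det_transpose, Matrix.det_apply]
    refine Finset.sum_congr rfl fun σ _ => ?_
    rw [← Finset.mul_prod_erase Finset.univ _ (Finset.mem_univ i)]
    have h1 : (M.updateRow i fun j => δ (M i j)).transpose (σ i) i = δ (M i (σ i)) := by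
      rw [Matrix.transpose_apply, Matrix.updateRow_self]
    rw [h1]
    congr 2
    refine Finset.prod_congr rfl fun j hj => ?_
    rw [Matrix.transpose_apply, Matrix.updateRow_ne (Finset.ne_of_mem_erase hj)]
  simp_rw [h]
  rw [Finset.sum_comm]
  refine Finset.sum_congr rfl fun σ _ => ?_
  rw [← Finset.smul_sum, Units.smul_def, Units.smul_def, map_zsmul, derivation_prod]
  rfl

/-- By Cramer's rule both sides are the trace of `A.adjugate * B`. -/
lemma sum_det_updateRow_eq_sum_det_updateCol {R n : Type*} [CommRing R] [DecidableEq n]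
    [Fintype n] (A B : Matrix n n R) :
    ∑ i, (A.updateRow i (B i)).det = ∑ j, (A.updateCol j fun i => B i j).det := by
  simp_rw [← Matrix.cramer_transpose_apply, ← Matrix.cramer_apply,
    Matrix.cramer_eq_adjugate_mulVec, ← Matrix.adjugate_transpose, Matrix.mulVec, dotProduct,
    Matrix.transpose_apply]
  rw [Finset.sum_comm]

lemma sum_det_updateCol_eq_trace {R n : Type*} [CommRing R] [DecidableEq n]
    [Fintype n] (A B : Matrix n n R) :
    ∑ j, (A.updateCol j fun i => B i j).det = (A.adjugate * B).trace := by
  simp_rw [← Matrix.cramer_apply, Matrix.cramer_eq_adjugate_mulVec]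
  rfl

end Det

/-! ### Jacobi–Trudi determinants with integer rows -/

section JacobiTrudi

variable {R : Type*} [CommRing R] [Algebra ℚ R]

/-- The matrix `(h_{f_i + j})`, the rows of which are indexed by arbitrary integers `f_i`. -/
def jtMatrix (t : ℕ+ → R) {N : ℕ} (f : Fin N → ℤ) : Matrix (Fin N) (Fin N) R :=
  Matrix.of fun i j => completeSymInt t (f i + (j : ℕ))

/-- The Jacobi–Trudi determinant `det (h_{f_i + j})`. -/
def jt (t : ℕ+ → R) {N : ℕ} (f : Fin N → ℤ) : R := (jtMatrix t f).det

lemma schur_eq_jt_colLen (t : ℕ+ → R) (lam : YoungDiagram) :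
    schur t lam = jt t (fun i : Fin (lam.colLen 0) => (lam.rowLen i : ℤ) - (i : ℕ)) := rfl

lemma jt_comp_perm (t : ℕ+ → R) {N : ℕ} (f : Fin N → ℤ) (σ : Equiv.Perm (Fin N)) :
    jt t (f ∘ σ) = ((Equiv.Perm.sign σ : ℤ) : R) * jt t f :=
  Matrix.det_permute σ (jtMatrix t f)

lemma jt_eq_zero_of_eq (t : ℕ+ → R) {N : ℕ} (f : Fin N → ℤ) {i j : Fin N} (hij : i ≠ j)
    (h : f i = f j) : jt t f = 0 :=
  Matrix.det_zero_of_row_eq hij (by ext k; simp [jtMatrix, h])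

lemma jt_eq_zero_of_le (t : ℕ+ → R) {N : ℕ} (f : Fin N → ℤ) {i : Fin N} (h : f i ≤ -N) :
    jt t f = 0 :=
  Matrix.det_eq_zero_of_row_eq_zero i fun j => completeSymInt_of_neg t (by omega)

lemma jt_map {S : Type*} [CommRing S] [Algebra ℚ S] (φ : R →+* S) (t : ℕ+ → R) {N : ℕ}
    (f : Fin N → ℤ) : jt (fun i => φ (t i)) f = φ (jt t f) := by
  unfold jt
  rw [RingHom.map_det]
  congr 1
  ext i j
  simp [jtMatrix, completeSymInt_map]

/-- The last row is `(0, …, 0, 1)`. Iterated, this lets a partition be padded with empty rows. -/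
lemma jt_snoc (t : ℕ+ → R) {N : ℕ} (f : Fin (N + 1) → ℤ) (h : f (Fin.last N) = -N) :
    jt t f = jt t (fun i : Fin N => f i.castSucc) := by
  unfold jt
  rw [Matrix.det_succ_row _ (Fin.last N), Fin.sum_univ_castSucc, Finset.sum_eq_zero, zero_add]
  · have : (jtMatrix t f) (Fin.last N) (Fin.last N) = 1 := by
      simp [jtMatrix, h]
    rw [this, Fin.succAbove_last, Fin.val_last, ← two_mul, pow_mul]
    simp only [even_two, Even.neg_pow, one_pow, mul_one, one_mul]
    rfl
  · intro j _
    have : (jtMatrix t f) (Fin.last N) j.castSucc = 0 := by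
      simp only [jtMatrix, Matrix.of_apply, h]
      exact completeSymInt_of_neg t (by simp)
    rw [this]; simp

/-- The Jacobi–Trudi determinants of a sequence that ends with `-n, -(n + 1), …`. -/
lemma jt_stable (t : ℕ+ → R) (F : ℕ → ℤ) {n N : ℕ} (hn : n ≤ N)
    (hF : ∀ i, n ≤ i → F i = -i) : jt t (fun i : Fin N => F i) = jt t (fun i : Fin n => F i) := by
  induction N, hn using Nat.le_induction with
  | base => rfl
  | succ N h ih =>
    rw [jt_snoc t _ (by simpa using hF N h), ← ih]
    rfl

lemma rowLen_eq_zero {lam : YoungDiagram} {i : ℕ} (h : lam.colLen 0 ≤ i) : lam.rowLen i = 0 := by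
  by_contra h0
  have : (i, 0) ∈ lam := YoungDiagram.mem_iff_lt_rowLen.2 (Nat.pos_of_ne_zero h0)
  have := YoungDiagram.mem_iff_lt_colLen.1 this
  omega

lemma schur_eq_jt (t : ℕ+ → R) (lam : YoungDiagram) {N : ℕ} (hN : lam.colLen 0 ≤ N) :
    schur t lam = jt t (fun i : Fin N => (lam.rowLen i : ℤ) - (i : ℕ)) := by
  rw [schur_eq_jt_colLen]
  exact (jt_stable t (fun i => (lam.rowLen i : ℤ) - (i : ℕ)) hN
    (fun i hi => by simp [rowLen_eq_zero hi])).symm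

lemma schur_map {S : Type*} [CommRing S] [Algebra ℚ S] (φ : R →+* S) (t : ℕ+ → R)
    (lam : YoungDiagram) : schur (fun i => φ (t i)) lam = φ (schur t lam) := by
  rw [schur_eq_jt_colLen, jt_map, schur_eq_jt_colLen]

lemma jt_insertNth (t : ℕ+ → R) {N : ℕ} (i : Fin (N + 1)) (b : ℤ) (g : Fin N → ℤ) :
    jt t (i.insertNth b g : Fin (N + 1) → ℤ) =
      (-1) ^ (i : ℕ) * jt t (Fin.cons b g : Fin (N + 1) → ℤ) := by
  rw [← Fin.insertNth_comp_cycleRange_symm i b g, jt_comp_perm, Equiv.Perm.sign_symm,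
    Fin.sign_cycleRange]
  push_cast
  rw [← mul_assoc, ← pow_add, ← two_mul, pow_mul]
  simp

lemma jt_update (t : ℕ+ → R) {N : ℕ} (f : Fin N → ℤ) (i : Fin N) (b : ℤ) :
    jt t (Function.update f i b) =
      ((jtMatrix t f).updateRow i fun j => completeSymInt t (b + (j : ℕ))).det := by
  unfold jt
  congr 1
  ext a j
  by_cases h : a = i
  · subst h; simp [jtMatrix]
  · simp [jtMatrix, Function.update_of_ne h, Matrix.updateRow_ne h]

/-- Since `δ h_n = ∑_k δ(t_k) h_{n-k}`, differentiating one row lowers its index. These are the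
determinants produced by the operators `J_{-k}`, see `J_neg_schurVec`. -/
lemma derivation_jt {A : Type*} [CommRing A] [Algebra A R] (δ : Derivation A R R)
    (t : ℕ+ → R) {N : ℕ} (f : Fin N → ℤ) {M : ℕ} (hM : ∀ i, f i + N ≤ M) :
    δ (jt t f) = ∑ k ∈ Finset.range (M + 1), extendZero (fun k => δ (t k)) k *
      ∑ i, jt t (Function.update f i (f i - k)) := by
  conv_lhs => rw [jt, derivation_det]
  simp_rw [Finset.mul_sum]
  rw [Finset.sum_comm]
  refine Finset.sum_congr rfl fun i _ => ?_
  have h : ∀ j : Fin N, δ (jtMatrix t f i j) = ∑ k ∈ Finset.range (M + 1),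
      extendZero (fun k => δ (t k)) k * completeSymInt t (f i - k + (j : ℕ)) := by
    intro j
    have := hM i
    rw [jtMatrix, Matrix.of_apply, derivation_completeSymInt δ t (M := M) (by omega)]
    refine Finset.sum_congr rfl fun k _ => ?_
    congr 2; ring
  simp_rw [h, jt_update]
  have h2 : ∀ v : Fin N → R, ((jtMatrix t f).updateRow i v).det =
      ∑ j, v j * ((jtMatrix t f).adjugate j i) := by
    intro v
    rw [← Matrix.cramer_transpose_apply, Matrix.cramer_eq_adjugate_mulVec,
      ← Matrix.adjugate_transpose]
    simp only [Matrix.mulVec, dotProduct, Matrix.transpose_apply, mul_comm]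
  simp_rw [h2, Finset.sum_mul, Finset.mul_sum]
  rw [Finset.sum_comm]
  simp_rw [mul_assoc]

end JacobiTrudi

/-! ### Multiplication of a Jacobi–Trudi determinant by a power sum -/

section MurnaghanNakayama

variable {R : Type*} [CommRing R] [Algebra ℚ R]

lemma completeSym_derivative (t : ℕ+ → R) :
    PowerSeries.derivative R (PowerSeries.mk (completeSym t)) =
      PowerSeries.mk (completeSym t) *
        PowerSeries.derivative R (PowerSeries.mk (extendZero t)) := by
  ext n
  rw [PowerSeries.coeff_derivative, PowerSeries.coeff_mul, PowerSeries.coeff_mk, mul_comm,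
    succ_mul_completeSym]
  refine Finset.sum_congr rfl fun x _ => ?_
  rw [PowerSeries.coeff_derivative, PowerSeries.coeff_mk, PowerSeries.coeff_mk, psum]
  push_cast
  ring

lemma extendZero_neg (t : ℕ+ → R) (k : ℕ) : extendZero (fun i => -t i) k = -extendZero t k := by
  unfold extendZero; split_ifs <;> simp

/-- The complete symmetric functions at `-t` are the coefficients of `1 / ∑ h_m z^m`. -/
lemma sum_completeSym_neg_mul (t : ℕ+ → R) (n : ℕ) :
    ∑ i ∈ Finset.range (n + 1),
      completeSym (fun i => -t i) i * completeSymInt t ((n : ℤ) - i) = if n = 0 then 1 else 0 := by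
  have h : PowerSeries.derivative R
      (PowerSeries.mk (completeSym fun i => -t i) * PowerSeries.mk (completeSym t)) = 0 := by
    rw [Derivation.leibniz, completeSym_derivative, completeSym_derivative]
    have : PowerSeries.mk (extendZero fun i => -t i) = -PowerSeries.mk (extendZero t) := by
      ext k; simp [extendZero_neg]
    rw [this, map_neg, smul_eq_mul, smul_eq_mul]
    ring
  have h2 : ∑ i ∈ Finset.range (n + 1),
      completeSym (fun i => -t i) i * completeSymInt t ((n : ℤ) - i) = PowerSeries.coeff n
      (PowerSeries.mk (completeSym fun i => -t i) * PowerSeries.mk (completeSym t)) := by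
    rw [PowerSeries.coeff_mul, Finset.Nat.antidiagonal_eq_map, Finset.sum_map]
    refine Finset.sum_congr rfl fun i hi => ?_
    have : ((n : ℤ) - i) = ((n - i : ℕ) : ℤ) := by
      simp only [Finset.mem_range] at hi; omega
    rw [this, completeSymInt_natCast, PowerSeries.coeff_mk, PowerSeries.coeff_mk]
    rfl
  rw [h2]
  cases n with
  | zero => simp [PowerSeries.coeff_mul, completeSym_zero]
  | succ n =>
    have h3 := congrArg (PowerSeries.coeff n) h
    rw [PowerSeries.coeff_derivative, map_zero] at h3
    have hu : IsUnit ((n : R) + 1) := by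
      have : ((n : R) + 1) = algebraMap ℚ R (n + 1 : ℚ) := by simp
      rw [this]
      exact (IsUnit.mk0 (n + 1 : ℚ) (by positivity)).map _
    simpa using hu.mul_left_eq_zero.1 h3

/-- The difference `j - i = r ≥ 0` occurs at `k - r` positions of a `k × k` square. -/
lemma sum_sum_toeplitz (F : ℤ → R) (hF : ∀ m, m < 0 → F m = 0) (k : ℕ) :
    ∑ i ∈ Finset.range k, ∑ j ∈ Finset.range k, F ((j : ℤ) - i) =
      ∑ r ∈ Finset.range k, ((k : R) - r) * F r := by
  induction k with
  | zero => simp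
  | succ k ih =>
    have h0 : ∑ j ∈ Finset.range k, F ((j : ℤ) - k) = 0 :=
      Finset.sum_eq_zero fun j hj => hF _ (by simp only [Finset.mem_range] at hj; omega)
    have h1 : ∑ i ∈ Finset.range (k + 1), F ((k : ℤ) - i) = ∑ r ∈ Finset.range (k + 1), F r := by
      rw [← Finset.sum_range_reflect]
      refine Finset.sum_congr rfl fun i hi => ?_
      simp only [Finset.mem_range] at hi
      congr 1
      omega
    rw [Finset.sum_range_succ, Finset.sum_range_succ (fun j : ℕ => F ((j : ℤ) - (k : ℕ))), h0,
      zero_add]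
    simp_rw [Finset.sum_range_succ (fun j : ℕ => F ((j : ℤ) - _)) k]
    rw [Finset.sum_add_distrib, ih, add_assoc,
      ← Finset.sum_range_succ (fun i : ℕ => F ((k : ℤ) - i)), h1, Finset.sum_range_succ,
      ← add_assoc, ← Finset.sum_add_distrib, Finset.sum_range_succ]
    push_cast
    congr 1
    · exact Finset.sum_congr rfl fun i _ => by ring
    · ring

/-- The sum equals `∑_r (k - r) h_r[-t] h_{k-r}[t]`. Newton's identity replaces `(k - r) h_{k-r}` by
`∑_m p_m h_{k-r-m}`, and the convolution of `h[-t]` with `h[t]` leaves only `m = k`. -/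
lemma sum_completeSym_neg_mul_eq_psum (t : ℕ+ → R) (k : ℕ) :
    ∑ i ∈ Finset.range k, ∑ j ∈ Finset.range k,
      completeSymInt (fun i => -t i) ((j : ℤ) - i) * completeSymInt t (k + i - j) = psum t k := by
  have h := sum_sum_toeplitz
    (fun m => completeSymInt (fun i => -t i) m * completeSymInt t (k - m))
    (fun m hm => by rw [completeSymInt_of_neg _ hm, zero_mul]) k
  have h1 : ∀ r : ℕ, ((k : R) - r) *
      (completeSymInt (fun i => -t i) r * completeSymInt t (k - r)) =
      ∑ m ∈ Finset.range (k + 1), psum t m *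
        (completeSym (fun i => -t i) r * completeSymInt t (((k : ℤ) - m) - r)) := by
    intro r
    have := mul_completeSymInt t (n := (k : ℤ) - r) (M := k) (by omega)
    push_cast at this
    rw [mul_left_comm, this, Finset.mul_sum, completeSymInt_natCast]
    exact Finset.sum_congr rfl fun m _ => by rw [sub_right_comm]; ring
  have h2 : ∑ i ∈ Finset.range k, ∑ j ∈ Finset.range k,
      completeSymInt (fun i => -t i) ((j : ℤ) - i) * completeSymInt t (k + i - j) =
      ∑ r ∈ Finset.range (k + 1), ((k : R) - r) *
        (completeSymInt (fun i => -t i) r * completeSymInt t (k - r)) := by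
    rw [Finset.sum_range_succ, sub_self, zero_mul, add_zero, ← h]
    refine Finset.sum_congr rfl fun i _ => Finset.sum_congr rfl fun j _ => ?_
    congr 2; ring
  rw [h2]
  simp_rw [h1]
  rw [Finset.sum_comm]
  simp_rw [← Finset.mul_sum]
  rw [Finset.sum_range_succ, Finset.sum_eq_zero, zero_add]
  · have := sum_completeSymInt_eq t (completeSym (fun i => -t i)) (n := (k : ℤ) - k) (M := k)
      (N := 0) (by simp) (by simp)
    rw [this]
    simp [completeSym_zero]
  · intro m hm
    simp only [Finset.mem_range] at hm
    have := sum_completeSymInt_eq t (completeSym (fun i => -t i)) (n := (k : ℤ) - m) (M := k)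
      (N := k - m) (by omega) (by omega)
    rw [this]
    have h3 := sum_completeSym_neg_mul t (k - m)
    rw [if_neg (by omega)] at h3
    have h4 : ((k - m : ℕ) : ℤ) = (k : ℤ) - m := by omega
    rw [h4] at h3
    rw [h3, mul_zero]

/-- `U` is unitriangular, and its inverse is the same matrix at the times `-t`. The trace is
therefore the sum in `sum_completeSym_neg_mul_eq_psum`. -/
lemma trace_adjugate_toeplitz (t : ℕ+ → R) (k : ℕ) :
    let U : Matrix (Fin k) (Fin k) R :=
      Matrix.of fun i j => completeSymInt t ((j : ℕ) - (i : ℕ) : ℤ)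
    let V : Matrix (Fin k) (Fin k) R :=
      Matrix.of fun i j => completeSymInt t (k + (j : ℕ) - (i : ℕ) : ℤ)
    U.det = 1 ∧ (U.adjugate * V).trace = psum t k := by
  intro U V
  have hdet : U.det = 1 := by
    rw [Matrix.det_of_isUpperTriangular]
    · simp [U]
    · intro i j hij
      exact completeSymInt_of_neg t (by simpa using hij)
  refine ⟨hdet, ?_⟩
  let E : Matrix (Fin k) (Fin k) R :=
    Matrix.of fun i j => completeSymInt (fun i => -t i) ((j : ℕ) - (i : ℕ) : ℤ)
  have hE : E * U = 1 := by
    ext i j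
    rw [Matrix.mul_apply, Matrix.one_apply]
    simp only [E, U, Matrix.of_apply]
    rw [Fin.sum_univ_eq_sum_range (fun l => completeSymInt (fun i => -t i) ((l : ℕ) - (i : ℕ) : ℤ) *
      completeSymInt t ((j : ℕ) - (l : ℕ) : ℤ)) k]
    rcases lt_or_ge (j : ℕ) i with hij | hij
    · rw [if_neg (by intro h; subst h; omega), Finset.sum_eq_zero]
      intro l _
      rcases lt_or_ge l (i : ℕ) with hl | hl
      · rw [completeSymInt_of_neg _ (by omega), zero_mul]
      · rw [completeSymInt_of_neg t (by omega), mul_zero]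
    · have h3 := sum_completeSym_neg_mul t (j - i : ℕ)
      have h4 : ((j - i : ℕ) : ℤ) = (j : ℕ) - (i : ℕ) := by omega
      rw [h4] at h3
      have h5 : (i = j) ↔ ((j : ℕ) - (i : ℕ) = 0) := by rw [Fin.ext_iff]; omega
      simp only [h5]
      rw [← h3]
      symm
      refine Finset.sum_of_injOn (fun l => l + (i : ℕ)) (fun a _ b _ h => by simpa using h) ?_ ?_ ?_
      · intro l hl
        simp only [Finset.coe_range, Set.mem_Iio] at hl ⊢
        omega
      · intro l hl hl2
        rcases lt_or_ge l (i : ℕ) with hli | hli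
        · rw [completeSymInt_of_neg _ (by omega), zero_mul]
        · rw [completeSymInt_of_neg t, mul_zero]
          by_contra hcon
          exact hl2 ⟨l - i, by simp only [Finset.coe_range, Set.mem_Iio]; omega, by simp; omega⟩
      · intro l _
        rw [← completeSymInt_natCast]
        congr 2 <;> push_cast <;> ring
  have hadj : U.adjugate = E := by
    have h1 : E * U * U.adjugate = E := by
      rw [Matrix.mul_assoc, Matrix.mul_adjugate, hdet, one_smul, Matrix.mul_one]
    rw [← h1, hE, Matrix.one_mul]
  rw [hadj, ← sum_completeSym_neg_mul_eq_psum t k, Matrix.trace, ← Fin.sum_univ_eq_sum_range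
    (fun i => ∑ j ∈ Finset.range k,
      completeSymInt (fun i => -t i) ((j : ℤ) - i) * completeSymInt t (k + i - j)) k]
  refine Finset.sum_congr rfl fun i _ => ?_
  rw [Matrix.diag_apply, Matrix.mul_apply, ← Fin.sum_univ_eq_sum_range
    (fun j => completeSymInt (fun i => -t i) ((j : ℤ) - (i : ℕ)) *
      completeSymInt t (k + (i : ℕ) - j)) k]
  rfl

/-- If the last `k` entries of `f` are those of the ground state, then raising the entries of `f`
by `k` one at a time multiplies the Jacobi–Trudi determinant by the power sum `p_k`. -/
lemma jt_murnaghanNakayama (t : ℕ+ → R) (n : ℕ) {k : ℕ} (hk : 0 < k)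
    (f : Fin (n + k) → ℤ)
    (hf : ∀ i : Fin k, f (Fin.natAdd n i) = -((n + i : ℕ) : ℤ)) :
    ∑ i, jt t (Function.update f i (f i + k)) = psum t k * jt t f := by
  let B : Matrix (Fin (n + k)) (Fin (n + k)) R :=
    Matrix.of fun i j => completeSymInt t (f i + k + (j : ℕ))
  let U : Matrix (Fin k) (Fin k) R :=
    Matrix.of fun i j => completeSymInt t ((j : ℕ) - (i : ℕ) : ℤ)
  let V : Matrix (Fin k) (Fin k) R :=
    Matrix.of fun i j => completeSymInt t (k + (j : ℕ) - (i : ℕ) : ℤ)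
  obtain ⟨hU, hUV⟩ := trace_adjugate_toeplitz t k
  change U.det = 1 at hU
  change (U.adjugate * V).trace = _ at hUV
  -- The ground-state rows vanish in the first `n` columns, so the matrices are block triangular.
  have hblock : ∀ W : Matrix (Fin (n + k)) (Fin (n + k)) R,
      (∀ (i : Fin k) (j : Fin n), W (Fin.natAdd n i) (Fin.castAdd k j) = 0) →
      W.det = (Matrix.of fun i j : Fin n => W (Fin.castAdd k i) (Fin.castAdd k j)).det *
        (Matrix.of fun i j : Fin k => W (Fin.natAdd n i) (Fin.natAdd n j)).det := by
    intro W hW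
    rw [← Matrix.det_submatrix_equiv_self finSumFinEquiv W, ← Matrix.det_fromBlocks_zero₂₁
      _ (Matrix.of fun (i : Fin n) (j : Fin k) => W (Fin.castAdd k i) (Fin.natAdd n j))]
    congr 1
    ext i j
    rcases i with i | i <;> rcases j with j | j <;> simp [hW]
  have hzero : ∀ (i : Fin k) (j : Fin n),
      jtMatrix t f (Fin.natAdd n i) (Fin.castAdd k j) = 0 := by
    intro i j
    simp only [jtMatrix, Matrix.of_apply, hf]
    exact completeSymInt_of_neg t (by simp; omega)
  have hA : jt t f =
      (Matrix.of fun i j : Fin n => jtMatrix t f (Fin.castAdd k i) (Fin.castAdd k j)).det := by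
    rw [jt, hblock _ hzero]
    have : (Matrix.of fun i j : Fin k => jtMatrix t f (Fin.natAdd n i) (Fin.natAdd n j)) = U := by
      ext i j
      simp only [jtMatrix, Matrix.of_apply, hf, U]
      congr 1
      simp
      ring
    rw [this, hU, mul_one]
  simp_rw [jt_update]
  -- Raising rows becomes shifting columns: column `j` is replaced by what would be column `j + k`.
  -- For `j < n` that column is already present and the determinant vanishes. Only the last `k`
  -- columns contribute, and they touch only the lower right block `U`.
  have h1 := sum_det_updateRow_eq_sum_det_updateCol (jtMatrix t f) B
  refine h1.trans ?_
  rw [Fin.sum_univ_add, Finset.sum_eq_zero, zero_add]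
  · rw [← hUV, ← sum_det_updateCol_eq_trace, Finset.sum_mul]
    refine Finset.sum_congr rfl fun j _ => ?_
    rw [hblock, hA, mul_comm]
    · congr 2
      · ext i l
        by_cases h : l = j
        · subst h
          simp only [Matrix.of_apply, Matrix.updateCol_self, B, V, hf]
          congr 1
          simp
          ring
        · rw [Matrix.of_apply, Matrix.updateCol_ne (by simpa using h), Matrix.updateCol_ne h]
          simp only [jtMatrix, Matrix.of_apply, hf, U]
          congr 1
          simp
          ring
      · ext i l
        rw [Matrix.of_apply, Matrix.updateCol_ne]
        · rfl
        · intro h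
          have := congrArg Fin.val h
          simp at this
          omega
    · intro i l
      rw [Matrix.updateCol_ne, hzero]
      intro h
      have := congrArg Fin.val h
      simp at this
      omega
  · intro j _
    have hne : Fin.castAdd k j ≠ ⟨j + k, by omega⟩ := by
      intro h; have := congrArg Fin.val h; simp at this; omega
    refine Matrix.det_zero_of_column_eq hne fun i => ?_
    rw [Matrix.updateCol_self, Matrix.updateCol_ne hne.symm]
    simp only [B, jtMatrix, Matrix.of_apply]
    congr 1
    simp
    ring

end MurnaghanNakayama

/-! ### Fermion bilinears as particle hops -/

section Hop

@[simp] lemma Maya.mem_add {S : Maya} {n x : ℤ} : x ∈ (S.add n).1 ↔ x = n ∨ x ∈ S.1 := Iff.rfl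

@[simp] lemma Maya.mem_remove {S : Maya} {n x : ℤ} :
    x ∈ (S.remove n).1 ↔ x ∈ S.1 ∧ x ≠ n := Iff.rfl

lemma Maya.ext {S T : Maya} (h : ∀ x, x ∈ S.1 ↔ x ∈ T.1) : S = T := Subtype.ext (Set.ext h)

lemma Maya.sign_mul_self (S : Maya) (n : ℤ) : S.sign n * S.sign n = 1 := by
  rw [Maya.sign, ← mul_pow]; simp

/-- The bilinear `ψ_{-a} ψ*_b`, which moves a particle from the level `b` to the level `a`. -/
def hop (a b : ℤ) (v : Fock) : Fock := fun S => psi (-a) (psiStar b v) S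

lemma hop_of_not {a b : ℤ} (v : Fock) {S : Maya} (h : ¬(a ∈ S.1 ∧ b ∉ (S.remove a).1)) :
    hop a b v S = 0 := by
  unfold hop psi psiStar
  rw [neg_neg]
  split_ifs <;> simp_all

lemma hop_of {a b : ℤ} (v : Fock) {S : Maya} (ha : a ∈ S.1) (hb : b ∉ (S.remove a).1) :
    hop a b v S = S.sign a * ((S.remove a).sign b * v ((S.remove a).add b)) := by
  unfold hop psi psiStar
  rw [neg_neg, if_pos ha, if_neg hb]

lemma hop_self (a : ℤ) (v : Fock) (S : Maya) [Decidable (a ∈ S.1)] :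
    hop a a v S = if a ∈ S.1 then v S else 0 := by
  split_ifs with h
  · have hS : (S.remove a).add a = S := Maya.ext fun x => by
      by_cases hx : x = a <;> simp [hx, h]
    have hs : (S.remove a).sign a = S.sign a := by
      unfold Maya.sign
      congr 2
      ext x
      simp only [Maya.mem_remove, Set.mem_ofPred_eq]
      constructor
      · tauto
      · intro hx; exact ⟨⟨hx.1, hx.2.ne'⟩, hx.2⟩
    rw [hop_of v h (by simp), hS, hs, ← mul_assoc, Maya.sign_mul_self, one_mul]
  · exact hop_of_not v (by tauto)

/-- A hop between two different levels never returns the vacuum to itself, so the subtracted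
expectation value is zero. -/
lemma normalOrdered_of_ne {m n : ℤ} (h : m + n ≠ 0) (v : Fock) (S : Maya) :
    normalOrdered m n v S = hop (-m) n v S := by
  have h0 : braGround 0 (psi m (psiStar n (ketGround 0))) = 0 := by
    change psi m (psiStar n (ketGround 0)) (Maya.ground 0) = 0
    have h1 : psi m (psiStar n (ketGround 0)) (Maya.ground 0) =
      hop (-m) n (ketGround 0) (Maya.ground 0) := by simp [hop]
    rw [h1]
    by_cases hc : -m ∈ (Maya.ground 0).1 ∧ n ∉ ((Maya.ground 0).remove (-m)).1
    · rw [hop_of _ hc.1 hc.2, ketGround, if_neg, mul_zero, mul_zero]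
      intro he
      have h2 : -m ∈ (((Maya.ground 0).remove (-m)).add n).1 := by rw [he]; exact hc.1
      simp only [Maya.mem_add, Maya.mem_remove] at h2
      omega
    · exact hop_of_not _ hc
  simp [normalOrdered, h0, hop]

lemma normalOrdered_neg_self (n : ℤ) (v : Fock) (S : Maya) [Decidable (n ∈ S.1)] :
    normalOrdered (-n) n v S = ((if n ∈ S.1 then 1 else 0) - (if n ≤ 0 then 1 else 0) : ℤ) • v S := by
  classical
  have h1 : ∀ v S, psi (-n) (psiStar n v) S = hop n n v S := fun _ _ => rfl
  have h2 : n ∈ (Maya.ground 0).1 ↔ n ≤ 0 := Iff.rfl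
  unfold normalOrdered braGround
  rw [h1, h1, hop_self, hop_self]
  simp only [h2, ketGround, if_true]
  split_ifs <;> simp

lemma J_apply {k : ℤ} (hk : k ≠ 0) (v : Fock) (S : Maya) :
    J k v S = ∑ᶠ a : ℤ, hop a (a + k) v S := by
  unfold J
  rw [← finsum_comp_equiv (Equiv.addRight k)]
  refine finsum_congr fun a => ?_
  rw [normalOrdered_of_ne (by simp; omega)]
  simp

end Hop

/-! ### Charge-`s` Maya diagrams and partitions -/

section Enumeration

/-- `f` lists, in decreasing order, the occupied levels of `S` above `s - N`, and all levels
`≤ s - N` are occupied. -/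
structure IsEnum (s : ℤ) (S : Maya) {N : ℕ} (f : Fin N → ℤ) : Prop where
  anti : StrictAnti f
  lt : ∀ i, s - N < f i
  mem : ∀ x, x ∈ S.1 ↔ x ≤ s - N ∨ ∃ i, f i = x

/-- The Maya diagram of charge `s` of a partition: the levels `s + λ_i - i` (`i ≥ 0`) are
occupied. -/
def mayaOf (s : ℤ) (lam : YoungDiagram) : Maya :=
  ⟨{x | ∃ i : ℕ, s + lam.rowLen i - i = x}, by
    refine (Set.finite_Ioc 0 (s + lam.rowLen 0)).subset ?_
    rintro x ⟨⟨i, rfl⟩, hx⟩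
    have := lam.rowLen_anti 0 i (Nat.zero_le i)
    simp only [Set.mem_Iic, not_le] at hx
    exact ⟨hx, by omega⟩, by
    refine (Set.finite_Ioc (s - lam.colLen 0) 0).subset ?_
    rintro x ⟨hx, hx2⟩
    refine ⟨?_, hx⟩
    by_contra hcon
    refine hx2 ⟨(s - x).toNat, ?_⟩
    rw [rowLen_eq_zero (by omega)]
    omega⟩

lemma isEnum_mayaOf (s : ℤ) (lam : YoungDiagram) {N : ℕ} (hN : lam.colLen 0 ≤ N) :
    IsEnum s (mayaOf s lam) (fun i : Fin N => s + lam.rowLen i - (i : ℕ)) where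
  anti i j hij := by
    have := lam.rowLen_anti i j hij.le
    have h : (i : ℕ) < j := hij
    change s + lam.rowLen j - (j : ℕ) < s + lam.rowLen i - (i : ℕ)
    omega
  lt i := by omega
  mem x := by
    constructor
    · rintro ⟨i, rfl⟩
      rcases lt_or_ge i N with h | h
      · exact Or.inr ⟨⟨i, h⟩, rfl⟩
      · left; rw [rowLen_eq_zero (by omega)]; omega
    · rintro (h | ⟨i, rfl⟩)
      · refine ⟨(s - x).toNat, ?_⟩
        rw [rowLen_eq_zero (by omega)]
        omega
      · exact ⟨i, rfl⟩

lemma youngDiagram_ext {lam mu : YoungDiagram} (h : ∀ i, lam.rowLen i = mu.rowLen i) :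
    lam = mu := by
  ext ⟨i, j⟩
  rw [YoungDiagram.mem_cells, YoungDiagram.mem_cells, YoungDiagram.mem_iff_lt_rowLen,
    YoungDiagram.mem_iff_lt_rowLen, h]

lemma mayaOf_injective (s : ℤ) : Function.Injective (mayaOf s) := by
  intro lam mu h
  have hanti : ∀ nu : YoungDiagram, StrictAnti fun i : ℕ => s + nu.rowLen i - i := by
    intro nu i j hij
    have := nu.rowLen_anti i j hij.le
    change s + nu.rowLen j - (j : ℕ) < s + nu.rowLen i - (i : ℕ)
    omega
  have hr : Set.range (fun i : ℕ => s + (lam.rowLen i : ℤ) - i) =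
      Set.range (fun i : ℕ => s + (mu.rowLen i : ℤ) - i) := congrArg Subtype.val h
  have := (StrictMono.range_inj (f := OrderDual.toDual ∘ fun i : ℕ => s + (lam.rowLen i : ℤ) - i)
    (g := OrderDual.toDual ∘ fun i : ℕ => s + (mu.rowLen i : ℤ) - i) (hanti lam) (hanti mu)).1 hr
  refine youngDiagram_ext fun i => ?_
  have h2 := congrFun this i
  have h3 : s + (lam.rowLen i : ℤ) - i = s + (mu.rowLen i : ℤ) - i := h2
  omega

/-- The parts are `λ_i = f i + i - s`: strict decrease of the integers `f i` makes them weakly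
decreasing, and `f i > s - N` makes the last one, hence all, nonnegative. -/
lemma IsEnum.exists_youngDiagram {s : ℤ} {S : Maya} {N : ℕ} {f : Fin N → ℤ} (h : IsEnum s S f) :
    ∃ lam, mayaOf s lam = S ∧ lam.colLen 0 ≤ N ∧
      ∀ i : Fin N, f i = s + lam.rowLen i - (i : ℕ) := by
  have hstep : ∀ i j : Fin N, i ≤ j → f j + (j : ℕ) ≤ f i + (i : ℕ) := by
    intro i j hij
    have hij' : (i : ℕ) ≤ j := hij
    obtain ⟨d, hd⟩ := Nat.exists_eq_add_of_le hij'
    clear hij'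
    induction d generalizing j with
    | zero => have : i = j := Fin.ext hd.symm
              rw [this]
    | succ d ih =>
      have := ih ⟨i + d, by omega⟩ (by rw [Fin.le_def]; simp) rfl
      have h2 : f j < f ⟨i + d, by omega⟩ := h.anti (by rw [Fin.lt_def]; simp [hd])
      simp only at this
      omega
  have hnn : ∀ i : Fin N, 0 ≤ f i + (i : ℕ) - s := by
    intro i
    have h1 := hstep i ⟨N - 1, by have := i.2; omega⟩ (by rw [Fin.le_def]; have := i.2; simp only; omega)
    have h2 := h.lt ⟨N - 1, by have := i.2; omega⟩
    simp only at h1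
    omega
  let g : Fin N → ℕ := fun i => (f i + (i : ℕ) - s).toNat
  have hg : Antitone g := by
    intro i j hij
    have := hstep i j hij
    simp only [g]
    omega
  have hsort : (List.ofFn g).SortedGE := by
    rw [List.sortedGE_ofFn_iff]; exact hg
  let lam := YoungDiagram.ofRowLens (List.ofFn g) hsort
  have hrow : ∀ i : Fin N, lam.rowLen i = g i := by
    intro i
    have := YoungDiagram.rowLen_ofRowLens (hw := hsort) (Fin.cast (by simp) i)
    simpa using this
  have hcol : lam.colLen 0 ≤ N := by
    by_contra hcon
    have : (N, 0) ∈ lam := YoungDiagram.mem_iff_lt_colLen.2 (by omega)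
    rw [YoungDiagram.mem_ofRowLens] at this
    obtain ⟨h1, _⟩ := this
    simp at h1
  have hf : ∀ i : Fin N, f i = s + lam.rowLen i - (i : ℕ) := by
    intro i
    rw [hrow]
    have := hnn i
    simp only [g]
    omega
  refine ⟨lam, Maya.ext fun x => ?_, hcol, hf⟩
  rw [(isEnum_mayaOf s lam hcol).mem, h.mem]
  simp_rw [hf]

end Enumeration

/-! ### Fermionic signs of moving one particle -/

section Move

variable {s : ℤ} {S : Maya} {M : ℕ}

lemma card_filter_lt_iff {g : Fin M → ℤ} (hg : StrictAnti g) (b : ℤ) (j : Fin M) :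
    (j : ℕ) < (Finset.univ.filter fun l => b < g l).card ↔ b < g j := by
  constructor
  · intro h
    by_contra hcon
    have hsub : (Finset.univ.filter fun l => b < g l) ⊆ Finset.Iio j := by
      intro l hl
      simp only [Finset.mem_filter, Finset.mem_univ, true_and] at hl
      rw [Finset.mem_Iio]
      by_contra h2
      have := hg.antitone (not_lt.1 h2)
      omega
    have := Finset.card_le_card hsub
    rw [Fin.card_Iio] at this
    omega
  · intro h
    have hsub : Finset.Iic j ⊆ (Finset.univ.filter fun l => b < g l) := by
      intro l hl
      rw [Finset.mem_Iic] at hl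
      simp only [Finset.mem_filter, Finset.mem_univ, true_and]
      have := hg.antitone hl
      omega
    have := Finset.card_le_card hsub
    rw [Fin.card_Iic] at this
    omega

/-- Moving a particle: the new enumeration and the two fermionic signs. -/
lemma IsEnum.move {f : Fin (M + 1) → ℤ} (h : IsEnum s S f) (i : Fin (M + 1)) {b : ℤ}
    (hb : b ∉ (S.remove (f i)).1) (hbN : s - (M + 1 : ℕ) < b) :
    ∃ i' : Fin (M + 1),
      IsEnum s ((S.remove (f i)).add b) (i'.insertNth b (f ∘ i.succAbove) : Fin (M + 1) → ℤ) ∧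
      S.sign (f i) = (-1) ^ (i : ℕ) ∧ (S.remove (f i)).sign b = (-1) ^ (i' : ℕ) := by
  set g := f ∘ i.succAbove with hg
  have hganti : StrictAnti g := fun x y hxy => h.anti (Fin.strictMono_succAbove i hxy)
  have hX : ∀ x, x ∈ (S.remove (f i)).1 ↔ x ≤ s - (M + 1 : ℕ) ∨ ∃ j, g j = x := by
    intro x
    rw [Maya.mem_remove, h.mem]
    constructor
    · rintro ⟨h1 | ⟨j, rfl⟩, h2⟩
      · exact Or.inl h1
      · right
        obtain ⟨l, hl⟩ := Fin.exists_succAbove_eq (x := j) (y := i) (by rintro rfl; exact h2 rfl)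
        exact ⟨l, congrArg f hl⟩
    · rintro (h1 | ⟨j, rfl⟩)
      · exact ⟨Or.inl h1, fun h2 => by have := h.lt i; omega⟩
      · exact ⟨Or.inr ⟨_, rfl⟩, fun h2 => Fin.succAbove_ne i j (h.anti.injective h2)⟩
  have hcard : (Finset.univ.filter fun l => b < g l).card < M + 1 := by
    have := Finset.card_filter_le (Finset.univ : Finset (Fin M)) (fun l => b < g l)
    simp at this
    omega
  -- The number of remaining particles above `b` is both the new position of the particle and the
  -- exponent of its fermionic sign.
  let i' : Fin (M + 1) := ⟨_, hcard⟩
  have hi' : ∀ j : Fin M, j.castSucc < i' ↔ b < g j := fun j => card_filter_lt_iff hganti b j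
  have hbg : ∀ j, g j ≠ b := fun j hj => hb ((hX b).2 (Or.inr ⟨j, hj⟩))
  refine ⟨i', ⟨?_, ?_, ?_⟩, ?_, ?_⟩
  · intro x y hxy
    rcases Fin.eq_self_or_eq_succAbove i' x with rfl | ⟨x, rfl⟩ <;>
    rcases Fin.eq_self_or_eq_succAbove i' y with rfl | ⟨y, rfl⟩
    · exact absurd hxy (lt_irrefl _)
    · rw [Fin.insertNth_apply_same, Fin.insertNth_apply_succAbove]
      rw [Fin.lt_succAbove_iff_le_castSucc] at hxy
      have := (hi' y).not.1 (not_lt.2 hxy)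
      have := hbg y
      omega
    · rw [Fin.insertNth_apply_same, Fin.insertNth_apply_succAbove]
      rw [Fin.succAbove_lt_iff_castSucc_lt] at hxy
      exact (hi' x).1 hxy
    · rw [Fin.insertNth_apply_succAbove, Fin.insertNth_apply_succAbove]
      exact hganti ((Fin.strictMono_succAbove i').lt_iff_lt.1 hxy)
  · intro x
    rcases Fin.eq_self_or_eq_succAbove i' x with rfl | ⟨x, rfl⟩
    · rw [Fin.insertNth_apply_same]; exact hbN
    · rw [Fin.insertNth_apply_succAbove]; exact h.lt _
  · intro x
    rw [Maya.mem_add, hX, Fin.exists_iff_succAbove i']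
    simp only [Fin.insertNth_apply_same, Fin.insertNth_apply_succAbove]
    rw [eq_comm]
    tauto
  · have : {x | x ∈ S.1 ∧ f i < x} = f '' (Finset.Iio i : Finset (Fin (M + 1))) := by
      ext x
      simp only [Set.mem_ofPred_eq, h.mem, Set.mem_image, Finset.coe_Iio, Set.mem_Iio]
      constructor
      · rintro ⟨h1 | ⟨j, rfl⟩, h2⟩
        · have := h.lt i; omega
        · exact ⟨j, h.anti.lt_iff_gt.1 h2, rfl⟩
      · rintro ⟨j, hj, rfl⟩
        exact ⟨Or.inr ⟨j, rfl⟩, h.anti hj⟩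
    rw [Maya.sign, this, Set.ncard_image_of_injective _ h.anti.injective, Set.ncard_coe_finset,
      Fin.card_Iio]
  · have : {x | x ∈ (S.remove (f i)).1 ∧ b < x} =
        g '' (Finset.univ.filter fun l => b < g l : Finset (Fin M)) := by
      ext x
      simp only [Set.mem_ofPred_eq, hX, Set.mem_image, Finset.coe_filter, Finset.mem_univ, true_and]
      constructor
      · rintro ⟨h1 | ⟨j, rfl⟩, h2⟩
        · omega
        · exact ⟨j, h2, rfl⟩
      · rintro ⟨j, hj, rfl⟩
        exact ⟨Or.inr ⟨j, rfl⟩, hj⟩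
    rw [Maya.sign, this, Set.ncard_image_of_injective _ hganti.injective, Set.ncard_coe_finset]

end Move

/-! ### The Schur vector and the action of the currents -/

section SchurVec

variable {R : Type*} [CommRing R] [Algebra ℚ R]

open Classical in
/-- The vector `∑_λ s_λ[t] |λ, s⟩`, with coefficients in an arbitrary ring. -/
def schurVec (t : ℕ+ → R) (s : ℤ) (S : Maya) : R :=
  if h : ∃ lam, mayaOf s lam = S then schur t h.choose else 0

lemma schurVec_mayaOf (t : ℕ+ → R) (s : ℤ) (lam : YoungDiagram) :
    schurVec t s (mayaOf s lam) = schur t lam := by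
  have h : ∃ mu, mayaOf s mu = mayaOf s lam := ⟨lam, rfl⟩
  rw [schurVec, dif_pos h, mayaOf_injective s h.choose_spec]

lemma schurVec_of_not (t : ℕ+ → R) (s : ℤ) {S : Maya} (h : ¬∃ lam, mayaOf s lam = S) :
    schurVec t s S = 0 := by
  rw [schurVec, dif_neg h]

lemma schurVec_eq_jt (t : ℕ+ → R) {s : ℤ} {S : Maya} {N : ℕ} {f : Fin N → ℤ}
    (h : IsEnum s S f) : schurVec t s S = jt t (fun i => f i - s) := by
  obtain ⟨lam, rfl, hN, hf⟩ := h.exists_youngDiagram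
  rw [schurVec_mayaOf, schur_eq_jt t lam hN]
  congr 1
  ext i
  rw [hf]; ring

lemma map_neg_one_pow_mul (φ : R →+ TimeSeries) (n : ℕ) (x : R) :
    φ ((-1) ^ n * x) = (-1) ^ n * φ x := by
  rcases neg_one_pow_eq_or R n with h | h <;> rcases Nat.even_or_odd n with h2 | h2 <;>
    simp [h2.neg_one_pow]

/-- A particle hop is the replacement of one row index. The map `φ` is only additive because it will
extract a coefficient in an auxiliary grading variable. The hypothesis `hlow` says that levels below
the cutoff cannot hop, their partner level being occupied. -/
lemma sum_hop_schurVec (φ : R →+ TimeSeries) (t : ℕ+ → R) {s : ℤ} {S : Maya} {M : ℕ}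
    {f : Fin (M + 1) → ℤ} (h : IsEnum s S f) {k : ℤ} (hk : k ≠ 0)
    (hlow : ∀ a ≤ s - (M + 1 : ℕ), a + k ∈ S.1) :
    ∑ᶠ a : ℤ, hop a (a + k) (fun T => φ (schurVec t s T)) S =
      φ (∑ i, jt t (Function.update (fun j => f j - s) i (f i - s + k))) := by
  rw [finsum_eq_sum_of_support_subset (s := Finset.univ.image f), map_sum,
    Finset.sum_image (fun x _ y _ hxy => h.anti.injective hxy)]
  · refine Finset.sum_congr rfl fun i _ => ?_
    have hi : f i ∈ S.1 := (h.mem _).2 (Or.inr ⟨i, rfl⟩)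
    -- A blocked hop has a vanishing determinant: the level is either in the filled sea, which gives
    -- a zero row, or already listed, which gives two equal rows.
    by_cases hb : f i + k ∈ (S.remove (f i)).1
    · rw [hop_of_not _ (by tauto)]
      rcases (h.mem _).1 hb.1 with h1 | ⟨j, hj⟩
      · rw [jt_eq_zero_of_le t _ (i := i) (by simp; omega), map_zero]
      · have hji : j ≠ i := by rintro rfl; omega
        rw [jt_eq_zero_of_eq t _ hji (by simp [Function.update_of_ne hji, hj]; ring), map_zero]
    · have hbN : s - (M + 1 : ℕ) < f i + k := by
        by_contra hcon
        exact hb (Maya.mem_remove.2 ⟨(h.mem _).2 (Or.inl (not_lt.1 hcon)), by omega⟩)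
      obtain ⟨i', he, h1, h2⟩ := h.move i hb hbN
      rw [hop_of _ hi hb, schurVec_eq_jt t he, h1, h2, ← map_neg_one_pow_mul,
        ← map_neg_one_pow_mul]
      congr 1
      -- The same new entry is inserted at `i'` in the sorted list and at `i` in the updated list.
      -- Either insertion is `(-1)` to its position times insertion in front, and these signs match
      -- the two fermionic ones.
      have e1 : (fun j => (i'.insertNth (f i + k) (f ∘ i.succAbove) : Fin (M + 1) → ℤ) j - s) =
          i'.insertNth (f i - s + k) (fun j => f (i.succAbove j) - s) := by
        ext j
        rcases Fin.eq_self_or_eq_succAbove i' j with rfl | ⟨j, rfl⟩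
        · simp; ring
        · simp
      have e2 : Function.update (fun j => f j - s) i (f i - s + k) =
          i.insertNth (f i - s + k) (fun j => f (i.succAbove j) - s) := by
        ext j
        rcases Fin.eq_self_or_eq_succAbove i j with rfl | ⟨j, rfl⟩
        · simp
        · simp
      rw [e1, e2, jt_insertNth, jt_insertNth, ← mul_assoc ((-1) ^ (i' : ℕ)), ← mul_pow]
      simp
  · intro a ha
    by_contra hcon
    apply ha
    refine hop_of_not _ ?_
    rintro ⟨h1, h2⟩
    rcases (h.mem a).1 h1 with h3 | ⟨j, hj⟩
    · exact h2 (Maya.mem_remove.2 ⟨hlow a h3, by omega⟩)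
    · exact hcon (by simp [← hj])

/-- Moving particles preserves the charge. -/
lemma exists_mayaOf_of_move {s : ℤ} {S : Maya} {a b : ℤ} (ha : a ∈ S.1)
    (hb : b ∉ (S.remove a).1) (h : ∃ lam, mayaOf s lam = S) :
    ∃ lam, mayaOf s lam = (S.remove a).add b := by
  obtain ⟨lam, rfl⟩ := h
  obtain ⟨M, hM⟩ : ∃ M, M = lam.colLen 0 + (s - a).toNat + (s - b).toNat := ⟨_, rfl⟩
  have he := isEnum_mayaOf s lam (N := M + 1) (by omega)
  rcases (he.mem a).1 ha with h1 | ⟨i, rfl⟩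
  · omega
  · obtain ⟨i', he', -, -⟩ := he.move i hb (by omega)
    obtain ⟨mu, hmu, -⟩ := he'.exists_youngDiagram
    exact ⟨mu, hmu⟩

/-- Otherwise the reverse hop would carry a state of charge `s` to `S`. -/
lemma hop_eq_zero_of_charge {s : ℤ} {v : Fock} (hv : ∀ T, (¬∃ lam, mayaOf s lam = T) → v T = 0)
    {S : Maya} (hS : ¬∃ lam, mayaOf s lam = S) (a b : ℤ) : hop a b v S = 0 := by
  by_cases h : a ∈ S.1 ∧ b ∉ (S.remove a).1
  · rw [hop_of _ h.1 h.2, hv, mul_zero, mul_zero]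
    intro hc
    apply hS
    have h1 : b ∈ ((S.remove a).add b).1 := by simp
    have h2 : a ∉ (((S.remove a).add b).remove b).1 := by
      simp only [Maya.mem_remove, Maya.mem_add]; tauto
    have := exists_mayaOf_of_move h1 h2 hc
    have h3 : (((S.remove a).add b).remove b).add a = S := by
      refine Maya.ext fun x => ?_
      have hb := h.2
      simp only [Maya.mem_remove, Maya.mem_add] at hb ⊢
      by_cases hx : x = a
      · simp [hx, h.1]
      · by_cases hxb : x = b
        · subst hxb; tauto
        · tauto
    rwa [h3] at this
  · exact hop_of_not _ h

/-- `J_{-k}` on the Schur vector. -/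
lemma J_neg_schurVec (φ : R →+ TimeSeries) (t : ℕ+ → R) (s : ℤ) (lam : YoungDiagram) {N : ℕ}
    (hN : lam.colLen 0 < N) {k : ℕ} (hk : 0 < k) :
    J (-(k : ℤ)) (fun T => φ (schurVec t s T)) (mayaOf s lam) =
      φ (∑ i : Fin N, jt t (Function.update (fun j : Fin N => (lam.rowLen j : ℤ) - (j : ℕ)) i
        ((lam.rowLen i : ℤ) - (i : ℕ) - k))) := by
  obtain ⟨M, rfl⟩ : ∃ M, N = M + 1 := ⟨N - 1, by omega⟩
  have he := isEnum_mayaOf s lam hN.le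
  rw [J_apply (by omega), sum_hop_schurVec φ t he (by omega)]
  · congr 1
    refine Finset.sum_congr rfl fun i _ => ?_
    congr 1
    ext j
    by_cases h : j = i
    · subst h; simp; ring
    · simp [Function.update_of_ne h]; ring
  · intro a ha
    exact (he.mem _).2 (Or.inl (by omega))

/-- `J_k` acts on the Schur vector as multiplication by `p_k`. -/
lemma J_schurVec (φ : R →+ TimeSeries) (t : ℕ+ → R) (s : ℤ) (S : Maya) {k : ℕ} (hk : 0 < k) :
    J k (fun T => φ (schurVec t s T)) S = φ (psum t k * schurVec t s S) := by
  by_cases hS : ∃ lam, mayaOf s lam = S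
  swap
  · rw [schurVec_of_not t s hS, mul_zero, map_zero, J_apply (by omega)]
    exact finsum_eq_zero_of_forall_eq_zero fun a => hop_eq_zero_of_charge
      (fun T hT => by rw [schurVec_of_not t s hT, map_zero]) hS _ _
  obtain ⟨lam, rfl⟩ := hS
  -- With `k` empty rows appended, the last `k` row indices are those of the ground state, as
  -- `jt_murnaghanNakayama` requires.
  have hN : lam.colLen 0 + k = (lam.colLen 0 + k - 1) + 1 := by omega
  have he := isEnum_mayaOf s lam (N := (lam.colLen 0 + k - 1) + 1) (by omega)
  rw [J_apply (by omega), sum_hop_schurVec φ t he (by omega)]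
  · congr 1
    have h1 := jt_murnaghanNakayama t (lam.colLen 0) hk
      (fun j => (lam.rowLen j : ℤ) - (j : ℕ)) (fun i => by
        rw [rowLen_eq_zero (by simp)]; simp)
    rw [schurVec_mayaOf, schur_eq_jt t lam (N := lam.colLen 0 + k) (by omega), ← h1]
    have key : ∀ N N' : ℕ, N = N' →
        ∑ i : Fin N, jt t (Function.update (fun j : Fin N => s + (lam.rowLen j : ℤ) - (j : ℕ) - s) i
          (s + (lam.rowLen i : ℤ) - (i : ℕ) - s + k)) =
        ∑ i : Fin N', jt t (Function.update (fun j : Fin N' => (lam.rowLen j : ℤ) - (j : ℕ)) i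
          ((lam.rowLen i : ℤ) - (i : ℕ) + k)) := by
      rintro N _ rfl
      refine Finset.sum_congr rfl fun i _ => ?_
      congr 1
      ext j
      by_cases h : j = i
      · subst h; simp; ring
      · simp [Function.update_of_ne h]; ring
    exact key _ _ hN.symm
  · intro a ha
    rw [he.mem]
    by_cases h : a + k ≤ s - ((lam.colLen 0 + k - 1 + 1 : ℕ) : ℤ)
    · exact Or.inl h
    · right
      refine ⟨⟨(s - (a + k)).toNat, by omega⟩, ?_⟩
      simp only
      rw [rowLen_eq_zero (by omega)]
      omega

end SchurVec

/-! ### Matrix elements of the currents and their symmetry -/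

section Edge

lemma Maya.exists_bound (S : Maya) : ∃ B : ℤ, (∀ x ∈ S.1, x ≤ B) ∧ ∀ x, x ∉ S.1 → -B < x := by
  obtain ⟨B1, h1⟩ := S.2.1.bddAbove
  obtain ⟨B2, h2⟩ := S.2.2.bddBelow
  refine ⟨max (max B1 (1 - B2)) 0, fun x hx => ?_, fun x hx => ?_⟩
  · by_cases h : x ≤ 0
    · omega
    · have := h1 ⟨hx, by simpa using h⟩
      omega
  · by_cases h : x ≤ 0
    · have := h2 ⟨by simpa using h, hx⟩
      omega
    · omega

lemma finite_hop_support (S : Maya) {k : ℤ} (hk : k ≠ 0) :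
    {a : ℤ | a ∈ S.1 ∧ a + k ∉ (S.remove a).1}.Finite := by
  obtain ⟨B, h1, h2⟩ := S.exists_bound
  refine (Set.finite_Icc (-B - |k|) B).subset ?_
  rintro a ⟨ha, hb⟩
  have := h1 a ha
  have h3 : a + k ∉ S.1 := fun h => hb (Maya.mem_remove.2 ⟨h, by omega⟩)
  have := h2 _ h3
  have := le_abs_self k
  exact ⟨by omega, by omega⟩

open Classical in
/-- The basis vector `|S⟩`. -/
def ket (S : Maya) : Fock := fun T => if T = S then 1 else 0

/-- The transpose of a hop is the reverse hop. Both pass through the same intermediate diagram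
`S.remove a = T.remove b`, with the same two signs. -/
lemma hop_ket_symm (a b : ℤ) (S T : Maya) : hop a b (ket T) S = hop b a (ket S) T := by
  have key : ∀ (a b : ℤ) (S T : Maya), hop a b (ket T) S ≠ 0 →
      hop a b (ket T) S = hop b a (ket S) T := by
    intro a b S T h
    by_cases hc : a ∈ S.1 ∧ b ∉ (S.remove a).1
    swap
    · exact absurd (hop_of_not _ hc) h
    obtain ⟨ha, hb⟩ := hc
    rw [hop_of _ ha hb] at h ⊢
    have hT : (S.remove a).add b = T := by
      by_contra hne
      rw [ket, if_neg hne, mul_zero, mul_zero] at h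
      exact h rfl
    have hX : T.remove b = S.remove a := by
      subst hT
      refine Maya.ext fun x => ?_
      rw [Maya.mem_remove] at hb
      simp only [Maya.mem_remove, Maya.mem_add]
      by_cases hx : x = b
      · subst hx; tauto
      · tauto
    have hS : (S.remove a).add a = S := Maya.ext fun x => by
      by_cases hx : x = a <;> simp [hx, ha]
    have hsign : ∀ (U : Maya) (c : ℤ), (U.remove c).sign c = U.sign c := by
      intro U c
      unfold Maya.sign
      congr 2
      ext x
      simp only [Maya.mem_remove, Set.mem_ofPred_eq]
      constructor
      · tauto
      · intro hx; exact ⟨⟨hx.1, hx.2.ne'⟩, hx.2⟩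
    rw [hop_of (ket S) (a := b) (b := a) (by rw [← hT]; simp) (by rw [hX]; simp), hX, hS, hT,
      ← hX, hsign, hX, ← hsign S a]
    simp only [ket, if_true, mul_one]
    ring
  by_cases h : hop a b (ket T) S = 0
  · by_cases h2 : hop b a (ket S) T = 0
    · rw [h, h2]
    · exact (key _ _ _ _ h2).symm
  · exact key _ _ _ _ h

/-- The matrix element of `J_k` between two basis vectors. -/
def edge (k : ℤ) (S T : Maya) : TimeSeries := J k (ket T) S

lemma edge_symm {k : ℤ} (hk : k ≠ 0) (S T : Maya) : edge k S T = edge (-k) T S := by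
  unfold edge
  rw [J_apply hk, J_apply (by omega), ← finsum_comp_equiv (Equiv.addRight k)
    (f := fun a => hop a (a + -k) (ket S) T)]
  refine finsum_congr fun a => ?_
  rw [hop_ket_symm]
  simp

lemma hop_eq_hop_ket_mul (a b : ℤ) (v : Fock) (S : Maya) :
    hop a b v S = hop a b (ket ((S.remove a).add b)) S * v ((S.remove a).add b) := by
  by_cases hc : a ∈ S.1 ∧ b ∉ (S.remove a).1
  · rw [hop_of _ hc.1 hc.2, hop_of _ hc.1 hc.2]
    simp only [ket, if_true]
    ring
  · rw [hop_of_not _ hc, hop_of_not _ hc, zero_mul]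

lemma hop_ket_of_ne {a b : ℤ} {S T : Maya} (h : T ≠ (S.remove a).add b) :
    hop a b (ket T) S = 0 := by
  rw [hop_eq_hop_ket_mul, ket, if_neg h.symm, mul_zero]

lemma J_eq_sum {k : ℤ} (hk : k ≠ 0) (v : Fock) (S : Maya) :
    J k v S = ∑ a ∈ (finite_hop_support S hk).toFinset, hop a (a + k) v S := by
  rw [J_apply hk]
  refine finsum_eq_sum_of_support_subset _ fun a ha => ?_
  simp only [Set.Finite.coe_toFinset, Set.mem_ofPred_eq]
  by_contra hcon
  exact ha (hop_of_not _ hcon)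

lemma finite_edge {k : ℤ} (hk : k ≠ 0) (S : Maya) : {T | edge k S T ≠ 0}.Finite := by
  refine ((finite_hop_support S hk).image fun a => (S.remove a).add (a + k)).subset ?_
  intro T hT
  rw [Set.mem_ofPred_eq, edge, J_eq_sum hk] at hT
  obtain ⟨a, ha, h⟩ := Finset.exists_ne_zero_of_sum_ne_zero hT
  refine ⟨a, by simpa using ha, ?_⟩
  by_contra hne
  exact h (hop_ket_of_ne (Ne.symm hne))

/-- For `k ≠ 0` only finitely many hops end in `S`, so each row of the matrix of `J_k` is finite and
the operator is given by its matrix. -/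
lemma hasSum_edge_mul {k : ℤ} (hk : k ≠ 0) (v : Fock) (S : Maya) :
    HasSum (fun T => edge k S T * v T) (J k v S) := by
  have h : ∀ T, edge k S T * v T = ∑ a ∈ (finite_hop_support S hk).toFinset,
      hop a (a + k) (ket T) S * v T := by
    intro T
    rw [edge, J_eq_sum hk, Finset.sum_mul]
  simp_rw [h]
  rw [J_eq_sum hk]
  refine hasSum_sum fun a _ => ?_
  rw [hop_eq_hop_ket_mul]
  exact hasSum_single _ fun T hT => by rw [hop_ket_of_ne hT, zero_mul]

end Edge

/-! ### Coefficientwise summability and the order filtration -/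

section Coefficients

open MvPowerSeries

lemma exists_of_coeff_mul_ne_zero {e : ℕ+ ⊕ ℕ+ →₀ ℕ} {f g : TimeSeries}
    (h : coeff e (f * g) ≠ 0) :
    ∃ e₁ e₂, e₁ + e₂ = e ∧ coeff e₁ f ≠ 0 ∧ coeff e₂ g ≠ 0 := by
  classical
  rw [coeff_mul] at h
  obtain ⟨⟨a, b⟩, hab, h⟩ := Finset.exists_ne_zero_of_sum_ne_zero h
  exact ⟨a, b, by simpa using hab, left_ne_zero_of_mul h, right_ne_zero_of_mul h⟩

lemma exists_of_coeff_X_mul_ne_zero {e : ℕ+ ⊕ ℕ+ →₀ ℕ} {i : ℕ+ ⊕ ℕ+} {g : TimeSeries}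
    (h : coeff e (X i * g) ≠ 0) :
    ∃ e₂, Finsupp.single i 1 + e₂ = e ∧ coeff e₂ g ≠ 0 := by
  classical
  obtain ⟨e₁, e₂, h1, h2, h3⟩ := exists_of_coeff_mul_ne_zero h
  rw [coeff_X] at h2
  obtain rfl : e₁ = Finsupp.single i 1 := by by_contra hne; exact h2 (if_neg hne)
  exact ⟨e₂, h1, h3⟩

lemma summable_of_finite_coeff {ι : Type*} {f : ι → TimeSeries}
    (h : ∀ e, {i | coeff e (f i) ≠ 0}.Finite) : Summable f := by
  rw [WithPiTopology.summable_iff_summable_coeff]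
  exact fun e => summable_of_hasFiniteSupport (h e)

/-- A fixed monomial involves finitely many variables, so only finitely many `k` reach it. -/
lemma summable_X_mul {ι : ℕ+ → ℕ+ ⊕ ℕ+} (hι : Function.Injective ι) (y : ℕ+ → TimeSeries) :
    Summable fun k => X (ι k) * y k := by
  refine summable_of_finite_coeff fun e => ?_
  refine (e.support.finite_toSet.preimage (f := ι) hι.injOn).subset fun k hk => ?_
  obtain ⟨e₂, rfl, -⟩ := exists_of_coeff_X_mul_ne_zero hk
  simp

lemma coeff_tsum {ι : Type*} {f : ι → TimeSeries} (hf : Summable f) (e : ℕ+ ⊕ ℕ+ →₀ ℕ) :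
    HasSum (fun i => coeff e (f i)) (coeff e (∑' i, f i)) :=
  WithPiTopology.hasSum_iff_hasSum_coeff.1 hf.hasSum e

/-- The power series without terms of total degree less than `n`. -/
def orderIdeal (n : ℕ) : Ideal TimeSeries where
  carrier := {x | ∀ e : ℕ+ ⊕ ℕ+ →₀ ℕ, e.degree < n → coeff e x = 0}
  add_mem' ha hb e he := by rw [map_add, ha e he, hb e he, add_zero]
  zero_mem' _ _ := map_zero _
  smul_mem' c x hx e he := by
    by_contra h
    rw [smul_eq_mul] at h
    obtain ⟨e₁, e₂, rfl, -, h2⟩ := exists_of_coeff_mul_ne_zero h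
    refine h2 (hx e₂ ?_)
    rw [map_add] at he
    omega

lemma smul_mem_orderIdeal {n : ℕ} {x : TimeSeries} (c : ℂ) (hx : x ∈ orderIdeal n) :
    c • x ∈ orderIdeal n := by
  rw [smul_eq_C_mul]
  exact Ideal.mul_mem_left _ _ hx

lemma J_mem_orderIdeal {n : ℕ} {k : ℤ} (hk : k ≠ 0) {v : Fock} (hv : ∀ S, v S ∈ orderIdeal n)
    (S : Maya) : J k v S ∈ orderIdeal n := by
  rw [J_eq_sum hk]
  refine Ideal.sum_mem _ fun a _ => ?_
  rw [hop_eq_hop_ket_mul]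
  exact Ideal.mul_mem_left _ _ (hv _)

lemma tsum_X_mul_mem_orderIdeal {ι : ℕ+ → ℕ+ ⊕ ℕ+} (hι : Function.Injective ι) {n : ℕ}
    {y : ℕ+ → TimeSeries} (hy : ∀ k, y k ∈ orderIdeal n) :
    ∑' k, X (ι k) * y k ∈ orderIdeal (n + 1) := by
  intro e he
  refine (coeff_tsum (summable_X_mul hι y) e).unique ?_
  convert hasSum_zero with k
  by_contra h
  obtain ⟨e₂, rfl, h2⟩ := exists_of_coeff_X_mul_ne_zero h
  refine h2 (hy k e₂ ?_)
  rw [map_add, Finsupp.degree_single] at he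
  omega

lemma iterate_mem_orderIdeal {A : Fock → Fock} (hA : ∀ n v, (∀ S, v S ∈ orderIdeal n) →
    ∀ S, A v S ∈ orderIdeal (n + 1)) (v : Fock) (n : ℕ) (S : Maya) :
    (A^[n] v) S ∈ orderIdeal n := by
  induction n generalizing S with
  | zero => intro e he; omega
  | succ n ih =>
    rw [Function.iterate_succ_apply']
    exact hA n _ ih S

/-- The `n`-th power of `A` has order at least `n`, so each coefficient of the exponential series is
a finite sum. -/
lemma opExpConverges_of_orderIdeal {A : Fock → Fock} (hA : ∀ n v, (∀ S, v S ∈ orderIdeal n) →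
    ∀ S, A v S ∈ orderIdeal (n + 1)) : OpExpConverges A := by
  intro v S
  refine summable_of_finite_coeff fun e => (Set.finite_Iic e.degree).subset fun n hn => ?_
  by_contra h
  rw [Set.mem_Iic, not_le] at h
  exact hn (smul_mem_orderIdeal _ (iterate_mem_orderIdeal hA v n S) e h)

lemma Jplus_tVar_mem_orderIdeal (n : ℕ) (v : Fock) (hv : ∀ S, v S ∈ orderIdeal n) (S : Maya) :
    Jplus tVar v S ∈ orderIdeal (n + 1) :=
  tsum_X_mul_mem_orderIdeal Sum.inl_injective fun k => J_mem_orderIdeal (by positivity) hv S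

lemma Jminus_tVar_mem_orderIdeal (n : ℕ) (v : Fock) (hv : ∀ S, v S ∈ orderIdeal n) (S : Maya) :
    Jminus tVar v S ∈ orderIdeal (n + 1) :=
  tsum_X_mul_mem_orderIdeal Sum.inl_injective fun k => J_mem_orderIdeal (by simp) hv S

lemma neg_Jminus_tbarVar_mem_orderIdeal (n : ℕ) (v : Fock) (hv : ∀ S, v S ∈ orderIdeal n)
    (S : Maya) : (-Jminus tbarVar) v S ∈ orderIdeal (n + 1) :=
  neg_mem (tsum_X_mul_mem_orderIdeal Sum.inr_injective fun k => J_mem_orderIdeal (by simp) hv S)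

end Coefficients

/-! ### Adjointness of `J_+[t]` and `J_-[t]` -/

section Adjoint

open MvPowerSeries

/-- In each coefficient only finitely many components of the vector are nonzero. -/
def LocallyFiniteVec (w : Fock) : Prop := ∀ e, {S | coeff e (w S) ≠ 0}.Finite

lemma LocallyFiniteVec.finite_le {w : Fock} (hw : LocallyFiniteVec w) (e : ℕ+ ⊕ ℕ+ →₀ ℕ) :
    {S | ∃ e₁ ≤ e, coeff e₁ (w S) ≠ 0}.Finite := by
  have : {S | ∃ e₁ ≤ e, coeff e₁ (w S) ≠ 0} = ⋃ e₁ ∈ Set.Iic e, {S | coeff e₁ (w S) ≠ 0} := by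
    ext S; simp
  rw [this]
  exact (Set.finite_Iic e).biUnion fun e₁ _ => hw e₁

lemma finite_setOf_inl (e : ℕ+ ⊕ ℕ+ →₀ ℕ) : {k : ℕ+ | Sum.inl k ∈ e.support}.Finite :=
  e.support.finite_toSet.preimage (f := Sum.inl) Sum.inl_injective.injOn

lemma summable_adjoint {w : Fock} (hw : LocallyFiniteVec w) (v : Fock) :
    Summable fun x : Maya × (ℕ+ × Maya) =>
      w x.1 * (tVar x.2.1 * (edge (x.2.1 : ℤ) x.1 x.2.2 * v x.2.2)) := by
  refine summable_of_finite_coeff fun e => ?_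
  have hfin : (⋃ S ∈ {S | ∃ e₁ ≤ e, coeff e₁ (w S) ≠ 0},
      ⋃ k ∈ {k : ℕ+ | Sum.inl k ∈ e.support},
        (fun T => (S, (k, T))) '' {T | edge (k : ℤ) S T ≠ 0}).Finite :=
    (hw.finite_le e).biUnion fun S _ => (finite_setOf_inl e).biUnion fun k _ =>
      (finite_edge (by positivity) S).image _
  refine hfin.subset ?_
  rintro ⟨S, k, T⟩ h
  obtain ⟨e₁, e₂, rfl, h1, h2⟩ := exists_of_coeff_mul_ne_zero h
  obtain ⟨e₃, rfl, h3⟩ := exists_of_coeff_X_mul_ne_zero h2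
  simp only [Set.mem_iUnion, Set.mem_image]
  refine ⟨S, ⟨e₁, le_self_add, h1⟩, k, by simp, T, ?_, rfl⟩
  intro h4
  simp only at h3
  rw [h4, zero_mul, map_zero] at h3
  exact h3 rfl

/-- Fubini for the triple sum over `(S, k, T)`, summed first over `T`, then over `k`. -/
lemma hasSum_mul_tsum {w v : Fock} {E : ℕ+ → Maya → Maya → TimeSeries}
    {y : ℕ+ → Maya → TimeSeries} (hE : ∀ k S, HasSum (fun T => E k S T * v T) (y k S))
    {ι : ℕ+ → ℕ+ ⊕ ℕ+} (hι : Function.Injective ι)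
    (hs : Summable fun x : Maya × (ℕ+ × Maya) =>
      w x.1 * (X (ι x.2.1) * (E x.2.1 x.1 x.2.2 * v x.2.2))) :
    HasSum (fun S => w S * ∑' k, X (ι k) * y k S) (∑' x : Maya × (ℕ+ × Maya),
      w x.1 * (X (ι x.2.1) * (E x.2.1 x.1 x.2.2 * v x.2.2))) := by
  refine hs.hasSum.prod_fiberwise fun S => ?_
  have h1 : Summable fun x : ℕ+ × Maya => w S * (X (ι x.1) * (E x.1 S x.2 * v x.2)) :=
    hs.prod_factor S
  have h2 : HasSum (fun k => w S * (X (ι k) * y k S)) _ :=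
    h1.hasSum.prod_fiberwise fun k => ((hE k S).mul_left (X (ι k))).mul_left (w S)
  have h3 := (summable_X_mul hι fun k => y k S).hasSum.mul_left (w S)
  rw [h3.unique h2]
  exact h1.hasSum

/-- `J_+[t]` and `J_-[t]` are adjoint to each other. -/
lemma exists_hasSum_adjoint {w : Fock} (hw : LocallyFiniteVec w) (v : Fock) :
    ∃ x, HasSum (fun S => w S * Jplus tVar v S) x ∧ HasSum (fun S => Jminus tVar w S * v S) x := by
  have hs := summable_adjoint hw v
  refine ⟨_, hasSum_mul_tsum (fun k S => hasSum_edge_mul (by positivity) v S)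
    Sum.inl_injective hs, ?_⟩
  -- Exchanging the two diagrams and using `edge_symm` turns the expansion of one pairing into that
  -- of the other.
  let e : Maya × (ℕ+ × Maya) ≃ Maya × (ℕ+ × Maya) :=
    ⟨fun x => (x.2.2, (x.2.1, x.1)), fun x => (x.2.2, (x.2.1, x.1)), fun _ => rfl, fun _ => rfl⟩
  have hE : ∀ (k : ℕ+) S, HasSum (fun T => edge (k : ℤ) T S * w T) (J (-(k : ℤ)) w S) := by
    intro k S
    have := hasSum_edge_mul (k := -(k : ℤ)) (by simp) w S
    convert this using 3 with T
    exact edge_symm (by positivity) _ _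
  have hre : (fun x : Maya × (ℕ+ × Maya) =>
      w x.1 * (tVar x.2.1 * (edge (x.2.1 : ℤ) x.1 x.2.2 * v x.2.2))) ∘ e =
      fun x : Maya × (ℕ+ × Maya) =>
        v x.1 * (X (Sum.inl x.2.1) * (edge (x.2.1 : ℤ) x.2.2 x.1 * w x.2.2)) := by
    ext1 x
    simp only [Function.comp, e, Equiv.coe_fn_mk, tVar]
    ring
  have h2 := hasSum_mul_tsum (w := v) (v := w) (E := fun k S T => edge (k : ℤ) T S) hE
    Sum.inl_injective (by rw [← hre]; exact (e.summable_iff).2 hs)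
  have h3 := congrArg (fun F => ∑' x, F x) hre
  have h4 := e.tsum_eq fun x : Maya × (ℕ+ × Maya) =>
    w x.1 * (tVar x.2.1 * (edge (x.2.1 : ℤ) x.1 x.2.2 * v x.2.2))
  convert h2 using 1
  · ext1 S; exact mul_comm _ _
  · exact h4.symm.trans h3

/-- A coefficient of the image at `T` comes from one of finitely many `S` and `k`, and each such
pair reaches finitely many `T`. -/
lemma LocallyFiniteVec.jminus {w : Fock} (hw : LocallyFiniteVec w) :
    LocallyFiniteVec (Jminus tVar w) := by
  intro e
  have hfin : (⋃ S ∈ {S | ∃ e₁ ≤ e, coeff e₁ (w S) ≠ 0},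
      ⋃ k ∈ {k : ℕ+ | Sum.inl k ∈ e.support}, {T | edge (k : ℤ) S T ≠ 0}).Finite :=
    (hw.finite_le e).biUnion fun S _ => (finite_setOf_inl e).biUnion fun k _ =>
      finite_edge (by positivity) S
  refine hfin.subset fun T hT => ?_
  have h1 : ∃ k : ℕ+, coeff e (tVar k * J (-(k : ℤ)) w T) ≠ 0 := by
    by_contra hcon
    push Not at hcon
    refine hT ((coeff_tsum (summable_X_mul Sum.inl_injective fun k => J (-(k : ℤ)) w T) e).unique ?_)
    convert hasSum_zero with k
    exact hcon k
  obtain ⟨k, hk⟩ := h1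
  obtain ⟨e₂, rfl, h2⟩ := exists_of_coeff_X_mul_ne_zero hk
  have h3 : ∃ S, coeff e₂ (edge (-(k : ℤ)) T S * w S) ≠ 0 := by
    by_contra hcon
    push Not at hcon
    refine h2 ((WithPiTopology.hasSum_iff_hasSum_coeff.1
      (hasSum_edge_mul (k := -(k : ℤ)) (by simp) w T) e₂).unique ?_)
    convert hasSum_zero with S
    exact hcon S
  obtain ⟨S, hS⟩ := h3
  obtain ⟨e₃, e₄, rfl, h4, h5⟩ := exists_of_coeff_mul_ne_zero hS
  simp only [Set.mem_iUnion]
  refine ⟨S, ⟨e₄, ?_, h5⟩, k, by simp, ?_⟩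
  · exact le_add_of_le_right le_add_self
  · rw [Set.mem_ofPred_eq, edge_symm (by positivity)]
    intro h6
    rw [h6, map_zero] at h4
    exact h4 rfl

end Adjoint

/-! ### The Schur vector at zero times is the ground state -/

section ZeroTimes

variable {R : Type*} [CommRing R] [Algebra ℚ R]

lemma completeSymInt_zero_times {n : ℤ} (hn : 0 < n) :
    completeSymInt (fun _ => (0 : R)) n = 0 := by
  refine completeSymInt_eq_of_mul_eq _ hn ?_
  rw [mul_completeSymInt (fun _ => (0 : R)) (M := n.toNat) (by omega), mul_zero,
    Finset.sum_eq_zero]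
  intro i _
  simp [psum, extendZero]

lemma rowLen_pos {lam : YoungDiagram} {i : ℕ} (h : i < lam.colLen 0) : 0 < lam.rowLen i :=
  YoungDiagram.mem_iff_lt_rowLen.1 (YoungDiagram.mem_iff_lt_colLen.2 h)

lemma colLen_bot (j : ℕ) : (⊥ : YoungDiagram).colLen j = 0 := by
  by_contra h
  exact YoungDiagram.notMem_bot _ (YoungDiagram.mem_iff_lt_colLen.2 (Nat.pos_of_ne_zero h))

lemma eq_bot_of_colLen {lam : YoungDiagram} (h : lam.colLen 0 = 0) : lam = ⊥ :=
  youngDiagram_ext fun i => by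
    rw [rowLen_eq_zero (by omega), rowLen_eq_zero (by rw [colLen_bot]; omega)]

lemma schur_bot (t : ℕ+ → R) : schur t ⊥ = 1 := by
  rw [schur_eq_jt_colLen]
  have : ∀ N (f : Fin N → ℤ), N = 0 → jt t f = 1 := by
    rintro N f rfl
    exact Matrix.det_isEmpty
  exact this _ _ (colLen_bot 0)

lemma schur_zero_times {lam : YoungDiagram} (h : lam ≠ ⊥) : schur (fun _ => (0 : R)) lam = 0 := by
  have hpos : 0 < lam.colLen 0 := Nat.pos_of_ne_zero fun h0 => h (eq_bot_of_colLen h0)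
  rw [schur_eq_jt_colLen]
  refine Matrix.det_eq_zero_of_row_eq_zero ⟨0, hpos⟩ fun j => ?_
  have := rowLen_pos hpos
  exact completeSymInt_zero_times (R := R)
    (n := (lam.rowLen 0 : ℤ) - ((0 : ℕ) : ℤ) + ((j : ℕ) : ℤ)) (by omega)

lemma mayaOf_bot (s : ℤ) : mayaOf s ⊥ = Maya.ground s := by
  refine Maya.ext fun x => ?_
  change (∃ i : ℕ, s + (⊥ : YoungDiagram).rowLen i - i = x) ↔ x ≤ s
  have : ∀ i, (⊥ : YoungDiagram).rowLen i = 0 := fun i =>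
    rowLen_eq_zero (by rw [colLen_bot]; omega)
  simp only [this]
  constructor
  · rintro ⟨i, rfl⟩; omega
  · intro h; exact ⟨(s - x).toNat, by omega⟩

lemma schurVec_ground (t : ℕ+ → R) (s : ℤ) : schurVec t s (Maya.ground s) = 1 := by
  rw [← mayaOf_bot, schurVec_mayaOf, schur_bot]

lemma schurVec_map {S : Type*} [CommRing S] [Algebra ℚ S] (φ : R →+* S) (t : ℕ+ → R) (s : ℤ)
    (T : Maya) : schurVec (fun i => φ (t i)) s T = φ (schurVec t s T) := by
  by_cases h : ∃ lam, mayaOf s lam = T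
  · obtain ⟨lam, rfl⟩ := h
    rw [schurVec_mayaOf, schurVec_mayaOf, schur_map]
  · rw [schurVec_of_not _ _ h, schurVec_of_not _ _ h, map_zero]

lemma schurVec_zero_times (s : ℤ) : schurVec (fun _ => (0 : TimeSeries)) s = ketGround s := by
  ext1 T
  by_cases h : ∃ lam, mayaOf s lam = T
  · obtain ⟨lam, rfl⟩ := h
    rw [schurVec_mayaOf, ketGround]
    by_cases hl : lam = ⊥
    · rw [hl, schur_bot, mayaOf_bot, if_pos rfl]
    · rw [schur_zero_times hl, if_neg]
      rw [← mayaOf_bot]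
      exact fun h => hl (mayaOf_injective s h)
  · rw [schurVec_of_not _ _ h, ketGround, if_neg]
    rintro rfl
    exact h ⟨⊥, mayaOf_bot s⟩

end ZeroTimes

/-! ### The exponentials `e^{J_-} |s⟩` and `⟨s| e^{J_+}` -/

section ExpJminus

open Polynomial

/-- The times `t_k z`, polynomials in an auxiliary variable `z`. -/
def polyTimes (y : ℕ+ → TimeSeries) (k : ℕ+) : TimeSeries[X] := C (y k) * X

/-- The component of `∑_λ s_λ[y] |λ, s⟩` of degree `n` in the times `y`. -/
def schurComponent (y : ℕ+ → TimeSeries) (s : ℤ) (n : ℕ) : Fock :=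
  fun T => (schurVec (polyTimes y) s T).coeff n

lemma tsum_pnat_extendZero {α : Type*} [AddCommMonoid α] [TopologicalSpace α] [T2Space α]
    (F : ℕ → α) {M : ℕ} (h0 : F 0 = 0) (hM : ∀ k, M < k → F k = 0) :
    ∑' k : ℕ+, F k = ∑ k ∈ Finset.range (M + 1), F k := by
  rw [tsum_pnat_eq_tsum_succ (f := F), Finset.sum_range_succ', h0, add_zero]
  exact tsum_eq_sum fun k hk => hM _ (by simp only [Finset.mem_range] at hk; omega)

lemma extendZero_polyTimes (y : ℕ+ → TimeSeries) (k : ℕ) :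
    extendZero (fun k => derivative (polyTimes y k)) k = C (extendZero y k) := by
  simp only [polyTimes, derivative_mul, derivative_C, zero_mul, derivative_X, mul_one, zero_add]
  exact extendZero_map C y k

/-- The recursion `J_-[y] u_n = (n + 1) u_{n + 1}` for the homogeneous components. -/
lemma Jminus_schurComponent (y : ℕ+ → TimeSeries) (s : ℤ) (n : ℕ) :
    Jminus y (schurComponent y s n) = ((n : TimeSeries) + 1) • schurComponent y s (n + 1) := by
  ext1 T
  let φ : TimeSeries[X] →+ TimeSeries := (lcoeff TimeSeries n).toAddMonoidHom
  have hφ : schurComponent y s n = fun T => φ (schurVec (polyTimes y) s T) := rfl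
  by_cases h : ∃ lam, mayaOf s lam = T
  swap
  · have hz : ∀ k : ℕ+, y k * J (-(k : ℤ)) (schurComponent y s n) T = 0 := by
      intro k
      rw [J_apply (by simp), finsum_eq_zero_of_forall_eq_zero, mul_zero]
      refine fun a => hop_eq_zero_of_charge (fun U hU => ?_) h _ _
      rw [schurComponent, schurVec_of_not _ _ hU, coeff_zero]
    rw [Jminus, tsum_congr hz, tsum_zero, Pi.smul_apply, schurComponent, schurVec_of_not _ _ h,
      coeff_zero, smul_zero]
  obtain ⟨lam, rfl⟩ := h
  set N := lam.colLen 0 + 1 with hN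
  set M := lam.rowLen 0 + N with hM
  set D : ℕ → TimeSeries[X] := fun k => ∑ i : Fin N, jt (polyTimes y)
    (Function.update (fun j : Fin N => (lam.rowLen j : ℤ) - (j : ℕ)) i
      ((lam.rowLen i : ℤ) - (i : ℕ) - k)) with hD
  have hJ : ∀ k : ℕ+, y k * J (-(k : ℤ)) (schurComponent y s n) (mayaOf s lam) =
      (fun k : ℕ => extendZero y k * (D k).coeff n) k := by
    intro k
    have := J_neg_schurVec φ (polyTimes y) s lam (N := N) (by omega) k.pos
    rw [hφ, this]
    simp only [extendZero_pos]
    rfl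
  have hrow : ∀ i : Fin N, lam.rowLen i ≤ lam.rowLen 0 := fun i =>
    lam.rowLen_anti 0 i (Nat.zero_le _)
  rw [Jminus, tsum_congr hJ, tsum_pnat_extendZero
    (fun k : ℕ => extendZero y k * (D k).coeff n) (M := M) (by simp)]
  -- Since `d/dz (z y_k) = y_k`, the derivative of the determinant in `z` is `∑_k y_k D k`, which is
  -- the action of `J_-[y]`. The coefficient of `z^n` of a derivative produces the factor `n + 1`.
  · have hder := derivation_jt (derivative' (R := TimeSeries)) (polyTimes y)
      (fun j : Fin N => (lam.rowLen j : ℤ) - (j : ℕ)) (M := M) (fun i => by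
        have := hrow i; omega)
    have h2 := congrArg (fun p => coeff p n) hder
    simp only [derivative'_apply, coeff_derivative, finsetSum_coeff, extendZero_polyTimes,
      coeff_C_mul] at h2
    rw [Pi.smul_apply, schurComponent, schurVec_mayaOf, schur_eq_jt _ lam (N := N) (by omega),
      smul_eq_mul, mul_comm ((n : TimeSeries) + 1), h2]
    simp only [hD, finsetSum_coeff]
  -- For `k > M` the lowered row index is at most `-N`, so its row is zero.
  · intro k hk
    simp only [hD]
    rw [Finset.sum_eq_zero, coeff_zero, mul_zero]
    intro i _
    refine jt_eq_zero_of_le _ _ (i := i) ?_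
    rw [Function.update_self]
    have := hrow i
    omega

lemma schurComponent_zero (y : ℕ+ → TimeSeries) (s : ℤ) :
    schurComponent y s 0 = ketGround s := by
  rw [← schurVec_zero_times]
  ext1 T
  rw [schurComponent, coeff_zero_eq_eval_zero, ← coe_evalRingHom, ← schurVec_map]
  simp [polyTimes]

lemma iterate_Jminus (y : ℕ+ → TimeSeries) {A : Fock → Fock} (hA : ∀ v, A v = Jminus y v)
    (hlin : ∀ (c : ℕ) v, A ((c : TimeSeries) • v) = (c : TimeSeries) • A v) (s : ℤ) (n : ℕ) :
    A^[n] (ketGround s) = (n.factorial : TimeSeries) • schurComponent y s n := by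
  induction n with
  | zero => simp [schurComponent_zero]
  | succ n ih =>
    rw [Function.iterate_succ_apply', ih, hlin, hA, Jminus_schurComponent, smul_smul,
      Nat.factorial_succ]
    push_cast
    rw [mul_comm]

lemma J_smul {k : ℤ} (hk : k ≠ 0) (c : TimeSeries) (v : Fock) : J k (c • v) = c • J k v := by
  ext1 S
  rw [Pi.smul_apply, J_eq_sum hk, J_eq_sum hk, Finset.smul_sum]
  refine Finset.sum_congr rfl fun a _ => ?_
  rw [hop_eq_hop_ket_mul, hop_eq_hop_ket_mul _ _ v, Pi.smul_apply, smul_eq_mul, smul_eq_mul]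
  ring

/-- Each component of the vector with times `z y_k` is a polynomial in `z`; the sum of its
coefficients is its value at `z = 1`. -/
lemma hasSum_schurComponent (y : ℕ+ → TimeSeries) (s : ℤ) (T : Maya) :
    HasSum (fun n => schurComponent y s n T) (schurVec y s T) := by
  have h : schurVec y s T = ∑ n ∈ Finset.range ((schurVec (polyTimes y) s T).natDegree + 1),
      schurComponent y s n T := by
    have h1 : schurVec y s T = (schurVec (polyTimes y) s T).eval 1 := by
      rw [← coe_evalRingHom, ← schurVec_map]
      simp [polyTimes]
    rw [h1, eval_eq_sum_range]
    simp [schurComponent]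
  rw [h]
  refine hasSum_sum_of_ne_finset_zero fun n hn => ?_
  exact coeff_eq_zero_of_natDegree_lt (by simp only [Finset.mem_range] at hn; omega)

lemma inv_factorial_smul (n : ℕ) (x : TimeSeries) :
    ((n.factorial : ℂ)⁻¹) • ((n.factorial : TimeSeries) * x) = x := by
  have : (n.factorial : TimeSeries) = MvPowerSeries.C (n.factorial : ℂ) := by simp
  rw [this, ← MvPowerSeries.smul_eq_C_mul, smul_smul, inv_mul_cancel₀, one_smul]
  exact_mod_cast n.factorial_ne_zero

lemma Jminus_smul {y : ℕ+ → TimeSeries}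
    (hs : ∀ v S, Summable fun k : ℕ+ => y k * J (-(k : ℤ)) v S) (c : TimeSeries) (v : Fock) :
    Jminus y (c • v) = c • Jminus y v := by
  ext1 S
  rw [Pi.smul_apply, Jminus, Jminus, smul_eq_mul, ← (hs v S).tsum_mul_left]
  refine tsum_congr fun k => ?_
  rw [J_smul (by simp), Pi.smul_apply, smul_eq_mul]
  exact mul_left_comm _ _ _

lemma summable_tVar_mul (y : ℕ+ → TimeSeries) : Summable fun k => tVar k * y k :=
  summable_X_mul Sum.inl_injective y

lemma summable_tbarVar_mul (y : ℕ+ → TimeSeries) : Summable fun k => tbarVar k * y k :=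
  summable_X_mul Sum.inr_injective y

lemma neg_Jminus (y : ℕ+ → TimeSeries) : -Jminus y = Jminus (-y) := by
  ext1 v
  ext1 S
  change -(∑' k, _) = ∑' k, _
  rw [← tsum_neg]
  simp

lemma opExp_neg_Jminus_ketGround (s : ℤ) :
    opExp (-Jminus tbarVar) (ketGround s) = schurVec (-tbarVar) s := by
  ext1 S
  unfold opExp
  rw [neg_Jminus]
  have h : ∀ n, ((n.factorial : ℂ)⁻¹) • ((Jminus (-tbarVar))^[n] (ketGround s)) S =
      schurComponent (-tbarVar) s n S := by
    intro n
    rw [iterate_Jminus (-tbarVar) (fun _ => rfl) (fun c v => Jminus_smul (fun v S => ?_) _ v),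
      Pi.smul_apply, smul_eq_mul, inv_factorial_smul]
    simpa using (summable_tbarVar_mul fun k => J (-(k : ℤ)) v S).neg
  simp_rw [h]
  exact (hasSum_schurComponent _ s S).tsum_eq

lemma natCast_factorial_mul_schurComponent (s : ℤ) (n : ℕ) (S : Maya) :
    schurComponent tVar s n S =
      ((n.factorial : ℂ)⁻¹) • ((Jminus tVar)^[n] (ketGround s)) S := by
  rw [iterate_Jminus tVar (fun _ => rfl)
    (fun c v => Jminus_smul (fun v S => summable_tVar_mul _) _ v),
    Pi.smul_apply, smul_eq_mul, inv_factorial_smul]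

lemma schurComponent_mem_orderIdeal (s : ℤ) (n : ℕ) (S : Maya) :
    schurComponent tVar s n S ∈ orderIdeal n := by
  rw [natCast_factorial_mul_schurComponent]
  exact smul_mem_orderIdeal _ (iterate_mem_orderIdeal Jminus_tVar_mem_orderIdeal _ n S)

lemma LocallyFiniteVec.smul {w : Fock} (hw : LocallyFiniteVec w) (c : ℂ) :
    LocallyFiniteVec (fun S => c • w S) := fun e => (hw e).subset fun S hS h => by
  simp only [Set.mem_ofPred_eq, map_smul] at hS
  exact hS (by rw [h, smul_zero])

lemma locallyFiniteVec_schurComponent (s : ℤ) (n : ℕ) :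
    LocallyFiniteVec (schurComponent tVar s n) := by
  have h : LocallyFiniteVec ((Jminus tVar)^[n] (ketGround s)) := by
    induction n with
    | zero =>
      intro e
      refine (Set.finite_singleton (Maya.ground s)).subset fun S hS => ?_
      by_contra hne
      refine hS ?_
      rw [Function.iterate_zero, id, ketGround, if_neg (by simpa using hne), map_zero]
    | succ n ih =>
      rw [Function.iterate_succ_apply']
      exact ih.jminus
  have h2 := h.smul ((n.factorial : ℂ)⁻¹)
  convert h2 using 1
  ext1 S
  exact natCast_factorial_mul_schurComponent s n S

/-- Moving `n` factors across the pairing gives `⟨J_-^n s, v⟩ / n! = ⟨s, J_+^n v⟩ / n!`. Local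
finiteness of the left vector makes every pairing converge for arbitrary `v`. -/
lemma hasSum_schurComponent_mul (s : ℤ) (n : ℕ) (v : Fock) :
    HasSum (fun S => schurComponent tVar s n S * v S)
      (((n.factorial : ℂ)⁻¹) • ((Jplus tVar)^[n] v) (Maya.ground s)) := by
  induction n generalizing v with
  | zero =>
    rw [schurComponent_zero]
    have := hasSum_single (f := fun S => ketGround s S * v S) (Maya.ground s)
      (fun S hS => by rw [ketGround, if_neg hS, zero_mul])
    simpa [ketGround] using this
  | succ n ih =>
    obtain ⟨x, h1, h2⟩ := exists_hasSum_adjoint (locallyFiniteVec_schurComponent s n) v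
    have h3 := h1.unique (ih (Jplus tVar v))
    rw [h3, Jminus_schurComponent] at h2
    have h4 := h2.const_smul (((n : ℂ) + 1)⁻¹)
    have hn : ((n : ℂ) + 1) ≠ 0 := by exact_mod_cast n.succ_ne_zero
    have h5 : ((n : TimeSeries) + 1) = MvPowerSeries.C ((n : ℂ) + 1) := by simp
    convert h4 using 1
    · ext1 S
      rw [Pi.smul_apply, smul_eq_mul, h5, ← MvPowerSeries.smul_eq_C_mul, smul_mul_assoc, smul_smul,
        inv_mul_cancel₀ hn, one_smul]
    · rw [smul_smul, Function.iterate_succ_apply, Nat.factorial_succ]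
      push_cast
      rw [mul_inv]

/-- `⟨s| e^{J_+[t]} = ∑_λ s_λ[t] ⟨λ, s|`. -/
lemma hasSum_opExp_Jplus (s : ℤ) (v : Fock) :
    HasSum (fun S => schurVec tVar s S * v S) (opExp (Jplus tVar) v (Maya.ground s)) := by
  -- Order at least `n` bounds `n`, and local finiteness bounds `S`, so the sums over `n` and over
  -- `S` may be exchanged.
  have hs : Summable fun x : ℕ × Maya => schurComponent tVar s x.1 x.2 * v x.2 := by
    refine summable_of_finite_coeff fun e => ?_
    have hfin : (⋃ n ∈ Set.Iic e.degree, (fun S => (n, S)) ''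
        {S | ∃ e₁ ≤ e, MvPowerSeries.coeff e₁ (schurComponent tVar s n S) ≠ 0}).Finite :=
      (Set.finite_Iic _).biUnion fun n _ =>
        ((locallyFiniteVec_schurComponent s n).finite_le e).image _
    refine hfin.subset ?_
    rintro ⟨n, S⟩ h
    obtain ⟨e₁, e₂, rfl, h1, h2⟩ := exists_of_coeff_mul_ne_zero h
    simp only [Set.mem_iUnion, Set.mem_image]
    refine ⟨n, ?_, S, ⟨e₁, le_self_add, h1⟩, rfl⟩
    by_contra hn
    rw [Set.mem_Iic, map_add, not_le] at hn
    exact h1 (schurComponent_mem_orderIdeal s n S e₁ (by omega))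
  have h1 : HasSum (fun n : ℕ => ((n.factorial : ℂ)⁻¹) • ((Jplus tVar)^[n] v) (Maya.ground s)) _ :=
    hs.hasSum.prod_fiberwise fun n => hasSum_schurComponent_mul s n v
  rw [opExp, h1.tsum_eq]
  have h2 : HasSum (fun x : Maya × ℕ => schurComponent tVar s x.2 x.1 * v x.1)
      (∑' x : ℕ × Maya, schurComponent tVar s x.1 x.2 * v x.2) :=
    ((Equiv.prodComm Maya ℕ).hasSum_iff (f := fun x : ℕ × Maya =>
      schurComponent tVar s x.1 x.2 * v x.2)).2 hs.hasSum
  exact h2.prod_fiberwise fun S => (hasSum_schurComponent tVar s S).mul_right (v S)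

lemma hasSum_youngDiagram_of_maya {s : ℤ} {w : Fock} {x : TimeSeries}
    (h : HasSum w x) (hw : ∀ S, (¬∃ lam, mayaOf s lam = S) → w S = 0) :
    HasSum (fun lam => w (mayaOf s lam)) x :=
  ((mayaOf_injective s).hasSum_iff fun S hS => hw S fun ⟨lam, hl⟩ => hS ⟨lam, hl⟩).2 h

end ExpJminus

/-! ### Homogeneity of Schur functions -/

section Scale

variable {R : Type*} [CommRing R] [Algebra ℚ R]

lemma card_eq_sum_rowLen (lam : YoungDiagram) {N : ℕ} (hN : lam.colLen 0 ≤ N) :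
    lam.card = ∑ i ∈ Finset.range N, lam.rowLen i := by
  have h : ∀ c ∈ lam.cells, c.1 ∈ Finset.range N := by
    rintro ⟨i, j⟩ hc
    have h1 := lam.up_left_mem (le_refl i) (Nat.zero_le j) (YoungDiagram.mem_cells _ |>.1 hc)
    have := YoungDiagram.mem_iff_lt_colLen.1 h1
    simp only [Finset.mem_range]
    omega
  change lam.cells.card = _
  rw [Finset.card_eq_sum_card_fiberwise h]
  refine Finset.sum_congr rfl fun i _ => ?_
  rw [YoungDiagram.rowLen_eq_card]
  rfl

/-- In every term of the determinant the indices `λ_i - i + σ(i)` add up to `|λ|`, and terms with a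
negative index vanish on both sides. -/
lemma schur_scale (t : ℕ+ → R) (z : R) (lam : YoungDiagram) :
    schur (fun k => z ^ (k : ℕ) * t k) lam = z ^ lam.card * schur t lam := by
  set N := lam.colLen 0
  have hh : ∀ n : ℤ, completeSymInt (fun k => z ^ (k : ℕ) * t k) n =
      z ^ n.toNat * completeSymInt t n := by
    intro n
    rcases lt_or_ge n 0 with h | h
    · rw [completeSymInt_of_neg _ h, completeSymInt_of_neg _ h, mul_zero]
    · obtain ⟨n, rfl⟩ := Int.eq_ofNat_of_zero_le h
      exact completeSymInt_scale t z n
  have hmat : ∀ t : ℕ+ → R, schur t lam = (jtMatrix t fun i : Fin N =>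
      (lam.rowLen i : ℤ) - (i : ℕ)).transpose.det := fun t => (Matrix.det_transpose _).symm
  rw [hmat, hmat, Matrix.det_apply, Matrix.det_apply, Finset.mul_sum]
  refine Finset.sum_congr rfl fun σ _ => ?_
  rw [mul_smul_comm]
  congr 1
  simp only [Matrix.transpose_apply, jtMatrix, Matrix.of_apply, hh]
  rw [Finset.prod_mul_distrib]
  by_cases hneg : ∃ i : Fin N, (lam.rowLen i : ℤ) - (i : ℕ) + ((σ i : Fin N) : ℕ) < 0
  · obtain ⟨i, hi⟩ := hneg
    have : ∏ i : Fin N, completeSymInt t ((lam.rowLen i : ℤ) - (i : ℕ) + ((σ i : Fin N) : ℕ)) = 0 :=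
      Finset.prod_eq_zero (Finset.mem_univ i) (completeSymInt_of_neg t hi)
    rw [this, mul_zero, mul_zero]
  · push Not at hneg
    rw [Finset.prod_pow_eq_pow_sum]
    congr 2
    zify
    rw [Finset.sum_congr rfl fun i _ => Int.toNat_of_nonneg (hneg i), Finset.sum_add_distrib,
      Equiv.sum_comp σ fun j : Fin N => ((j : ℕ) : ℤ), Finset.sum_sub_distrib, sub_add_cancel,
      card_eq_sum_rowLen lam (le_refl N), ← Fin.sum_univ_eq_sum_range]
    push_cast
    rfl

lemma finite_card_eq (d : ℕ) : {lam : YoungDiagram | lam.card = d}.Finite := by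
  refine Set.Finite.of_finite_image (f := YoungDiagram.cells) ?_ ?_
  · refine (((Finset.range d ×ˢ Finset.range d).powerset).finite_toSet).subset ?_
    rintro _ ⟨lam, hl, rfl⟩
    rw [Finset.mem_coe, Finset.mem_powerset]
    rintro ⟨i, j⟩ hc
    rw [YoungDiagram.mem_cells] at hc
    have h1 : i < lam.colLen j := YoungDiagram.mem_iff_lt_colLen.1 hc
    have h2 : j < lam.rowLen i := YoungDiagram.mem_iff_lt_rowLen.1 hc
    have h3 : lam.colLen j ≤ lam.card := by
      rw [YoungDiagram.colLen_eq_card]; exact Finset.card_le_card (Finset.filter_subset _ _)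
    have h4 : lam.rowLen i ≤ lam.card := by
      rw [YoungDiagram.rowLen_eq_card]; exact Finset.card_le_card (Finset.filter_subset _ _)
    rw [Set.mem_ofPred_eq] at hl
    simp only [Finset.mem_product, Finset.mem_range]
    omega
  · intro lam _ mu _ h
    exact YoungDiagram.ext h

/-- The Young diagrams with `d` cells. -/
def diagrams (d : ℕ) : Finset YoungDiagram := (finite_card_eq d).toFinset

@[simp] lemma mem_diagrams {d : ℕ} {lam : YoungDiagram} : lam ∈ diagrams d ↔ lam.card = d := by
  simp [diagrams]

end Scale

/-! ### The graded Cauchy identity -/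

section Cauchy

open Polynomial

/-- The power sums `k t_k y_k` of the product alphabet. -/
def productTimes (y : ℕ+ → TimeSeries) (k : ℕ+) : TimeSeries := tVar k * ((k : ℕ) * y k)

/-- The times `z^k y_k`. -/
def gradedTimes (y : ℕ+ → TimeSeries) (k : ℕ+) : TimeSeries[X] := X ^ (k : ℕ) * C (y k)

/-- The coefficient of `z^d` in `F p`. -/
def coeffMul (F : PowerSeries TimeSeries) (d : ℕ) : TimeSeries[X] →+ TimeSeries where
  toFun p := PowerSeries.coeff d (F * (p : PowerSeries TimeSeries))
  map_zero' := by simp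
  map_add' p q := by rw [Polynomial.coe_add, mul_add, map_add]

lemma coeffMul_apply (F : PowerSeries TimeSeries) (d : ℕ) (p : TimeSeries[X]) :
    coeffMul F d p = PowerSeries.coeff d (F * (p : PowerSeries TimeSeries)) := rfl

lemma coeff_mul_X_pow_mul_C (G : PowerSeries TimeSeries) (c : TimeSeries) (k d : ℕ) :
    PowerSeries.coeff d (G * (PowerSeries.X ^ k * PowerSeries.C c)) =
      if k ≤ d then c * PowerSeries.coeff (d - k) G else 0 := by
  rw [← mul_assoc, PowerSeries.coeff_mul_C, PowerSeries.coeff_mul_X_pow']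
  split_ifs <;> ring

lemma psum_gradedTimes (y : ℕ+ → TimeSeries) (k : ℕ+) :
    psum (gradedTimes y) k = X ^ (k : ℕ) * C ((k : ℕ) * y k) := by
  rw [psum, extendZero_pos, gradedTimes]
  simp only [C_mul, map_natCast]
  ring

/-- By `J_schurVec` the operator `J_+[t]` multiplies the graded Schur vector by `∑_k k t_k y_k z^k`.
The series `F` collects the factors already produced. -/
lemma Jplus_gradedTimes (y : ℕ+ → TimeSeries) (s : ℤ) (F : PowerSeries TimeSeries) (d : ℕ) :
    Jplus tVar (fun T => coeffMul F d (schurVec (gradedTimes y) s T)) =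
      fun T => coeffMul (F * PowerSeries.mk (extendZero (productTimes y))) d
        (schurVec (gradedTimes y) s T) := by
  ext1 T
  set G : PowerSeries TimeSeries := F * (schurVec (gradedTimes y) s T : TimeSeries[X]) with hG
  have h : ∀ k : ℕ+, tVar k * J (k : ℤ) (fun T => coeffMul F d (schurVec (gradedTimes y) s T)) T =
      (fun k : ℕ => if k ≤ d then extendZero (productTimes y) k * PowerSeries.coeff (d - k) G
        else 0) k := by
    intro k
    have := J_schurVec (coeffMul F d) (gradedTimes y) s T k.pos
    rw [this]
    have h2 : coeffMul F d (psum (gradedTimes y) k * schurVec (gradedTimes y) s T) =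
        PowerSeries.coeff d (G * (PowerSeries.X ^ (k : ℕ) * PowerSeries.C ((k : ℕ) * y k))) := by
      rw [psum_gradedTimes, coeffMul_apply, Polynomial.coe_mul, Polynomial.coe_mul, Polynomial.coe_pow, Polynomial.coe_X,
        Polynomial.coe_C, hG]
      congr 1
      ring
    rw [h2, coeff_mul_X_pow_mul_C]
    simp only [extendZero_pos, productTimes]
    split_ifs
    · ring
    · ring
  rw [Jplus, tsum_congr h, tsum_pnat_extendZero (fun k : ℕ => if k ≤ d then
    extendZero (productTimes y) k * PowerSeries.coeff (d - k) G else 0) (M := d) (by simp)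
    (fun k hk => if_neg (by omega))]
  rw [coeffMul_apply]
  have : F * PowerSeries.mk (extendZero (productTimes y)) *
      (schurVec (gradedTimes y) s T : TimeSeries[X]) =
      PowerSeries.mk (extendZero (productTimes y)) * G := by rw [hG]; ring
  rw [this, PowerSeries.coeff_mul, Finset.Nat.antidiagonal_eq_map, Finset.sum_map]
  refine Finset.sum_congr rfl fun i hi => ?_
  rw [if_pos (by simp only [Finset.mem_range] at hi; omega), PowerSeries.coeff_mk]
  rfl

lemma iterate_Jplus_gradedTimes (y : ℕ+ → TimeSeries) (s : ℤ) (d n : ℕ) :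
    (Jplus tVar)^[n] (fun T => coeffMul 1 d (schurVec (gradedTimes y) s T)) =
      fun T => coeffMul (PowerSeries.mk (extendZero (productTimes y)) ^ n) d
        (schurVec (gradedTimes y) s T) := by
  induction n with
  | zero => rfl
  | succ n ih => rw [Function.iterate_succ_apply', ih, Jplus_gradedTimes, pow_succ]

lemma opExp_Jplus_gradedTimes (y : ℕ+ → TimeSeries) (s : ℤ) (d : ℕ) :
    opExp (Jplus tVar) (fun T => coeffMul 1 d (schurVec (gradedTimes y) s T)) (Maya.ground s) =
      completeSym (productTimes y) d := by
  unfold opExp completeSym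
  have hs := hasSubst_extendZero (productTimes y)
  have hfin := PowerSeries.coeff_subst_finite' hs (PowerSeries.exp TimeSeries) d
  rw [PowerSeries.coeff_subst' hs, ← tsum_eq_finsum (L := .unconditional ℕ) hfin]
  refine tsum_congr fun n => ?_
  rw [iterate_Jplus_gradedTimes]
  simp only [coeffMul_apply]
  rw [schurVec_ground, Polynomial.coe_one, mul_one, PowerSeries.coeff_exp, smul_eq_mul,
    MvPowerSeries.smul_eq_C_mul]
  congr 1
  rw [IsScalarTower.algebraMap_apply ℚ ℂ TimeSeries]
  simp
  rfl

/-- The Cauchy identity, graded by the size of the partition. -/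
lemma sum_schur_mul_schur (y : ℕ+ → TimeSeries) (d : ℕ) :
    ∑ lam ∈ diagrams d, schur tVar lam * schur y lam = completeSym (productTimes y) d := by
  -- The same element `⟨0| e^{J_+[t]}` applied to the graded Schur vector is computed twice: as a
  -- pairing of Schur functions, and as an exponential of eigenvalues whose ground component is `1`.
  -- The charge `0` is an arbitrary choice.
  have h1 := hasSum_youngDiagram_of_maya (hasSum_opExp_Jplus 0
    (fun T => coeffMul 1 d (schurVec (gradedTimes y) 0 T)))
    (fun S hS => by rw [schurVec_of_not _ _ hS, zero_mul])
  rw [opExp_Jplus_gradedTimes] at h1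
  refine HasSum.unique ?_ h1
  have h2 : ∀ lam, schurVec tVar 0 (mayaOf 0 lam) *
      coeffMul 1 d (schurVec (gradedTimes y) 0 (mayaOf 0 lam)) =
      if lam.card = d then schur tVar lam * schur y lam else 0 := by
    intro lam
    have h3 : schur (gradedTimes y) lam = X ^ lam.card * C (schur y lam) := by
      have := schur_scale (fun k => C (y k)) X lam
      rw [schur_map C y lam] at this
      exact this
    rw [schurVec_mayaOf, schurVec_mayaOf, h3]
    rw [coeffMul_apply, one_mul, Polynomial.coeff_coe, coeff_X_pow_mul', coeff_C]
    split_ifs <;> first | rfl | omega | simp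
  simp_rw [h2]
  have := hasSum_sum_of_ne_finset_zero (L := .unconditional YoungDiagram)
    (s := diagrams d) (f := fun lam => if lam.card = d then schur tVar lam * schur y lam else 0)
    (fun lam hl => if_neg (by simpa using hl))
  rwa [Finset.sum_congr rfl fun lam hl => if_pos (mem_diagrams.1 hl)] at this

end Cauchy

/-! ### Eigenvalues of `L_0` and `W_0`; the Schur expansion of tau -/

section Diagonal

lemma occupied_support_finite (S : Maya) (φ : ℤ → ℂ) [DecidablePred (· ∈ S.1)] :
    (Function.support fun n : ℤ =>
      φ n * (((if n ∈ S.1 then 1 else 0) - (if n ≤ 0 then 1 else 0) : ℤ) : ℂ)).Finite := by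
  obtain ⟨B, h1, h2⟩ := S.exists_bound
  refine (Set.finite_Icc (-B) (max B 0)).subset fun n hn => ?_
  by_contra hcon
  apply hn
  rw [Set.mem_Icc, not_and_or, not_le, not_le] at hcon
  rcases hcon with h | h
  · have h3 : n ∈ S.1 := by by_contra h4; have := h2 n h4; omega
    by_cases h0 : n ≤ 0
    · simp [h3, h0]
    · have := h1 n h3
      have h5 : (1 : ℤ) ∈ S.1 ∨ (1 : ℤ) ∉ S.1 := Classical.em _
      exfalso; omega
  · have h3 : n ∉ S.1 := fun h4 => by have := h1 n h4; omega
    simp [h3]; omega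

open Classical in
/-- The eigenvalue of `∑_n φ(n) :ψ_{-n} ψ*_n:` on a basis vector. -/
def weight (φ : ℤ → ℂ) (S : Maya) : ℂ := ∑ᶠ n : ℤ,
  φ n * (((if n ∈ S.1 then 1 else 0) - (if n ≤ 0 then 1 else 0) : ℤ) : ℂ)

lemma finsum_normalOrdered (φ : ℤ → ℂ) (v : Fock) (S : Maya) :
    ∑ᶠ n : ℤ, φ n • normalOrdered (-n) n v S = weight φ S • v S := by
  classical
  rw [weight, finsum_smul' (occupied_support_finite S φ)]
  refine finsum_congr fun n => ?_
  rw [normalOrdered_neg_self, mul_smul, Int.cast_smul_eq_zsmul]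

lemma iterate_diagonal {A : Fock → Fock} {w : Maya → ℂ} (hA : ∀ v S, A v S = w S • v S) (c : ℂ)
    (n : ℕ) (v : Fock) (S : Maya) : ((c • A)^[n] v) S = (c * w S) ^ n • v S := by
  induction n with
  | zero => simp
  | succ n ih =>
    rw [Function.iterate_succ_apply', Pi.smul_apply, Pi.smul_apply, hA, ih, smul_smul, smul_smul,
      pow_succ]
    congr 1; ring

/-- A diagonal operator does not raise the order in the times; here convergence is that of the
complex exponential in each coefficient. -/
lemma hasSum_exp_diagonal {A : Fock → Fock} {w : Maya → ℂ} (hA : ∀ v S, A v S = w S • v S) (c : ℂ)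
    (v : Fock) (S : Maya) : HasSum (fun n : ℕ => ((n.factorial : ℂ)⁻¹) • ((c • A)^[n] v) S)
      (Complex.exp (c * w S) • v S) := by
  have h : HasSum (fun n : ℕ => (n.factorial : ℂ)⁻¹ * (c * w S) ^ n) (Complex.exp (c * w S)) := by
    rw [Complex.exp_eq_exp_ℂ]
    simpa [smul_eq_mul] using NormedSpace.exp_series_hasSum_exp' (𝕂 := ℂ) (c * w S)
  rw [MvPowerSeries.WithPiTopology.hasSum_iff_hasSum_coeff]
  intro e
  simp_rw [iterate_diagonal hA, smul_smul, map_smul, smul_eq_mul]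
  exact h.mul_right _

lemma L0_apply (v : Fock) (S : Maya) : L0 v S = weight (fun n => n) S • v S :=
  finsum_normalOrdered (fun n => n) v S

lemma W0_apply (v : Fock) (S : Maya) : W0 v S = weight (fun n => (n : ℂ) ^ 2) S • v S :=
  finsum_normalOrdered (fun n => (n : ℂ) ^ 2) v S

lemma tauConverges (β Q : ℂ) : TauConverges β Q where
  jplus _ _ := summable_tVar_mul _
  jminus _ _ := summable_tbarVar_mul _
  exp_jplus := opExpConverges_of_orderIdeal Jplus_tVar_mem_orderIdeal
  exp_jminus := opExpConverges_of_orderIdeal neg_Jminus_tbarVar_mem_orderIdeal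
  exp_W0 v S := (hasSum_exp_diagonal W0_apply _ v S).summable
  pow_L0 v S := (hasSum_exp_diagonal L0_apply _ v S).summable

lemma hurwitzElement_apply (β Q : ℂ) (v : Fock) (S : Maya) :
    hurwitzElement β Q v S = Complex.exp (β / 2 * weight (fun n => (n : ℂ) ^ 2) S) •
      Complex.exp (Complex.log Q * weight (fun n => n) S) • v S := by
  unfold hurwitzElement opPow
  rw [opExp, (hasSum_exp_diagonal W0_apply _ _ S).tsum_eq, opExp,
    (hasSum_exp_diagonal L0_apply _ _ S).tsum_eq]

/-- The discrete primitive `Φ` of `φ` gives the ground state value by telescoping, for either sign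
of `s`. The remaining sum compares the occupied levels `s + λ_i - i` with those of the ground state.
-/
lemma weight_mayaOf {φ Φ : ℤ → ℂ} (h0 : Φ 0 = 0) (hΦ : ∀ n, Φ n - Φ (n - 1) = φ n) (s : ℤ)
    (lam : YoungDiagram) {N : ℕ} (hN : lam.colLen 0 ≤ N) :
    weight φ (mayaOf s lam) =
      Φ s + ∑ i ∈ Finset.range N, (φ (s + lam.rowLen i - i) - φ (s - i)) := by
  classical
  have hsum : ∀ M : ℕ, ∑ i ∈ Finset.range M, φ (s - i) = Φ s - Φ (s - M) := by
    intro M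
    induction M with
    | zero => simp
    | succ M ih =>
      rw [Finset.sum_range_succ, ih, ← hΦ]
      push_cast
      rw [← sub_sub]; ring
  have hIoc : ∀ m : ℕ, ∑ n ∈ Finset.Ioc (-(m : ℤ)) 0, φ n = -Φ (-(m : ℤ)) := by
    intro m
    induction m with
    | zero => simp [h0]
    | succ m ih =>
      have : Finset.Ioc (-((m + 1 : ℕ) : ℤ)) 0 = insert (-(m : ℤ)) (Finset.Ioc (-(m : ℤ)) 0) := by
        ext x; simp only [Finset.mem_Ioc, Finset.mem_insert]; omega
      rw [this, Finset.sum_insert (by simp), ih, ← hΦ]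
      push_cast
      rw [neg_add']; ring
  -- This `M` makes `s - M ≤ 0`, so all levels `≤ s - M` are occupied and are cancelled by the
  -- normal ordering.
  set M := N + s.toNat with hM
  have hext : ∑ i ∈ Finset.range N, (φ (s + lam.rowLen i - i) - φ (s - i)) =
      ∑ i ∈ Finset.range M, (φ (s + lam.rowLen i - i) - φ (s - i)) := by
    refine Finset.sum_subset (by intro x; simp; omega) fun x _ hx => ?_
    rw [rowLen_eq_zero (by simp only [Finset.mem_range] at hx; omega)]
    simp
  obtain ⟨m, hm⟩ : ∃ m : ℕ, s - M = -(m : ℤ) := ⟨(M - s).toNat, by omega⟩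
  have he := isEnum_mayaOf s lam (N := M) (by omega)
  set f : Fin M → ℤ := fun i => s + lam.rowLen i - (i : ℕ) with hf
  have hterm : ∀ n : ℤ, φ n * (((if n ∈ (mayaOf s lam).1 then 1 else 0) -
      (if n ≤ 0 then 1 else 0) : ℤ) : ℂ) =
      (if n ∈ Finset.univ.image f then φ n else 0) -
      (if n ∈ Finset.Ioc (-(m : ℤ)) 0 then φ n else 0) := by
    intro n
    have h1 : n ∈ (mayaOf s lam).1 ↔ n ≤ -(m : ℤ) ∨ n ∈ Finset.univ.image f := by
      rw [he.mem, hm]; simp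
    have h2 : n ∈ Finset.univ.image f → -(m : ℤ) < n := by
      intro h
      obtain ⟨i, -, rfl⟩ := Finset.mem_image.1 h
      rw [← hm]; exact he.lt i
    by_cases ha : n ∈ Finset.univ.image f
    · have := h2 ha
      rw [if_pos (h1.2 (Or.inr ha)), if_pos ha]
      by_cases hb : n ≤ 0
      · rw [if_pos hb, if_pos (Finset.mem_Ioc.2 ⟨this, hb⟩)]; simp
      · rw [if_neg hb, if_neg (by simp [hb])]; simp
    · by_cases hb : n ≤ -(m : ℤ)
      · rw [if_pos (h1.2 (Or.inl hb)), if_neg ha, if_pos (by omega),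
          if_neg (by simp; omega)]; simp
      · rw [if_neg (by rw [h1]; tauto), if_neg ha]
        by_cases hc : n ≤ 0
        · rw [if_pos hc, if_pos (Finset.mem_Ioc.2 ⟨by omega, hc⟩)]; simp
        · rw [if_neg hc, if_neg (by simp [hc])]; simp
  have hw : weight φ (mayaOf s lam) =
      ∑ n ∈ Finset.univ.image f, φ n - ∑ n ∈ Finset.Ioc (-(m : ℤ)) 0, φ n := by
    rw [weight]
    have h3 : ∀ A : Finset ℤ, ∑ n ∈ A, φ n = ∑ᶠ n, if n ∈ A then φ n else 0 := by
      intro A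
      rw [finsum_eq_sum_of_support_subset (s := A)]
      · exact Finset.sum_congr rfl fun x hx => (if_pos hx).symm
      · intro x hx; by_contra h; exact hx (if_neg h)
    have h4 : ∀ A : Finset ℤ, (Function.support fun n => if n ∈ A then φ n else 0).Finite :=
      fun A => A.finite_toSet.subset fun x hx => by by_contra h; exact hx (if_neg h)
    rw [h3, h3, ← finsum_sub_distrib (h4 _) (h4 _)]
    exact finsum_congr fun n => by rw [← hterm]
  rw [hw, Finset.sum_image (fun x _ y _ h => he.anti.injective h), hIoc, hext,
    Finset.sum_sub_distrib, hsum, hm, Fin.sum_univ_eq_sum_range (fun i => φ (s + lam.rowLen i - i))]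
  ring

lemma kappa_eq_sum (lam : YoungDiagram) : kappa lam = ∑ i ∈ Finset.range (lam.colLen 0),
    ((lam.rowLen i : ℤ) * (lam.rowLen i - 2 * i - 1)) :=
  Finset.sum_congr rfl fun i _ => by ring

lemma weight_L0 (s : ℤ) (lam : YoungDiagram) :
    weight (fun n => (n : ℂ)) (mayaOf s lam) = (s : ℂ) * (s + 1) / 2 + lam.card := by
  rw [weight_mayaOf (Φ := fun n => (n : ℂ) * (n + 1) / 2) (by simp)
    (fun n => by push_cast; ring) s lam (le_refl _), card_eq_sum_rowLen lam (le_refl _)]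
  push_cast
  congr 1
  exact Finset.sum_congr rfl fun i _ => by ring

lemma weight_W0 (s : ℤ) (lam : YoungDiagram) :
    weight (fun n => (n : ℂ) ^ 2) (mayaOf s lam) =
      (s : ℂ) * (s + 1) * (2 * s + 1) / 6 + (kappa lam + (2 * s + 1) * lam.card) := by
  rw [weight_mayaOf (Φ := fun n => (n : ℂ) * (n + 1) * (2 * n + 1) / 6) (by simp)
    (fun n => by push_cast; ring) s lam (le_refl _), card_eq_sum_rowLen lam (le_refl _),
    kappa_eq_sum]
  push_cast
  rw [Finset.mul_sum, ← Finset.sum_add_distrib]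
  congr 1
  exact Finset.sum_congr rfl fun i _ => by ring

/-- The eigenvalues of `L_0` are integers, so the choice of branch of the logarithm in `opPow` is
immaterial. -/
lemma exp_log_mul_int {Q : ℂ} (hQ : Q ≠ 0) (n : ℤ) : Complex.exp (Complex.log Q * n) = Q ^ n := by
  rw [mul_comm, Complex.exp_int_mul, Complex.exp_log hQ]

/-- The Schur function expansion of the tau function. -/
lemma hasSum_todaTau (β Q : ℂ) (hQ : Q ≠ 0) (s : ℤ) :
    HasSum (fun lam : YoungDiagram =>
      const (Complex.exp (β * ((s : ℂ) * ((s : ℂ) + 1) * (2 * (s : ℂ) + 1)) / 12) *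
            Q ^ (s * (s + 1) / 2)) *
      (const (Complex.exp (β * (kappa lam : ℂ) / 2) *
          (Complex.exp (β * ((s : ℂ) + 1 / 2)) * Q) ^ lam.card) *
        schur tVar lam * schur (-tbarVar) lam)) (todaTau (hurwitzElement β Q) s) := by
  have h := hasSum_youngDiagram_of_maya (hasSum_opExp_Jplus s
    (hurwitzElement β Q (opExp (-Jminus tbarVar) (ketGround s))))
    (fun S hS => by rw [schurVec_of_not _ _ hS, zero_mul])
  rw [todaTau, braGround]
  convert h using 1
  ext1 lam
  rw [opExp_neg_Jminus_ketGround, hurwitzElement_apply, schurVec_mayaOf, schurVec_mayaOf,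
    weight_L0, weight_W0, smul_smul, MvPowerSeries.smul_eq_C_mul]
  have hev : (s * (s + 1) / 2 : ℤ) * 2 = s * (s + 1) :=
    Int.ediv_mul_cancel (Int.even_mul_succ_self s).two_dvd
  have hL : (s : ℂ) * (s + 1) / 2 + lam.card = ((s * (s + 1) / 2 + lam.card : ℤ) : ℂ) := by
    have : ((s * (s + 1) / 2 : ℤ) : ℂ) * 2 = s * (s + 1) := by exact_mod_cast hev
    push_cast
    rw [← this]; ring
  rw [hL, exp_log_mul_int hQ, zpow_add₀ hQ, zpow_natCast]
  have hW : Complex.exp (β / 2 * ((s : ℂ) * (s + 1) * (2 * s + 1) / 6 +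
      (kappa lam + (2 * s + 1) * lam.card))) =
      Complex.exp (β * ((s : ℂ) * ((s : ℂ) + 1) * (2 * (s : ℂ) + 1)) / 12) *
      Complex.exp (β * (kappa lam : ℂ) / 2) * Complex.exp (β * ((s : ℂ) + 1 / 2)) ^ lam.card := by
    rw [← Complex.exp_nat_mul, ← Complex.exp_add, ← Complex.exp_add]
    congr 1; ring
  rw [hW, mul_pow]
  simp only [const, map_mul, map_pow]
  ring

end Diagonal

/-! ### The cut-and-join operator on Jacobi–Trudi determinants -/

section CutJoinSchur

variable {R : Type*} [CommRing R] [Algebra ℚ R]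

lemma mul_completeSymInt_range (t : ℕ+ → R) {n : ℤ} {M : ℕ} (hM : n ≤ M) :
    ∑ i ∈ Finset.range M, psum t (i + 1) * completeSymInt t (n - i - 1) =
      (n : R) * completeSymInt t n := by
  rw [mul_completeSymInt t hM, Finset.sum_range_succ', psum_zero, zero_mul, add_zero]
  refine Finset.sum_congr rfl fun i _ => ?_
  congr 2; push_cast; ring

lemma sum_sum_add_succ (F : ℕ → R) {M : ℕ} (hF : ∀ l, M ≤ l → F l = 0) :
    ∑ i ∈ Finset.range M, ∑ j ∈ Finset.range M, F (i + j + 1) =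
      ∑ l ∈ Finset.range M, (l : R) * F l := by
  have h : ∀ i ∈ Finset.range M, ∑ j ∈ Finset.range M, F (i + j + 1) =
      ∑ l ∈ Finset.range M, if i < l then F l else 0 := by
    intro i hi
    simp only [Finset.mem_range] at hi
    have h1 : ∑ j ∈ Finset.range M, F (i + j + 1) =
        ∑ j ∈ Finset.range (M - i - 1), F (i + j + 1) :=
      (Finset.sum_subset (by intro x; simp only [Finset.mem_range]; omega) fun x _ hx => hF _ (by
        simp only [Finset.mem_range] at hx; omega)).symm
    rw [h1, ← Finset.sum_filter]
    refine Finset.sum_nbij (fun j => i + j + 1) ?_ ?_ ?_ fun _ _ => rfl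
    · intro j hj
      simp only [Finset.mem_range, Finset.mem_filter] at hj ⊢
      omega
    · intro a _ b _ hab
      simp only at hab
      omega
    · intro l hl
      simp only [Finset.coe_filter, Finset.mem_range, Set.mem_ofPred_eq] at hl
      exact ⟨l - i - 1, by simp only [Finset.coe_range, Set.mem_Iio]; omega, by simp only; omega⟩
  rw [Finset.sum_congr rfl h, Finset.sum_comm]
  refine Finset.sum_congr rfl fun l hl => ?_
  rw [← Finset.sum_filter, Finset.sum_const, nsmul_eq_mul]
  congr 2
  have : (Finset.range M).filter (fun i => i < l) = Finset.range l := by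
    ext x; simp only [Finset.mem_range, Finset.mem_filter] at hl ⊢; omega
  rw [this, Finset.card_range]

/-- In one-based indices the first part is `∑_i (n - i) p_i h_{n-i}` and the second is `∑_l (l - 1)
p_l h_{n-l}`. Their sum is `(n - 1) ∑_i p_i h_{n-i}`, to which Newton's identity applies. -/
lemma sum_sum_completeSymInt (t : ℕ+ → R) {n : ℤ} {M : ℕ} (hM : n ≤ M) :
    ∑ i ∈ Finset.range M, ∑ j ∈ Finset.range M,
      (psum t (i + 1) * psum t (j + 1) * completeSymInt t (n - (i + j + 1 : ℕ) - 1) +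
        psum t (i + j + 2) * completeSymInt t (n - (i + j + 1 : ℕ) - 1)) =
      (n : R) * (n - 1) * completeSymInt t n := by
  simp_rw [Finset.sum_add_distrib]
  rw [sum_sum_add_succ (fun l => psum t (l + 1) * completeSymInt t (n - l - 1)) fun l hl => by
    rw [completeSymInt_of_neg t (by omega), mul_zero], ← Finset.sum_add_distrib,
    mul_comm (n : R), mul_assoc, ← mul_completeSymInt_range t hM, Finset.mul_sum]
  refine Finset.sum_congr rfl fun i hi => ?_
  have h := mul_completeSymInt_range t (n := n - i - 1) (M := M) (by omega)
  have h2 : ∑ j ∈ Finset.range M,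
      psum t (i + 1) * psum t (j + 1) * completeSymInt t (n - (i + j + 1 : ℕ) - 1) =
      psum t (i + 1) * (((n - i - 1 : ℤ) : R) * completeSymInt t (n - i - 1)) := by
    rw [← h, Finset.mul_sum]
    refine Finset.sum_congr rfl fun j _ => ?_
    rw [mul_assoc]
    congr 3; push_cast; ring
  rw [h2]
  push_cast
  ring

/-- The two-row contribution `∑_{i, j ≥ 1} p_{i + j} h_{n - i} h_{m - j}`. -/
def pairSum (t : ℕ+ → R) (n m : ℤ) : R :=
  ∑ i ∈ Finset.range n.toNat, ∑ j ∈ Finset.range m.toNat,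
    psum t (i + j + 2) * (completeSymInt t (n - i - 1) * completeSymInt t (m - j - 1))

lemma pairSum_eq (t : ℕ+ → R) {n m : ℤ} {M K : ℕ} (hn : n ≤ M) (hm : m ≤ K) :
    pairSum t n m = ∑ i ∈ Finset.range M, ∑ j ∈ Finset.range K,
      psum t (i + j + 2) * (completeSymInt t (n - i - 1) * completeSymInt t (m - j - 1)) := by
  rw [pairSum]
  have h1 : ∀ i, ∑ j ∈ Finset.range m.toNat,
      psum t (i + j + 2) * (completeSymInt t (n - i - 1) * completeSymInt t (m - j - 1)) =
      ∑ j ∈ Finset.range K,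
      psum t (i + j + 2) * (completeSymInt t (n - i - 1) * completeSymInt t (m - j - 1)) := fun i =>
    Finset.sum_subset (by intro x; simp only [Finset.mem_range]; omega) fun x _ hx => by
      simp only [Finset.mem_range] at hx
      rw [completeSymInt_of_neg t (n := m - x - 1) (by omega), mul_zero, mul_zero]
  simp_rw [h1]
  refine Finset.sum_subset (by intro x; simp only [Finset.mem_range]; omega) fun x _ hx => ?_
  simp only [Finset.mem_range] at hx
  refine Finset.sum_eq_zero fun j _ => ?_
  rw [completeSymInt_of_neg t (n := n - x - 1) (by omega), zero_mul, mul_zero]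

/-- The two double sums agree after shifting both indices, except for the boundary terms, which
Newton's identity evaluates. `pairSum` has no closed form, but this difference does, and only the
difference survives antisymmetrization. -/
lemma pairSum_sub (t : ℕ+ → R) (n m : ℤ) :
    pairSum t n (m - 1) - pairSum t (n - 1) m =
      (m : R) * (completeSymInt t m * completeSymInt t (n - 1)) -
        n * (completeSymInt t n * completeSymInt t (m - 1)) := by
  obtain ⟨M, hnM, hmM⟩ : ∃ M : ℕ, n ≤ M ∧ m ≤ M := ⟨max n.toNat m.toNat, by omega, by omega⟩
  rw [pairSum_eq t (M := M + 1) (K := M) (by omega) (by omega),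
    pairSum_eq t (n := n - 1) (M := M) (K := M + 1) (by omega) (by omega), Finset.sum_range_succ']
  simp_rw [Finset.sum_range_succ' _ M]
  rw [Finset.sum_add_distrib]
  have e1 : ∑ i ∈ Finset.range M, ∑ j ∈ Finset.range M, psum t (i + 1 + j + 2) *
      (completeSymInt t (n - (i + 1 : ℕ) - 1) * completeSymInt t (m - 1 - j - 1)) =
      ∑ i ∈ Finset.range M, ∑ j ∈ Finset.range M, psum t (i + (j + 1) + 2) *
      (completeSymInt t (n - 1 - i - 1) * completeSymInt t (m - (j + 1 : ℕ) - 1)) := by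
    refine Finset.sum_congr rfl fun i _ => Finset.sum_congr rfl fun j _ => ?_
    congr 2
    · congr 1; omega
    · congr 1; push_cast; ring
    · congr 1; push_cast; ring
  have e2 : ∀ k : ℤ, k ≤ M → ∑ j ∈ Finset.range M,
      psum t (j + 2) * completeSymInt t (k - 1 - j - 1) =
      (k : R) * completeSymInt t k - psum t 1 * completeSymInt t (k - 1) := by
    intro k hk
    rw [← mul_completeSymInt_range t (n := k) (M := M + 1) (by omega), Finset.sum_range_succ']
    simp only [zero_add, Nat.cast_zero, sub_zero, add_sub_cancel_right]
    refine Finset.sum_congr rfl fun j _ => ?_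
    congr 2; push_cast; ring
  have e3 : ∑ j ∈ Finset.range M, psum t (0 + j + 2) *
      (completeSymInt t (n - (0 : ℕ) - 1) * completeSymInt t (m - 1 - j - 1)) =
      completeSymInt t (n - 1) *
        ((m : R) * completeSymInt t m - psum t 1 * completeSymInt t (m - 1)) := by
    rw [← e2 m hmM, Finset.mul_sum]
    refine Finset.sum_congr rfl fun j _ => ?_
    rw [zero_add]; push_cast; rw [sub_zero]; ring
  have e4 : ∑ i ∈ Finset.range M, psum t (i + 0 + 2) *
      (completeSymInt t (n - 1 - i - 1) * completeSymInt t (m - (0 : ℕ) - 1)) =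
      completeSymInt t (m - 1) *
        ((n : R) * completeSymInt t n - psum t 1 * completeSymInt t (n - 1)) := by
    rw [← e2 n hnM, Finset.mul_sum]
    refine Finset.sum_congr rfl fun j _ => ?_
    rw [add_zero]; push_cast; rw [sub_zero]; ring
  rw [e1, e3, e4]
  ring

/-- Twice the cut-and-join operator
`∑_{i, j ≥ 1} (p_i p_j ∂_{i + j} + p_{i + j} ∂_i ∂_j)`, with `D i = ∂ / ∂ t_{i + 1}`. -/
def cutJoin {A : Type*} [CommRing A] [Algebra A R] (t : ℕ+ → R) (D : ℕ → Derivation A R R) (M : ℕ)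
    (x : R) : R :=
  ∑ i ∈ Finset.range M, ∑ j ∈ Finset.range M,
    (psum t (i + 1) * psum t (j + 1) * D (i + j + 1) x + psum t (i + j + 2) * D i (D j x))

variable {N : ℕ}

/-- The product `∏_a h_{α_a}`. -/
def completeProd (t : ℕ+ → R) (α : Fin N → ℤ) : R := ∏ a, completeSymInt t (α a)

lemma completeProd_update (t : ℕ+ → R) (α : Fin N → ℤ) (a : Fin N) (n : ℤ) :
    completeProd t (Function.update α a n) =
      completeSymInt t n * ∏ b ∈ Finset.univ.erase a, completeSymInt t (α b) := by
  rw [completeProd, ← Finset.mul_prod_erase _ _ (Finset.mem_univ a), Function.update_self]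
  congr 1
  refine Finset.prod_congr rfl fun b hb => ?_
  rw [Function.update_of_ne (Finset.ne_of_mem_erase hb)]

lemma completeProd_update_update (t : ℕ+ → R) (α : Fin N → ℤ) {a b : Fin N} (hab : a ≠ b)
    (n m : ℤ) : completeProd t (Function.update (Function.update α b m) a n) =
      completeSymInt t n * completeSymInt t m *
        ∏ c ∈ (Finset.univ.erase a).erase b, completeSymInt t (α c) := by
  rw [completeProd_update, ← Finset.mul_prod_erase (Finset.univ.erase a) _
    (Finset.mem_erase.2 ⟨hab.symm, Finset.mem_univ b⟩), Function.update_self, mul_assoc]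
  congr 2
  refine Finset.prod_congr rfl fun c hc => ?_
  rw [Function.update_of_ne (Finset.ne_of_mem_erase hc)]

section Derivations

variable {A : Type*} [CommRing A] [Algebra A R] {t : ℕ+ → R} {D : ℕ → Derivation A R R}

lemma derivation_completeProd (hD : ∀ i n, D i (completeSymInt t n) = completeSymInt t (n - i - 1))
    (α : Fin N → ℤ) (i : ℕ) :
    D i (completeProd t α) = ∑ a, completeProd t (Function.update α a (α a - i - 1)) := by
  rw [completeProd, derivation_prod]
  refine Finset.sum_congr rfl fun a _ => ?_
  rw [completeProd_update, hD]

/-- Terms in which the derivatives hit a single factor give `α_a (α_a - 1)` by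
`sum_sum_completeSymInt`. Terms in which they hit two different factors give `pairSum`. -/
lemma cutJoin_completeProd
    (hD : ∀ i n, D i (completeSymInt t n) = completeSymInt t (n - i - 1))
    (α : Fin N → ℤ) {M : ℕ} (hM : ∀ a, α a ≤ M) :
    cutJoin t D M (completeProd t α) =
      ∑ a, ((α a : R) * (α a - 1) * completeProd t α + ∑ b ∈ Finset.univ.erase a,
        pairSum t (α a) (α b) * ∏ c ∈ (Finset.univ.erase a).erase b, completeSymInt t (α c)) := by
  have h1 : ∀ i j : ℕ, D i (D j (completeProd t α)) =
      ∑ a, (completeProd t (Function.update α a (α a - (i + j + 1 : ℕ) - 1)) +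
        ∑ b ∈ Finset.univ.erase a, completeSymInt t (α a - i - 1) * completeSymInt t (α b - j - 1) *
          ∏ c ∈ (Finset.univ.erase a).erase b, completeSymInt t (α c)) := by
    intro i j
    rw [derivation_completeProd hD, map_sum]
    simp_rw [derivation_completeProd hD]
    rw [Finset.sum_comm]
    refine Finset.sum_congr rfl fun a _ => ?_
    rw [← Finset.add_sum_erase _ _ (Finset.mem_univ a)]
    congr 1
    · rw [Function.update_idem, Function.update_self]
      congr 2; push_cast; ring
    · refine Finset.sum_congr rfl fun b hb => ?_
      have hab := (Finset.ne_of_mem_erase hb).symm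
      rw [Function.update_of_ne hab, completeProd_update_update t α hab]
  simp only [cutJoin, h1]
  simp only [derivation_completeProd hD, Finset.mul_sum]
  simp_rw [← Finset.sum_add_distrib]
  rw [Finset.sum_congr rfl fun i _ => Finset.sum_comm, Finset.sum_comm]
  refine Finset.sum_congr rfl fun a _ => ?_
  simp_rw [mul_add, ← add_assoc, Finset.sum_add_distrib]
  congr 1
  · simp_rw [← Finset.sum_add_distrib, completeProd_update, ← mul_assoc, ← add_mul,
      ← Finset.sum_mul]
    simp_rw [add_mul]
    rw [sum_sum_completeSymInt t (hM a), completeProd,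
      ← Finset.mul_prod_erase _ _ (Finset.mem_univ a)]
    ring
  · simp_rw [Finset.mul_sum]
    rw [Finset.sum_congr rfl fun i _ => Finset.sum_comm, Finset.sum_comm]
    refine Finset.sum_congr rfl fun b _ => ?_
    rw [pairSum_eq t (hM a) (hM b), Finset.sum_mul]
    refine Finset.sum_congr rfl fun i _ => ?_
    rw [Finset.sum_mul]
    exact Finset.sum_congr rfl fun j _ => by ring

end Derivations

/-! ### The Vandermonde polynomial and its Euler derivatives -/

section Vandermonde

open MvPolynomial

/-- The Vandermonde determinant `det (x_a^j)`. -/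
def vdm (N : ℕ) : MvPolynomial (Fin N) ℤ := (Matrix.vandermonde fun a : Fin N => X a).det

/-- The exponents `a ↦ σ(a)`. -/
def permExp (σ : Equiv.Perm (Fin N)) : Fin N →₀ ℕ := Finsupp.equivFunOnFinite.symm fun a => σ a

lemma vdm_eq_sum : vdm N = ∑ σ : Equiv.Perm (Fin N),
    ((Equiv.Perm.sign σ : ℤ)) • monomial (permExp σ) (1 : ℤ) := by
  rw [vdm, ← Matrix.det_transpose, Matrix.det_apply]
  refine Finset.sum_congr rfl fun σ _ => ?_
  rw [Units.smul_def]
  congr 1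
  rw [monomial_eq, C_1, one_mul, Finsupp.prod_fintype _ _ (by simp)]
  rfl

/-- The pairs `i < j`. -/
def ltPairs (N : ℕ) : Finset (Fin N × Fin N) := Finset.univ.filter fun x => x.1 < x.2

lemma vdm_eq_prod : vdm N = ∏ x ∈ ltPairs N, (X x.2 - X x.1) := by
  rw [vdm, Matrix.det_vandermonde, ltPairs, Finset.prod_filter, ← Finset.univ_product_univ,
    Finset.prod_product]
  refine Finset.prod_congr rfl fun i _ => ?_
  rw [← Finset.prod_filter]
  exact Finset.prod_congr (by ext j; simp) fun _ _ => rfl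

/-- The quotient of the Vandermonde determinant by `x_a - x_b`. -/
def vdmQuot (a b : Fin N) : MvPolynomial (Fin N) ℤ :=
  if a < b then -∏ x ∈ (ltPairs N).erase (a, b), (X x.2 - X x.1)
  else ∏ x ∈ (ltPairs N).erase (b, a), (X x.2 - X x.1)

lemma vdmQuot_symm {a b : Fin N} (hab : a ≠ b) : vdmQuot b a = -vdmQuot a b := by
  unfold vdmQuot
  rcases lt_or_gt_of_ne hab with h | h
  · rw [if_pos h, if_neg h.le.not_gt, neg_neg]
  · rw [if_pos h, if_neg h.le.not_gt]

lemma sub_mul_vdmQuot {a b : Fin N} (hab : a ≠ b) : (X a - X b) * vdmQuot a b = vdm N := by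
  have key : ∀ a b : Fin N, a < b → (X a - X b) * vdmQuot a b = vdm N := by
    intro a b h
    rw [vdm_eq_prod, vdmQuot, if_pos h,
      ← Finset.mul_prod_erase (ltPairs N) _ (a := (a, b)) (by simp [ltPairs, h])]
    ring
  rcases lt_or_gt_of_ne hab with h | h
  · exact key a b h
  · rw [← key b a h, vdmQuot_symm hab]; ring

/-- Logarithmic derivative: `∂_a V = ∑_{b ≠ a} V / (x_a - x_b)`. -/
lemma pderiv_vdm (a : Fin N) : pderiv a (vdm N) = ∑ b ∈ Finset.univ.erase a, vdmQuot a b := by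
  rw [vdm_eq_prod, derivation_prod]
  have h : ∀ x ∈ ltPairs N, pderiv a ((X x.2 - X x.1 : MvPolynomial (Fin N) ℤ)) *
      ∏ y ∈ (ltPairs N).erase x, (X y.2 - X y.1) =
      (if x.2 = a then vdmQuot a x.1 else 0) + (if x.1 = a then vdmQuot a x.2 else 0) := by
    intro x hx
    have hlt : x.1 < x.2 := by simpa [ltPairs] using hx
    rw [map_sub, pderiv_X, pderiv_X]
    by_cases h2 : x.2 = a
    · have h1 : x.1 ≠ a := by rw [← h2]; exact hlt.ne
      rw [if_pos h2, if_neg h1, ← h2, Pi.single_eq_same, Pi.single_eq_of_ne hlt.ne, vdmQuot,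
        if_neg hlt.le.not_gt]
      simp
    · by_cases h1 : x.1 = a
      · rw [if_neg h2, if_pos h1, ← h1, Pi.single_eq_same, Pi.single_eq_of_ne hlt.ne', vdmQuot,
          if_pos hlt]
        simp
      · rw [if_neg h2, if_neg h1, Pi.single_eq_of_ne h2, Pi.single_eq_of_ne h1]
        simp
  rw [Finset.sum_congr rfl h, Finset.sum_add_distrib, ltPairs, Finset.sum_filter,
    Finset.sum_filter, ← Finset.univ_product_univ, Finset.sum_product, Finset.sum_product]
  have e1 : ∀ i : Fin N, ∑ j : Fin N, (if (i, j).1 < (i, j).2 then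
      if (i, j).2 = a then vdmQuot a (i, j).1 else 0 else 0) = if i < a then vdmQuot a i else 0 := by
    intro i
    rw [Finset.sum_eq_single a]
    · simp
    · intro j _ hj; simp [hj]
    · simp
  have e2 : ∑ i : Fin N, ∑ j : Fin N, (if (i, j).1 < (i, j).2 then
      if (i, j).1 = a then vdmQuot a (i, j).2 else 0 else 0) =
      ∑ j : Fin N, if a < j then vdmQuot a j else 0 := by
    rw [Finset.sum_eq_single a]
    · simp
    · intro i _ hi; simp [hi]
    · simp
  rw [Finset.sum_congr rfl fun i _ => e1 i, e2, ← Finset.sum_add_distrib,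
    ← Finset.add_sum_erase _ _ (Finset.mem_univ a)]
  simp only [lt_irrefl, if_false, add_zero, zero_add]
  refine Finset.sum_congr rfl fun b hb => ?_
  rcases lt_or_gt_of_ne (Finset.ne_of_mem_erase hb) with h | h
  · rw [if_pos h, if_neg h.le.not_gt, add_zero]
  · rw [if_pos h, if_neg h.le.not_gt, zero_add]

/-- The operator `x_a ∂ / ∂ x_a`. -/
def euler (a : Fin N) : MvPolynomial (Fin N) ℤ →ₗ[ℤ] MvPolynomial (Fin N) ℤ :=
  LinearMap.mulLeft ℤ (X a) ∘ₗ (pderiv a).toLinearMap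

lemma euler_monomial (a : Fin N) (c : Fin N →₀ ℕ) :
    euler a (monomial c 1) = (c a : ℤ) • monomial c (1 : ℤ) := by
  change X a * pderiv a (monomial c (1 : ℤ)) = _
  rw [X_mul_pderiv_monomial, natCast_zsmul]

lemma euler_vdm (a : Fin N) : euler a (vdm N) = ∑ b ∈ Finset.univ.erase a, X a * vdmQuot a b := by
  change X a * pderiv a (vdm N) = _
  rw [pderiv_vdm, Finset.mul_sum]

end Vandermonde

/-! ### Antisymmetrization through linear functionals on polynomials -/

section Functional

open MvPolynomial

/-- The linear functional `x^c ↦ F(c)` on polynomials. -/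
def monomialFunctional (F : (Fin N →₀ ℕ) → R) : MvPolynomial (Fin N) ℤ →ₗ[ℤ] R :=
  (basisMonomials (Fin N) ℤ).constr ℤ F

lemma monomialFunctional_monomial (F : (Fin N →₀ ℕ) → R) (c : Fin N →₀ ℕ) :
    monomialFunctional F (monomial c 1) = F c := by
  have := (basisMonomials (Fin N) ℤ).constr_basis ℤ F c
  rwa [coe_basisMonomials] at this

lemma linearMap_ext_monomial {F G : MvPolynomial (Fin N) ℤ →ₗ[ℤ] R}
    (h : ∀ c, F (monomial c 1) = G (monomial c 1)) : F = G :=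
  (basisMonomials (Fin N) ℤ).ext fun c => by rw [coe_basisMonomials]; exact h c

/-- `x^c ↦ ∏_a h_{f_a + c_a}`. -/
def prodFunctional (t : ℕ+ → R) (f : Fin N → ℤ) : MvPolynomial (Fin N) ℤ →ₗ[ℤ] R :=
  monomialFunctional fun c => completeProd t fun a => f a + c a

/-- The functional for the contribution of two rows to the cut-and-join operator. -/
def pairFunctional (t : ℕ+ → R) (f : Fin N → ℤ) (a b : Fin N) : MvPolynomial (Fin N) ℤ →ₗ[ℤ] R :=
  monomialFunctional fun c => pairSum t (f a + c a) (f b + c b) *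
    ∏ d ∈ (Finset.univ.erase a).erase b, completeSymInt t (f d + c d)

/-- This is `pairSum_sub` in generating form: multiplication by `x_a` raises the index of row `a`,
and the factor `f_a + c_a` becomes the operator `f_a + x_a ∂_a`. -/
lemma pairFunctional_sub_mul (t : ℕ+ → R) (f : Fin N → ℤ) {a b : Fin N} (hab : a ≠ b)
    (q : MvPolynomial (Fin N) ℤ) :
    pairFunctional t f a b ((X a - X b) * q) =
      prodFunctional t f (f b • (X b * q) + euler b (X b * q)) -
        prodFunctional t f (f a • (X a * q) + euler a (X a * q)) := by
  have key : pairFunctional t f a b ∘ₗ LinearMap.mulLeft ℤ (X a - X b) =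
      prodFunctional t f ∘ₗ (f b • LinearMap.mulLeft ℤ (X b) + euler b ∘ₗ LinearMap.mulLeft ℤ (X b))
      - prodFunctional t f ∘ₗ
        (f a • LinearMap.mulLeft ℤ (X a) + euler a ∘ₗ LinearMap.mulLeft ℤ (X a)) := by
    refine linearMap_ext_monomial fun c => ?_
    have hX : ∀ d : Fin N, X d * monomial c (1 : ℤ) = monomial (Finsupp.single d 1 + c) 1 := by
      intro d; rw [X, monomial_mul, mul_one]
    simp only [LinearMap.comp_apply, LinearMap.sub_apply, LinearMap.add_apply, LinearMap.smul_apply,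
      LinearMap.mulLeft_apply, sub_mul, hX, map_sub, map_add, map_smul, euler_monomial]
    have hprod : ∀ d e : Fin N, (d = a ∨ d = b) → (e = a ∨ e = b) → d ≠ e →
        prodFunctional t f (monomial (Finsupp.single d 1 + c) 1) =
        completeSymInt t (f d + c d + 1) * completeSymInt t (f e + c e) *
          ∏ x ∈ (Finset.univ.erase a).erase b, completeSymInt t (f x + c x) := by
      intro d e hd he hde
      rw [prodFunctional, monomialFunctional_monomial, completeProd]
      have hset : (Finset.univ.erase a).erase b = (Finset.univ.erase d).erase e := by
        rcases hd with rfl | rfl <;> rcases he with rfl | rfl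
        · exact absurd rfl hde
        · rfl
        · exact Finset.erase_right_comm
        · exact absurd rfl hde
      rw [hset, ← Finset.mul_prod_erase _ _ (Finset.mem_univ d),
        ← Finset.mul_prod_erase (Finset.univ.erase d) _
          (Finset.mem_erase.2 ⟨hde.symm, Finset.mem_univ e⟩), mul_assoc]
      congr 1
      · congr 1; simp; ring
      congr 1
      · congr 1; simp [hde]
      · refine Finset.prod_congr rfl fun x hx => ?_
        have : d ≠ x := (Finset.ne_of_mem_erase (Finset.mem_of_mem_erase hx)).symm
        simp [this]
    have hpair : ∀ d : Fin N, (d = a ∨ d = b) →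
        pairFunctional t f a b (monomial (Finsupp.single d 1 + c) 1) =
        pairSum t (f a + c a + if d = a then 1 else 0) (f b + c b + if d = b then 1 else 0) *
          ∏ x ∈ (Finset.univ.erase a).erase b, completeSymInt t (f x + c x) := by
      intro d hd
      rw [pairFunctional, monomialFunctional_monomial]
      congr 1
      · congr 1
        · simp only [Finsupp.add_apply, Finsupp.single_apply]; split_ifs <;> push_cast <;> ring
        · simp only [Finsupp.add_apply, Finsupp.single_apply]; split_ifs <;> push_cast <;> ring
      · refine Finset.prod_congr rfl fun x hx => ?_
        have h1 : x ≠ a := Finset.ne_of_mem_erase (Finset.mem_of_mem_erase hx)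
        have h2 : x ≠ b := Finset.ne_of_mem_erase hx
        have : d ≠ x := by rcases hd with rfl | rfl <;> tauto
        simp [this]
    rw [hpair a (Or.inl rfl), hpair b (Or.inr rfl), hprod a b (Or.inl rfl) (Or.inr rfl) hab,
      hprod b a (Or.inr rfl) (Or.inl rfl) hab.symm, if_pos rfl, if_neg hab, if_pos rfl,
      if_neg hab.symm, ← sub_mul]
    have hp := pairSum_sub t (f a + c a + 1) (f b + c b + 1)
    rw [add_sub_cancel_right, add_sub_cancel_right] at hp
    rw [add_zero, add_zero, hp]
    simp only [zsmul_eq_mul, Finsupp.add_apply, Finsupp.single_eq_same]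
    push_cast
    ring
  exact LinearMap.congr_fun key q

lemma prodFunctional_vdm (t : ℕ+ → R) (f : Fin N → ℤ) : prodFunctional t f (vdm N) = jt t f := by
  rw [vdm_eq_sum, map_sum, jt, ← Matrix.det_transpose, Matrix.det_apply]
  refine Finset.sum_congr rfl fun σ _ => ?_
  rw [map_smul, prodFunctional, monomialFunctional_monomial, Units.smul_def]
  rfl

/-- The eigenvalue of twice the cut-and-join operator on the Jacobi–Trudi determinant. -/
def cutJoinEigenvalue (f : Fin N → ℤ) : ℤ :=
  ∑ a, (f a * (f a - 1)) - ∑ a : Fin N, ((a : ℕ) * ((a : ℕ) + 1) : ℤ)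

/-- The exponents of every monomial of the Vandermonde polynomial are a permutation of `0, …, N -
1`. -/
lemma sum_euler_vdm : ∑ a : Fin N, (euler a (euler a (vdm N)) + euler a (vdm N)) =
    (∑ a : Fin N, ((a : ℕ) * ((a : ℕ) + 1) : ℤ)) • vdm N := by
  rw [vdm_eq_sum]
  simp only [map_sum, map_smul, euler_monomial]
  rw [Finset.smul_sum]
  simp_rw [← Finset.sum_add_distrib]
  rw [Finset.sum_comm]
  refine Finset.sum_congr rfl fun σ _ => ?_
  rw [smul_comm, (Equiv.sum_comp σ fun a : Fin N => ((a : ℕ) * ((a : ℕ) + 1) : ℤ)).symm,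
    Finset.sum_smul, Finset.smul_sum]
  refine Finset.sum_congr rfl fun a _ => ?_
  have : permExp σ a = ((σ a : Fin N) : ℕ) := rfl
  rw [this]
  module

/-- Jacobi–Trudi determinants are eigenvectors of the cut-and-join operator. -/
lemma cutJoin_jt {A : Type*} [CommRing A] [Algebra A R] {t : ℕ+ → R} {D : ℕ → Derivation A R R}
    (hD : ∀ i n, D i (completeSymInt t n) = completeSymInt t (n - i - 1))
    (f : Fin N → ℤ) {M : ℕ} (hM : ∀ a, f a + N ≤ M) :
    cutJoin t D M (jt t f) = (cutJoinEigenvalue f : R) * jt t f := by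
  have hadd : ∀ (ι : Type) (s : Finset ι) (c : ι → ℤ) (x : ι → R),
      cutJoin t D M (∑ i ∈ s, c i • x i) = ∑ i ∈ s, c i • cutJoin t D M (x i) := by
    intro ι s c x
    have : ∀ x, cutJoin t D M x = (∑ i ∈ Finset.range M, ∑ j ∈ Finset.range M,
      (AddMonoidHom.mulLeft (psum t (i + 1) * psum t (j + 1))).comp
        (D (i + j + 1)).toLinearMap.toAddMonoidHom +
      ∑ i ∈ Finset.range M, ∑ j ∈ Finset.range M, (AddMonoidHom.mulLeft (psum t (i + j + 2))).comp
        ((D i).toLinearMap.toAddMonoidHom.comp (D j).toLinearMap.toAddMonoidHom)) x := by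
      intro x
      simp only [cutJoin, AddMonoidHom.add_apply, AddMonoidHom.finsetSum_apply,
        Finset.sum_add_distrib]
      rfl
    simp_rw [this, map_sum, map_zsmul]
  have h1 : jt t f = ∑ σ : Equiv.Perm (Fin N), (Equiv.Perm.sign σ : ℤ) •
      completeProd t (fun a => f a + permExp σ a) := by
    rw [← prodFunctional_vdm, vdm_eq_sum, map_sum]
    refine Finset.sum_congr rfl fun σ _ => ?_
    rw [map_smul, prodFunctional, monomialFunctional_monomial]
  -- Expand `n (n - 1)` at `n = f_a + c_a` in powers of `c_a`, which `euler a` reads off from the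
  -- monomial.
  have h2 : ∀ (a : Fin N) (c : Fin N →₀ ℕ), (((f a + c a : ℤ) : R) * ((f a + c a : ℤ) - 1)) *
      completeProd t (fun a => f a + c a) = prodFunctional t f
        ((f a * (f a - 1)) • monomial c 1 + (2 * f a - 1) • euler a (monomial c 1) +
          euler a (euler a (monomial c 1))) := by
    intro a c
    simp only [map_add, map_smul, euler_monomial]
    rw [prodFunctional, monomialFunctional_monomial]
    simp only [zsmul_eq_mul]
    push_cast
    ring
  have h3 : cutJoin t D M (jt t f) = ∑ a, (prodFunctional t f
      ((f a * (f a - 1)) • vdm N + (2 * f a - 1) • euler a (vdm N) + euler a (euler a (vdm N))) +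
      ∑ b ∈ Finset.univ.erase a, pairFunctional t f a b (vdm N)) := by
    rw [h1, hadd]
    have h4 : ∀ σ : Equiv.Perm (Fin N), cutJoin t D M (completeProd t fun a => f a + permExp σ a) =
        ∑ a, (prodFunctional t f ((f a * (f a - 1)) • monomial (permExp σ) 1 +
          (2 * f a - 1) • euler a (monomial (permExp σ) 1) +
          euler a (euler a (monomial (permExp σ) 1))) + ∑ b ∈ Finset.univ.erase a,
            pairFunctional t f a b (monomial (permExp σ) 1)) := by
      intro σ
      rw [cutJoin_completeProd hD _ fun a => by
        have := hM a
        have h5 : permExp σ a = ((σ a : Fin N) : ℕ) := rfl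
        have := (σ a).2
        omega]
      refine Finset.sum_congr rfl fun a _ => ?_
      rw [h2]
      simp only [pairFunctional, monomialFunctional_monomial]
    simp_rw [h4, vdm_eq_sum, Finset.smul_sum]
    rw [Finset.sum_comm]
    refine Finset.sum_congr rfl fun a _ => ?_
    simp_rw [smul_add, Finset.sum_add_distrib, map_add, map_sum, map_smul, Finset.smul_sum, map_sum,
      map_smul]
    rw [Finset.sum_comm (s := Finset.univ.erase a)]
    simp_rw [smul_add, Finset.sum_add_distrib, smul_comm (_ : ℤ) ((Equiv.Perm.sign _ : ℤˣ) : ℤ)]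
    simp_rw [Finset.smul_sum, smul_comm (2 * f a - 1)]
  -- Write `V = (x_a - x_b) · vdmQuot a b`. Each ordered pair gives one term for `a` and one for
  -- `b`; summing the quotients over the other index restores Euler derivatives of `V`, twice.
  have h5 : ∑ a : Fin N, ∑ b ∈ Finset.univ.erase a, pairFunctional t f a b (vdm N) =
      -2 * ∑ a, prodFunctional t f (f a • euler a (vdm N) + euler a (euler a (vdm N))) := by
    have h6 : ∀ a, ∀ b ∈ Finset.univ.erase a, pairFunctional t f a b (vdm N) =
        -prodFunctional t f (f a • (X a * vdmQuot a b) + euler a (X a * vdmQuot a b)) -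
          prodFunctional t f (f b • (X b * vdmQuot b a) + euler b (X b * vdmQuot b a)) := by
      intro a b hb
      have hab := (Finset.ne_of_mem_erase hb).symm
      rw [← sub_mul_vdmQuot hab, pairFunctional_sub_mul t f hab, vdmQuot_symm hab]
      simp only [mul_neg, smul_neg, map_neg, map_add]
      ring
    have h7 : ∀ a, ∑ b ∈ Finset.univ.erase a,
        prodFunctional t f (f a • (X a * vdmQuot a b) + euler a (X a * vdmQuot a b)) =
        prodFunctional t f (f a • euler a (vdm N) + euler a (euler a (vdm N))) := by
      intro a
      rw [← map_sum, Finset.sum_add_distrib, ← Finset.smul_sum, ← map_sum, ← euler_vdm]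
    have h8 : ∑ a, ∑ b ∈ Finset.univ.erase a,
        prodFunctional t f (f b • (X b * vdmQuot b a) + euler b (X b * vdmQuot b a)) =
        ∑ a, prodFunctional t f (f a • euler a (vdm N) + euler a (euler a (vdm N))) := by
      rw [Finset.sum_comm' (t' := Finset.univ) (s' := fun b => Finset.univ.erase b)
        (by simp [ne_comm])]
      exact Finset.sum_congr rfl fun b _ => h7 b
    rw [Finset.sum_congr rfl fun a _ => Finset.sum_congr rfl (h6 a)]
    simp_rw [Finset.sum_sub_distrib, Finset.sum_neg_distrib]
    rw [h8, Finset.sum_congr rfl fun a _ => h7 a]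
    ring
  rw [h3, Finset.sum_add_distrib, h5, Finset.mul_sum, ← Finset.sum_add_distrib,
    ← prodFunctional_vdm]
  -- The terms `f_a · euler a` cancel. What is left besides `f_a (f_a - 1)` is the symmetric
  -- operator of `sum_euler_vdm`.
  have h6 : ∀ a : Fin N, prodFunctional t f
      ((f a * (f a - 1)) • vdm N + (2 * f a - 1) • euler a (vdm N) + euler a (euler a (vdm N))) +
      -2 * prodFunctional t f (f a • euler a (vdm N) + euler a (euler a (vdm N))) =
      prodFunctional t f ((f a * (f a - 1)) • vdm N - (euler a (euler a (vdm N)) +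
        euler a (vdm N))) := by
    intro a
    simp only [map_add, map_sub, map_smul]
    simp only [zsmul_eq_mul]
    push_cast
    ring
  rw [Finset.sum_congr rfl fun a _ => h6 a, ← map_sum, Finset.sum_sub_distrib, sum_euler_vdm,
    ← Finset.sum_smul, ← sub_smul, map_smul, zsmul_eq_mul]
  rfl

end Functional

end CutJoinSchur

/-! ### Cycles of permutations under multiplication by a transposition -/

section Orbits

open Equiv Equiv.Perm

variable {α : Type*} [Fintype α] [DecidableEq α]

/-- The orbit of `a` under the permutation `w`. -/
def orb (w : Perm α) (a : α) : Finset α := Finset.univ.filter (w.SameCycle a)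

/-- The set of orbits of the permutation `w`. -/
def orbits (w : Perm α) : Finset (Finset α) := Finset.univ.image (orb w)

lemma mem_orb {w : Perm α} {a b : α} : b ∈ orb w a ↔ w.SameCycle a b := by simp [orb]

lemma self_mem_orb (w : Perm α) (a : α) : a ∈ orb w a := mem_orb.2 (SameCycle.refl _ _)

lemma orb_eq_iff {w : Perm α} {a b : α} : orb w a = orb w b ↔ w.SameCycle a b := by
  constructor
  · intro h
    exact mem_orb.1 (h ▸ self_mem_orb w b)
  · intro h
    ext c
    rw [mem_orb, mem_orb]
    exact ⟨fun h' => h.symm.trans h', fun h' => h.trans h'⟩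

lemma orb_mem_orbits (w : Perm α) (a : α) : orb w a ∈ orbits w :=
  Finset.mem_image_of_mem _ (Finset.mem_univ a)

lemma forall_mem_orbits {w : Perm α} {P : Finset α → Prop} :
    (∀ O ∈ orbits w, P O) ↔ ∀ a, P (orb w a) := by simp [orbits]

lemma card_pos_of_mem_orbits {w : Perm α} {O : Finset α} (hO : O ∈ orbits w) : 0 < O.card :=
  (forall_mem_orbits (P := fun O => 0 < O.card)).2
    (fun a => Finset.card_pos.2 ⟨a, self_mem_orb w a⟩) O hO

lemma sum_orb {R : Type*} [CommRing R] (w : Perm α) (F : Finset α → R) :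
    ∑ a, F (orb w a) = ∑ O ∈ orbits w, (O.card : R) * F O := by
  rw [Finset.sum_comp F (orb w)]
  refine Finset.sum_congr rfl fun O hO => ?_
  rw [nsmul_eq_mul]
  congr 2
  revert O
  refine forall_mem_orbits.2 fun a => ?_
  congr 1
  ext b
  rw [Finset.mem_filter, orb_eq_iff, mem_orb, sameCycle_comm]
  simp

lemma sameCycle_le {w : Perm α} {r : α → α → Prop} (hr : Equivalence r) (h : ∀ a, r a (w a))
    {a b : α} (hab : w.SameCycle a b) : r a b := by
  obtain ⟨n, -, rfl⟩ := hab.exists_pow_eq'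
  clear hab
  induction n with
  | zero => exact hr.refl a
  | succ n ih => rw [pow_succ', Perm.mul_apply]; exact hr.trans ih (h _)

lemma sameCycle_equivalence (w : Perm α) : Equivalence w.SameCycle :=
  ⟨SameCycle.refl w, fun h => h.symm, fun h h' => h.trans h'⟩

lemma sameCycle_apply_self (w : Perm α) (a : α) : w.SameCycle a (w a) := ⟨1, by simp⟩

/-- Starting at `x`, the product first jumps to `w y` and then follows the cycle of `y` under `w`
until it reaches `y`. -/
lemma sameCycle_mul_swap_self {w : Perm α} {x y : α} (h : ¬ w.SameCycle x y) :
    (w * swap x y).SameCycle x y := by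
  by_contra hn
  have key : ∀ n : ℕ, (w * swap x y).SameCycle x ((w ^ (n + 1)) y) := by
    intro n
    induction n with
    | zero => convert sameCycle_apply_self (w * swap x y) x using 1; simp
    | succ n ih =>
      refine ih.trans ?_
      have h1 : (w ^ (n + 1)) y ≠ y := fun h1 => by rw [h1] at ih; exact hn ih
      have h2 : (w ^ (n + 1)) y ≠ x := fun h2 =>
        h (SameCycle.symm ⟨(n + 1 : ℕ), by rw [zpow_natCast]; exact h2⟩)
      convert sameCycle_apply_self (w * swap x y) ((w ^ (n + 1)) y) using 1
      rw [Perm.mul_apply, swap_apply_of_ne_of_ne h2 h1, pow_succ', Perm.mul_apply]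
  have h3 := key (orderOf w - 1)
  rw [Nat.sub_add_cancel (orderOf_pos w), pow_orderOf_eq_one] at h3
  exact hn h3

/-- Multiplication by a transposition joins two cycles. -/
lemma sameCycle_mul_swap_iff {w : Perm α} {x y : α} (h : ¬ w.SameCycle x y) {a b : α} :
    (w * swap x y).SameCycle a b ↔
      w.SameCycle a b ∨ (a ∈ orb w x ∪ orb w y ∧ b ∈ orb w x ∪ orb w y) := by
  have hcl : ∀ a b, w.SameCycle a b → (a ∈ orb w x ∪ orb w y ↔ b ∈ orb w x ∪ orb w y) := by
    intro a b hab
    simp only [Finset.mem_union, mem_orb]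
    exact or_congr ⟨fun h => h.trans hab, fun h => h.trans hab.symm⟩
      ⟨fun h => h.trans hab, fun h => h.trans hab.symm⟩
  constructor
  · refine sameCycle_le (r := fun a b => w.SameCycle a b ∨
      (a ∈ orb w x ∪ orb w y ∧ b ∈ orb w x ∪ orb w y)) ⟨fun a => Or.inl (SameCycle.refl _ _),
        fun h => h.imp SameCycle.symm And.symm, ?_⟩ ?_
    · rintro a b c (h1 | h1) (h2 | h2)
      · exact Or.inl (h1.trans h2)
      · exact Or.inr ⟨(hcl _ _ h1).2 h2.1, h2.2⟩
      · exact Or.inr ⟨h1.1, (hcl _ _ h2).1 h1.2⟩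
      · exact Or.inr ⟨h1.1, h2.2⟩
    · intro a
      by_cases hx : a = x
      · subst hx
        refine Or.inr ⟨Finset.mem_union_left _ (self_mem_orb w a), Finset.mem_union_right _ ?_⟩
        rw [Perm.mul_apply, swap_apply_left]
        exact mem_orb.2 (sameCycle_apply_self w y)
      · by_cases hy : a = y
        · subst hy
          refine Or.inr ⟨Finset.mem_union_right _ (self_mem_orb w a), Finset.mem_union_left _ ?_⟩
          rw [Perm.mul_apply, swap_apply_right]
          exact mem_orb.2 (sameCycle_apply_self w x)
        · rw [Perm.mul_apply, swap_apply_of_ne_of_ne hx hy]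
          exact Or.inl (sameCycle_apply_self w a)
  · have hxy := sameCycle_mul_swap_self h
    have h1 : ∀ a b, w.SameCycle a b → (w * swap x y).SameCycle a b := by
      intro a b
      refine sameCycle_le (sameCycle_equivalence _) fun a => ?_
      by_cases hx : a = x
      · subst hx
        refine hxy.trans ?_
        convert sameCycle_apply_self (w * swap a y) y using 1
        simp
      · by_cases hy : a = y
        · subst hy
          refine hxy.symm.trans ?_
          convert sameCycle_apply_self (w * swap x a) x using 1
          simp
        · convert sameCycle_apply_self (w * swap x y) a using 1
          rw [Perm.mul_apply, swap_apply_of_ne_of_ne hx hy]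
    rintro (hab | ⟨ha, hb⟩)
    · exact h1 a b hab
    · have h2 : ∀ c ∈ orb w x ∪ orb w y, (w * swap x y).SameCycle x c := by
        intro c hc
        rcases Finset.mem_union.1 hc with hc | hc
        · exact h1 _ _ (mem_orb.1 hc)
        · exact hxy.trans (h1 _ _ (mem_orb.1 hc))
      exact (h2 a ha).symm.trans (h2 b hb)

lemma disjoint_orb {w : Perm α} {x y : α} (h : ¬ w.SameCycle x y) :
    Disjoint (orb w x) (orb w y) :=
  Finset.disjoint_left.2 fun _ ha hb => h ((mem_orb.1 ha).trans (mem_orb.1 hb).symm)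

lemma orb_mul_swap_of_mem {w : Perm α} {x y : α} (h : ¬ w.SameCycle x y) {a : α}
    (ha : a ∈ orb w x ∪ orb w y) : orb (w * swap x y) a = orb w x ∪ orb w y := by
  ext b
  rw [mem_orb, sameCycle_mul_swap_iff h]
  refine ⟨?_, fun hb => Or.inr ⟨ha, hb⟩⟩
  rintro (hab | hb)
  · simp only [Finset.mem_union, mem_orb] at ha ⊢
    exact ha.imp (fun h => h.trans hab) (fun h => h.trans hab)
  · exact hb.2

lemma orb_mul_swap_of_notMem {w : Perm α} {x y : α} (h : ¬ w.SameCycle x y) {a : α}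
    (ha : a ∉ orb w x ∪ orb w y) : orb (w * swap x y) a = orb w a := by
  ext b
  rw [mem_orb, sameCycle_mul_swap_iff h, mem_orb]
  tauto

lemma orbits_mul_swap {w : Perm α} {x y : α} (h : ¬ w.SameCycle x y) :
    orb w x ∪ orb w y ∉ ((orbits w).erase (orb w x)).erase (orb w y) ∧
    orbits (w * swap x y) =
      insert (orb w x ∪ orb w y) (((orbits w).erase (orb w x)).erase (orb w y)) := by
  constructor
  · simp only [Finset.mem_erase, not_and]
    intro _ h2 h3
    obtain ⟨a, -, ha⟩ := Finset.mem_image.1 h3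
    have hx : x ∈ orb w a := ha ▸ Finset.mem_union_left _ (self_mem_orb w x)
    have hy : y ∈ orb w a := ha ▸ Finset.mem_union_right _ (self_mem_orb w y)
    exact h ((mem_orb.1 hx).symm.trans (mem_orb.1 hy))
  · ext O
    simp only [orbits, Finset.mem_image, Finset.mem_univ, true_and, Finset.mem_insert,
      Finset.mem_erase]
    constructor
    · rintro ⟨a, rfl⟩
      by_cases ha : a ∈ orb w x ∪ orb w y
      · exact Or.inl (orb_mul_swap_of_mem h ha)
      · rw [orb_mul_swap_of_notMem h ha]
        rw [Finset.mem_union, not_or, mem_orb, mem_orb] at ha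
        refine Or.inr ⟨fun h1 => ha.2 (orb_eq_iff.1 h1).symm, fun h1 => ha.1 (orb_eq_iff.1 h1).symm,
          a, rfl⟩
    · rintro (rfl | ⟨h1, h2, a, rfl⟩)
      · exact ⟨x, orb_mul_swap_of_mem h (Finset.mem_union_left _ (self_mem_orb w x))⟩
      · refine ⟨a, orb_mul_swap_of_notMem h ?_⟩
        rw [Finset.mem_union, not_or, mem_orb, mem_orb]
        exact ⟨fun h3 => h2 (orb_eq_iff.2 h3.symm), fun h3 => h1 (orb_eq_iff.2 h3.symm)⟩

lemma orb_eq_image (w : Perm α) (x : α) : orb w x =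
    (Finset.range (Function.minimalPeriod w x)).image fun j => (w ^ j) x := by
  ext b
  simp only [mem_orb, Finset.mem_image, Finset.mem_range]
  constructor
  · intro h
    obtain ⟨n, -, rfl⟩ := h.exists_pow_eq'
    refine ⟨n % Function.minimalPeriod w x, Nat.mod_lt _ (Function.IsPeriodicPt.minimalPeriod_pos
      (orderOf_pos w) ?_), ?_⟩
    · change w^[orderOf w] x = x
      rw [iterate_eq_pow, pow_orderOf_eq_one]; rfl
    · rw [← iterate_eq_pow, ← iterate_eq_pow, Function.iterate_mod_minimalPeriod_eq]
  · rintro ⟨j, -, rfl⟩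
    exact ⟨j, by simp⟩

lemma pow_injOn (w : Perm α) (x : α) :
    Set.InjOn (fun j : ℕ => (w ^ j) x) (Set.Iio (Function.minimalPeriod w x)) := by
  intro i hi j hj hij
  simp only [← iterate_eq_pow] at hij
  exact Function.iterate_injOn_Iio_minimalPeriod hi hj hij

lemma card_orb (w : Perm α) (x : α) : (orb w x).card = Function.minimalPeriod w x := by
  rw [orb_eq_image, Finset.card_image_of_injOn, Finset.card_range]
  simpa using pow_injOn w x

/-- Multiplication by a transposition of two elements of a cycle cuts this cycle. -/
lemma orb_mul_swap_pow (w : Perm α) (x : α) {i : ℕ} (hi : i ∈ Finset.Ioo 0 (orb w x).card) :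
    orb (w * swap x ((w ^ i) x)) x =
      insert x ((Finset.Ioo i (orb w x).card).image fun j => (w ^ j) x) := by
  have hi' := Finset.mem_Ioo.1 hi
  have hper : (w ^ (orb w x).card) x = x := by
    rw [card_orb, ← iterate_eq_pow]; exact Function.iterate_minimalPeriod
  have hinj : ∀ a b, a < (orb w x).card → b < (orb w x).card → (w ^ a) x = (w ^ b) x → a = b := by
    intro a b ha hb h
    rw [card_orb] at ha hb
    exact pow_injOn w x ha hb h
  set k := (orb w x).card
  set v := w * swap x ((w ^ i) x) with hv
  -- The cycle of `x` under `v` is `x, w^{i+1} x, …, w^{k-1} x`: the stretch from `w x` to `w^i x`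
  -- is bypassed.
  have hvx : v x = (w ^ (i + 1)) x := by simp [hv, pow_succ']
  have hvj : ∀ j, i < j → j < k → v ((w ^ j) x) = (w ^ (j + 1)) x := by
    intro j h1 h2
    rw [hv, Perm.mul_apply, swap_apply_of_ne_of_ne, pow_succ', Perm.mul_apply]
    · intro h
      have := hinj j 0 h2 (by omega) (by simpa using h)
      omega
    · intro h
      have := hinj j i h2 hi'.2 h
      omega
  have hmem : ∀ j, i < j → j ≤ k →
      (w ^ j) x ∈ insert x ((Finset.Ioo i k).image fun j => (w ^ j) x) := by
    intro j h1 h2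
    rcases h2.lt_or_eq with h2 | rfl
    · exact Finset.mem_insert_of_mem (Finset.mem_image_of_mem _ (Finset.mem_Ioo.2 ⟨h1, h2⟩))
    · rw [hper]; exact Finset.mem_insert_self _ _
  refine Finset.Subset.antisymm (fun b hb => ?_) (fun b hb => ?_)
  · obtain ⟨n, -, rfl⟩ := (mem_orb.1 hb).exists_pow_eq'
    clear hb
    induction n with
    | zero => exact Finset.mem_insert_self _ _
    | succ n ih =>
      rw [pow_succ', Perm.mul_apply]
      rcases Finset.mem_insert.1 ih with h | h
      · rw [h, hvx]; exact hmem _ (by omega) (by omega)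
      · obtain ⟨j, hj, h⟩ := Finset.mem_image.1 h
        rw [← h]
        have := Finset.mem_Ioo.1 hj
        rw [hvj j this.1 this.2]
        exact hmem _ (by omega) (by omega)
  · have key : ∀ n, i + n < k → (w ^ (i + 1 + n)) x ∈ orb v x := by
      intro n
      induction n with
      | zero => intro _; rw [mem_orb, add_zero, ← hvx]; exact sameCycle_apply_self v x
      | succ n ih =>
        intro hn
        rw [mem_orb, ← add_assoc, ← hvj _ (by omega) (by omega)]
        exact (mem_orb.1 (ih (by omega))).trans (sameCycle_apply_self v _)
    rcases Finset.mem_insert.1 hb with rfl | h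
    · exact self_mem_orb _ _
    · obtain ⟨j, hj, h⟩ := Finset.mem_image.1 h
      rw [← h]
      have := Finset.mem_Ioo.1 hj
      have h4 := key (j - i - 1) (by omega)
      rwa [show i + 1 + (j - i - 1) = j by omega] at h4

lemma card_orb_mul_swap_pow (w : Perm α) (x : α) {i : ℕ} (hi : i ∈ Finset.Ioo 0 (orb w x).card) :
    (orb (w * swap x ((w ^ i) x)) x).card = (orb w x).card - i ∧
      ¬ (w * swap x ((w ^ i) x)).SameCycle x ((w ^ i) x) := by
  have hi' := Finset.mem_Ioo.1 hi
  have hinj : ∀ a b, a < (orb w x).card → b < (orb w x).card → (w ^ a) x = (w ^ b) x → a = b := by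
    intro a b ha hb h
    rw [card_orb] at ha hb
    exact pow_injOn w x ha hb h
  constructor
  · rw [orb_mul_swap_pow w x hi, Finset.card_insert_of_notMem, Finset.card_image_of_injOn,
      Nat.card_Ioo]
    · omega
    · intro a ha b hb hab
      simp only [Finset.coe_Ioo, Set.mem_Ioo] at ha hb
      exact hinj a b ha.2 hb.2 hab
    · intro h
      obtain ⟨j, hj, h⟩ := Finset.mem_image.1 h
      have hj := Finset.mem_Ioo.1 hj
      have := hinj j 0 hj.2 (by omega) (by simpa using h)
      omega
  · rw [← mem_orb, orb_mul_swap_pow w x hi]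
    intro h
    rcases Finset.mem_insert.1 h with h | h
    · have := hinj i 0 hi'.2 (by omega) (by simpa using h)
      omega
    · obtain ⟨j, hj, h⟩ := Finset.mem_image.1 h
      have hj := Finset.mem_Ioo.1 hj
      have := hinj j i hj.2 hi'.2 h
      omega

/-! ### Cut-and-join as the sum over all transpositions -/

section CycleProd

variable {R : Type*} [CommRing R]

/-- The product over the cycles of `w` (including the fixed points) of `p` of the length. -/
def cycleProd (p : ℕ → R) (w : Perm α) : R := ∏ O ∈ orbits w, p O.card

lemma cycleProd_map {S : Type*} [CommRing S] (φ : R →+* S) (p : ℕ → R) (w : Perm α) :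
    φ (cycleProd p w) = cycleProd (fun k => φ (p k)) w := map_prod φ _ _

lemma cycleProd_mul (p q : ℕ → R) (w : Perm α) :
    cycleProd (fun k => p k * q k) w = cycleProd p w * cycleProd q w := Finset.prod_mul_distrib

lemma cycleProd_eq_of_sameCycle_not (p : ℕ → R) {w : Perm α} {x y : α} (h : ¬ w.SameCycle x y) :
    cycleProd p w = p (orb w x).card * p (orb w y).card *
      ∏ O ∈ ((orbits w).erase (orb w x)).erase (orb w y), p O.card := by
  rw [cycleProd, ← Finset.mul_prod_erase _ _ (orb_mem_orbits w x),
    ← Finset.mul_prod_erase ((orbits w).erase (orb w x)) _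
      (Finset.mem_erase.2 ⟨fun h' => h (orb_eq_iff.1 h').symm, orb_mem_orbits w y⟩), mul_assoc]

lemma cycleProd_join (p : ℕ → R) {w : Perm α} {x y : α} (h : ¬ w.SameCycle x y) :
    cycleProd p (w * swap x y) = p ((orb w x).card + (orb w y).card) *
      ∏ O ∈ ((orbits w).erase (orb w x)).erase (orb w y), p O.card := by
  obtain ⟨h1, h2⟩ := orbits_mul_swap h
  rw [cycleProd, h2, Finset.prod_insert h1, Finset.card_union_of_disjoint (disjoint_orb h)]

/-- The permutation `w` is recovered from the cut one by joining with the same transposition, so the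
join lemmas are read backwards. -/
lemma cycleProd_cut (p : ℕ → R) (w : Perm α) (x : α) {i : ℕ}
    (hi : i ∈ Finset.Ioo 0 (orb w x).card) :
    cycleProd p (w * swap x ((w ^ i) x)) = p i * p ((orb w x).card - i) *
      ∏ O ∈ (orbits w).erase (orb w x), p O.card := by
  obtain ⟨h1, h2⟩ := card_orb_mul_swap_pow w x hi
  set v := w * swap x ((w ^ i) x) with hv
  have hw : w = v * swap x ((w ^ i) x) := by rw [hv, mul_assoc, swap_mul_self, mul_one]
  obtain ⟨h3, h4⟩ := orbits_mul_swap h2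
  have h5 := orb_mul_swap_of_mem h2 (Finset.mem_union_left _ (self_mem_orb v x))
  rw [← hw] at h4 h5
  have h6 : (orb v ((w ^ i) x)).card = i := by
    have := congrArg Finset.card h5
    rw [Finset.card_union_of_disjoint (disjoint_orb h2), h1] at this
    have := Finset.mem_Ioo.1 hi
    omega
  rw [cycleProd_eq_of_sameCycle_not p h2, h1, h6, h4, h5, Finset.erase_insert h3, ← h5,
    mul_comm (p i)]

/-- The effect of all transpositions on the product over the cycles. -/
lemma sum_cycleProd_mul_swap (p : ℕ → R) (w : Perm α) :
    ∑ x, ∑ y ∈ Finset.univ.erase x, cycleProd p (w * swap x y) =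
      ∑ O ∈ orbits w, (O.card : R) *
        ((∑ i ∈ Finset.Ioo 0 O.card, p i * p (O.card - i)) * ∏ Q ∈ (orbits w).erase O, p Q.card +
        ∑ O' ∈ (orbits w).erase O, (O'.card : R) * (p (O.card + O'.card) *
          ∏ Q ∈ ((orbits w).erase O).erase O', p Q.card)) := by
  rw [← sum_orb w fun O => (∑ i ∈ Finset.Ioo 0 O.card, p i * p (O.card - i)) *
    ∏ Q ∈ (orbits w).erase O, p Q.card +
        ∑ O' ∈ (orbits w).erase O, (O'.card : R) * (p (O.card + O'.card) *
          ∏ Q ∈ ((orbits w).erase O).erase O', p Q.card)]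
  refine Finset.sum_congr rfl fun x _ => ?_
  rw [← Finset.sum_filter_add_sum_filter_not _ (w.SameCycle x)]
  congr 1
  -- A point `y ≠ x` in the cycle of `x` is `w^i x` for a unique `i` with `0 < i <` the length:
  -- these transpositions cut.
  · rw [Finset.sum_mul]
    symm
    refine Finset.sum_nbij (fun i => (w ^ i) x) ?_ ?_ ?_ fun i hi => (cycleProd_cut p w x hi).symm
    · intro i hi
      have h := Finset.mem_Ioo.1 hi
      rw [Finset.mem_filter, Finset.mem_erase]
      refine ⟨⟨fun h' => ?_, Finset.mem_univ _⟩, ⟨i, by simp⟩⟩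
      rw [card_orb] at h
      exact h.1.ne' (pow_injOn w x h.2 (h.1.trans h.2) h')
    · intro i hi j hj hij
      simp only [Finset.coe_Ioo, Set.mem_Ioo, card_orb] at hi hj
      exact pow_injOn w x hi.2 hj.2 hij
    · intro y hy
      simp only [Finset.coe_filter, Finset.mem_erase, Finset.mem_univ, and_true,
        Set.mem_ofPred_eq] at hy
      have := mem_orb.2 hy.2
      rw [orb_eq_image, ← card_orb] at this
      obtain ⟨j, hj, rfl⟩ := Finset.mem_image.1 this
      refine ⟨j, ?_, rfl⟩
      rw [Finset.mem_coe, Finset.mem_Ioo]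
      refine ⟨Nat.pos_of_ne_zero ?_, Finset.mem_range.1 hj⟩
      rintro rfl
      exact hy.1 rfl
  -- A point `y` in another cycle `O'` can be chosen in `|O'|` ways: these transpositions join.
  · have h1 : ∀ F : Finset α → R, ∑ y with ¬ w.SameCycle x y, F (orb w y) =
        ∑ O' ∈ (orbits w).erase (orb w x), (O'.card : R) * F O' := by
      intro F
      have := sum_orb w fun O => if O = orb w x then 0 else F O
      rw [← Finset.add_sum_erase _ _ (orb_mem_orbits w x), if_pos rfl, mul_zero, zero_add] at this
      rw [Finset.sum_filter]
      convert this using 1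
      · refine Finset.sum_congr rfl fun y _ => ?_
        by_cases hxy : w.SameCycle x y
        · rw [if_neg (not_not.2 hxy), if_pos (orb_eq_iff.2 hxy.symm)]
        · rw [if_pos hxy, if_neg fun h' => hxy (orb_eq_iff.1 h').symm]
      · refine Finset.sum_congr rfl fun O hO => ?_
        rw [if_neg (Finset.ne_of_mem_erase hO)]
    rw [← h1 fun O' => p ((orb w x).card + O'.card) *
      ∏ Q ∈ ((orbits w).erase (orb w x)).erase O', p Q.card]
    refine Finset.sum_congr ?_ fun y hy => cycleProd_join p (Finset.mem_filter.1 hy).2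
    ext y
    simp only [Finset.mem_filter, Finset.mem_erase, Finset.mem_univ, and_true, true_and,
      and_iff_right_iff_imp]
    rintro h rfl
    exact h (SameCycle.refl _ _)

lemma sum_sum_ite_add (F : ℕ → ℕ → R) {k M : ℕ} (hk : k ≤ M) :
    ∑ i ∈ Finset.range M, ∑ j ∈ Finset.range M,
      (if k = i + j + 2 then F (i + 1) (j + 1) else 0) = ∑ i ∈ Finset.Ioo 0 k, F i (k - i) := by
  rw [← Finset.sum_product', ← Finset.sum_filter]
  refine Finset.sum_nbij' (fun x => x.1 + 1) (fun i => (i - 1, k - i - 1)) ?_ ?_ ?_ ?_ ?_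
  · rintro ⟨i, j⟩ h
    simp only [Finset.mem_filter, Finset.mem_product, Finset.mem_range, Finset.mem_Ioo] at h ⊢
    omega
  · intro i h
    simp only [Finset.mem_filter, Finset.mem_product, Finset.mem_range, Finset.mem_Ioo] at h ⊢
    omega
  · rintro ⟨i, j⟩ h
    simp only [Finset.mem_filter, Finset.mem_product, Finset.mem_range] at h
    simp only [Prod.mk.injEq]
    omega
  · intro i h
    simp only [Finset.mem_Ioo] at h
    simp only
    omega
  · rintro ⟨i, j⟩ h
    simp only [Finset.mem_filter, Finset.mem_product, Finset.mem_range] at h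
    simp only [h.2]
    congr 1
    omega

lemma derivation_cycleProd {A : Type*} [CommRing A] [Algebra A R] (δ : Derivation A R R)
    (p : ℕ → R) (w : Perm α) :
    δ (cycleProd p w) = ∑ O ∈ orbits w, δ (p O.card) * ∏ Q ∈ (orbits w).erase O, p Q.card :=
  derivation_prod δ _ _

/-- The cut-and-join operator is the sum over all transpositions. -/
lemma cutJoin_cycleProd [Algebra ℚ R] {A : Type*} [CommRing A] [Algebra A R] {t : ℕ+ → R}
    {D : ℕ → Derivation A R R} (hD : ∀ i k, D i (psum t k) = if k = i + 1 then (k : R) else 0)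
    (w : Perm α) {M : ℕ} (hM : Fintype.card α ≤ M) :
    cutJoin t D M (cycleProd (psum t) w) =
      ∑ x, ∑ y ∈ Finset.univ.erase x, cycleProd (psum t) (w * swap x y) := by
  have h2 : ∀ i j, D i (D j (cycleProd (psum t) w)) = ∑ O ∈ orbits w,
      (if O.card = j + 1 then (O.card : R) else 0) * ∑ O' ∈ (orbits w).erase O,
        (if O'.card = i + 1 then (O'.card : R) else 0) *
          ∏ Q ∈ ((orbits w).erase O).erase O', psum t Q.card := by
    intro i j
    rw [derivation_cycleProd, map_sum]
    refine Finset.sum_congr rfl fun O _ => ?_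
    have h3 : D i (if O.card = j + 1 then (O.card : R) else 0) = 0 := by
      split_ifs
      · exact Derivation.map_natCast _ _
      · exact map_zero _
    rw [Derivation.leibniz, hD, h3, smul_zero, add_zero, derivation_prod, smul_eq_mul]
    simp_rw [hD]
  rw [sum_cycleProd_mul_swap]
  simp only [cutJoin, h2]
  simp only [derivation_cycleProd, hD, Finset.mul_sum, ← Finset.sum_add_distrib]
  rw [Finset.sum_congr rfl fun i _ => Finset.sum_comm, Finset.sum_comm]
  refine Finset.sum_congr rfl fun O hO => ?_
  simp_rw [Finset.sum_add_distrib]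
  rw [mul_add]
  congr 1
  · rw [← sum_sum_ite_add (fun i j => psum t i * psum t j) (O.card_le_univ.trans hM)]
    simp_rw [Finset.sum_mul, Finset.mul_sum]
    refine Finset.sum_congr rfl fun i _ => Finset.sum_congr rfl fun j _ => ?_
    simp only [show i + j + 1 + 1 = i + j + 2 from rfl]
    split_ifs <;> ring
  · rw [Finset.sum_congr rfl fun i _ => Finset.sum_comm, Finset.sum_comm, Finset.mul_sum]
    refine Finset.sum_congr rfl fun O' hO' => ?_
    have hO1 := card_pos_of_mem_orbits hO
    have hO2 := card_pos_of_mem_orbits (Finset.mem_of_mem_erase hO')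
    have hO3 := O.card_le_univ
    have hO4 := O'.card_le_univ
    -- `D i` differentiates in `t_{i+1}`, whence the shift by one: two derivatives select the
    -- ordered pair of cycles of these lengths.
    rw [Finset.sum_eq_single (O'.card - 1), Finset.sum_eq_single (O.card - 1), if_pos (by omega),
      if_pos (by omega), show O'.card - 1 + (O.card - 1) + 2 = O.card + O'.card by omega]
    · ring
    · intro j _ hj
      rw [if_neg (by omega)]; ring
    · intro h
      exact absurd (Finset.mem_range.2 (by omega)) h
    · intro i _ hi
      refine Finset.sum_eq_zero fun j _ => ?_
      rw [if_neg (c := O'.card = i + 1) (by omega)]; ring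
    · intro h
      exact absurd (Finset.mem_range.2 (by omega)) h

end CycleProd

/-! ### The cycle index of the symmetric group -/

section CycleIndex

variable {R : Type*} [CommRing R]

lemma orbits_inv (w : Perm α) : orbits w⁻¹ = orbits w := by
  have h : orb w⁻¹ = orb w := by
    ext a b
    rw [mem_orb, mem_orb, sameCycle_inv]
  rw [orbits, h, orbits]

lemma cycleProd_inv (p : ℕ → R) (w : Perm α) : cycleProd p w⁻¹ = cycleProd p w := by
  rw [cycleProd, orbits_inv, cycleProd]

/-- Extend a permutation by a fixed point. -/
def addFixedPoint {n : ℕ} (e : Perm (Fin n)) : Perm (Fin (n + 1)) := decomposeFin.symm (0, e)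

lemma addFixedPoint_zero {n : ℕ} (e : Perm (Fin n)) : addFixedPoint e 0 = 0 := by
  simp [addFixedPoint]

lemma addFixedPoint_succ {n : ℕ} (e : Perm (Fin n)) (a : Fin n) :
    addFixedPoint e a.succ = (e a).succ := by simp [addFixedPoint]

lemma decomposeFin_symm_eq {n : ℕ} (q : Fin (n + 1)) (e : Perm (Fin n)) :
    decomposeFin.symm (q, e) = swap 0 q * addFixedPoint e := by
  ext x
  refine Fin.cases ?_ (fun x => ?_) x
  · simp [addFixedPoint_zero]
  · rw [decomposeFin_symm_apply_succ, Perm.mul_apply, addFixedPoint_succ]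

lemma addFixedPoint_pow_succ {n : ℕ} (e : Perm (Fin n)) (a : Fin n) (m : ℕ) :
    (addFixedPoint e ^ m) a.succ = ((e ^ m) a).succ := by
  induction m with
  | zero => rfl
  | succ m ih => rw [pow_succ', Perm.mul_apply, ih, addFixedPoint_succ, pow_succ', Perm.mul_apply]

lemma orb_addFixedPoint_zero {n : ℕ} (e : Perm (Fin n)) : orb (addFixedPoint e) 0 = {0} := by
  ext b
  rw [mem_orb, Finset.mem_singleton]
  constructor
  · intro h
    obtain ⟨m, -, rfl⟩ := h.exists_pow_eq'
    exact Function.IsFixedPt.perm_pow (addFixedPoint_zero e) m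
  · rintro rfl
    exact SameCycle.refl _ _

lemma orb_addFixedPoint_succ {n : ℕ} (e : Perm (Fin n)) (a : Fin n) :
    orb (addFixedPoint e) a.succ = (orb e a).map (Fin.succEmb n) := by
  ext b
  rw [mem_orb, Finset.mem_map]
  constructor
  · intro h
    obtain ⟨m, -, rfl⟩ := h.exists_pow_eq'
    exact ⟨(e ^ m) a, mem_orb.2 ⟨m, by simp⟩, (addFixedPoint_pow_succ e a m).symm⟩
  · rintro ⟨c, hc, rfl⟩
    obtain ⟨m, -, rfl⟩ := (mem_orb.1 hc).exists_pow_eq'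
    exact ⟨m, by rw [zpow_natCast]; exact addFixedPoint_pow_succ e a m⟩

lemma orbits_addFixedPoint {n : ℕ} (e : Perm (Fin n)) :
    orbits (addFixedPoint e) =
      insert {0} ((orbits e).map (Finset.mapEmbedding (Fin.succEmb n)).toEmbedding) := by
  ext O
  simp only [orbits, Finset.mem_image, Finset.mem_univ, true_and, Finset.mem_insert,
    Finset.mem_map, Fin.exists_fin_succ, orb_addFixedPoint_zero, orb_addFixedPoint_succ,
    exists_exists_eq_and]
  exact or_congr eq_comm Iff.rfl

lemma singleton_zero_notMem {n : ℕ} (s : Finset (Finset (Fin n))) :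
    ({0} : Finset (Fin (n + 1))) ∉ s.map (Finset.mapEmbedding (Fin.succEmb n)).toEmbedding := by
  intro h
  obtain ⟨O, -, hO⟩ := Finset.mem_map.1 h
  have : (0 : Fin (n + 1)) ∈ O.map (Fin.succEmb n) := by
    change Finset.map _ O = _ at hO
    rw [hO]; exact Finset.mem_singleton_self 0
  obtain ⟨c, -, hc⟩ := Finset.mem_map.1 this
  exact Fin.succ_ne_zero c hc

lemma cycleProd_addFixedPoint (p : ℕ → R) {n : ℕ} (e : Perm (Fin n)) :
    cycleProd p (addFixedPoint e) = p 1 * cycleProd p e := by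
  rw [cycleProd, orbits_addFixedPoint, Finset.prod_insert (singleton_zero_notMem _),
    Finset.prod_map, Finset.card_singleton, cycleProd]
  congr 1
  refine Finset.prod_congr rfl fun O _ => ?_
  change p (Finset.map _ O).card = _
  rw [Finset.card_map]

/-- The new point is inserted into the cycle of `a`. Passing to inverses puts the transposition on
the right, where `cycleProd_join` applies. -/
lemma cycleProd_decomposeFin_succ (p : ℕ → R) {n : ℕ} (e : Perm (Fin n)) (a : Fin n) :
    cycleProd p (decomposeFin.symm (a.succ, e)) =
      p ((orb e a).card + 1) * ∏ O ∈ (orbits e).erase (orb e a), p O.card := by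
  have h : ¬ (addFixedPoint e).SameCycle 0 a.succ := by
    rw [← mem_orb, orb_addFixedPoint_zero, Finset.mem_singleton]
    exact Fin.succ_ne_zero a
  have h' : ¬ (addFixedPoint e)⁻¹.SameCycle 0 a.succ := by rwa [sameCycle_inv]
  have horb : orb (addFixedPoint e)⁻¹ = orb (addFixedPoint e) := by
    ext a b
    rw [mem_orb, mem_orb, sameCycle_inv]
  rw [← cycleProd_inv, decomposeFin_symm_eq, mul_inv_rev, swap_inv, cycleProd_join p h', orbits_inv,
    horb, orb_addFixedPoint_zero, orbits_addFixedPoint, Finset.erase_insert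
    (singleton_zero_notMem _), orb_addFixedPoint_succ, Finset.card_map, Finset.card_singleton,
    add_comm 1]
  congr 1
  have h2 : (orb e a).map (Fin.succEmb n) =
    (Finset.mapEmbedding (Fin.succEmb n)).toEmbedding (orb e a) := rfl
  rw [h2, ← Finset.map_erase, Finset.prod_map]
  refine Finset.prod_congr rfl fun O _ => ?_
  change p (Finset.map _ O).card = _
  rw [Finset.card_map]

lemma sum_cycleProd_succ (p : ℕ → R) (n : ℕ) :
    ∑ w : Perm (Fin (n + 1)), cycleProd p w = ∑ e : Perm (Fin n), (p 1 * cycleProd p e +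
      ∑ O ∈ orbits e, (O.card : R) * (p (O.card + 1) * ∏ Q ∈ (orbits e).erase O, p Q.card)) := by
  rw [← Equiv.sum_comp decomposeFin.symm, Fintype.sum_prod_type, Finset.sum_comm]
  refine Finset.sum_congr rfl fun e _ => ?_
  rw [Fin.sum_univ_succ]
  congr 1
  · exact cycleProd_addFixedPoint p e
  · rw [← sum_orb e fun O => p (O.card + 1) * ∏ Q ∈ (orbits e).erase O, p Q.card]
    exact Finset.sum_congr rfl fun a _ => cycleProd_decomposeFin_succ p e a

open MvPolynomial in
/-- The cycle index of the symmetric group in generic times. -/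
lemma sum_cycleProd_X (n : ℕ) :
    ∑ w : Perm (Fin n), cycleProd (psum (X : ℕ+ → MvPolynomial ℕ+ ℚ)) w =
      (n.factorial : MvPolynomial ℕ+ ℚ) * completeSym X n := by
  let t : ℕ+ → MvPolynomial ℕ+ ℚ := X
  -- Chosen so that `δ p_k = k p_{k+1}`: a new point enters a cycle of length `k` in `k` ways.
  -- Generic times are needed for such a derivation to exist.
  let δ : Derivation ℚ (MvPolynomial ℕ+ ℚ) (MvPolynomial ℕ+ ℚ) :=
    mkDerivation ℚ fun k : ℕ+ => psum t (k + 1)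
  have hδ : ∀ k : ℕ+, δ (t k) = psum t (k + 1) := fun k => mkDerivation_X _ _ _
  have hp : ∀ k : ℕ, 0 < k → δ (psum t k) = k * psum t (k + 1) := by
    intro k hk
    have h := (congrArg δ (extendZero_pos t ⟨k, hk⟩)).trans (hδ ⟨k, hk⟩)
    rw [psum, Derivation.leibniz, Derivation.map_natCast, smul_zero, add_zero, smul_eq_mul]
    exact congrArg _ h
  induction n with
  | zero =>
    rw [Fintype.sum_unique, completeSym_zero, Nat.factorial_zero, Nat.cast_one, mul_one, cycleProd]
    rfl
  | succ n ih =>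
    rw [sum_cycleProd_succ]
    have h1 : ∀ e : Perm (Fin n), ∑ O ∈ orbits e, (O.card : MvPolynomial ℕ+ ℚ) *
        (psum X (O.card + 1) * ∏ Q ∈ (orbits e).erase O, psum X Q.card) =
        δ (cycleProd (psum X) e) := by
      intro e
      rw [derivation_cycleProd]
      refine Finset.sum_congr rfl fun O hO => ?_
      rw [hp _ (card_pos_of_mem_orbits hO), mul_assoc]
    rw [Finset.sum_congr rfl fun e _ => by rw [h1 e], Finset.sum_add_distrib, ← Finset.mul_sum,
      ← map_sum, ih, Derivation.leibniz, Derivation.map_natCast, smul_zero, add_zero, smul_eq_mul,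
      Nat.factorial_succ]
    have h2 := derivation_completeSymInt δ t (n := n) (M := n) le_rfl
    have h3 := mul_completeSymInt t (n := (n + 1 : ℕ)) (M := n + 1) le_rfl
    rw [completeSymInt_natCast] at h2 h3
    rw [Finset.sum_range_succ', psum_zero, zero_mul, add_zero, Finset.sum_range_succ'] at h3
    rw [Finset.sum_range_succ', extendZero_zero, zero_mul, add_zero] at h2
    have h4 : ∀ i : ℕ, extendZero (fun k => δ (t k)) (i + 1) = psum t (i + 1 + 1) := fun i =>
      (extendZero_pos (fun k => δ (t k)) ⟨i + 1, i.succ_pos⟩).trans (hδ _)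
    -- Newton's identity for `h_{n+1}` with the term `p_1 h_n` split off; the other terms are `δ
    -- h_n`.
    have h5 : δ (completeSym t n) + psum t 1 * completeSym t n =
        ((n + 1 : ℕ) : MvPolynomial ℕ+ ℚ) * completeSym t (n + 1) := by
      have h6 := h3
      rw [Int.cast_natCast] at h6
      rw [h6, h2]
      congr 1
      · refine Finset.sum_congr rfl fun i _ => ?_
        rw [h4]
        congr 2
        push_cast
        ring
      · rw [zero_add, ← completeSymInt_natCast]
        congr 2
        push_cast
        ring
    push_cast at h5 ⊢
    linear_combination (n.factorial : MvPolynomial ℕ+ ℚ) * h5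

end CycleIndex

/-! ### Orbit lengths and the cycle type -/

section CycleType

variable {R : Type*} [CommRing R]

lemma orb_of_notMem_support {w : Perm α} {a : α} (h : a ∉ w.support) : orb w a = {a} := by
  ext b
  rw [mem_orb, Finset.mem_singleton]
  constructor
  · intro h'
    obtain ⟨m, -, rfl⟩ := h'.exists_pow_eq'
    exact Function.IsFixedPt.perm_pow (notMem_support.1 h) m
  · rintro rfl
    exact SameCycle.refl _ _

lemma orb_eq_support_cycleOf {w : Perm α} {a : α} (h : a ∈ w.support) :
    orb w a = (w.cycleOf a).support := by
  ext b
  rw [mem_orb, mem_support_cycleOf_iff]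
  exact ⟨fun h' => ⟨h', h⟩, fun h' => h'.1⟩

/-- The lengths of the orbits are the parts of the cycle type. -/
lemma cycleProd_eq_prod_partition (p : ℕ → R) (w : Perm α) :
    cycleProd p w = (w.partition.parts.map p).prod := by
  have h : orbits w = w.cycleFactorsFinset.image support ∪ w.supportᶜ.image singleton := by
    ext O
    simp only [orbits, Finset.mem_union, Finset.mem_image, Finset.mem_univ, true_and,
      Finset.mem_compl]
    constructor
    · rintro ⟨a, rfl⟩
      by_cases ha : a ∈ w.support
      · exact Or.inl ⟨w.cycleOf a, cycleOf_mem_cycleFactorsFinset_iff.2 ha,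
          (orb_eq_support_cycleOf ha).symm⟩
      · exact Or.inr ⟨a, ha, (orb_of_notMem_support ha).symm⟩
    · rintro (⟨c, hc, rfl⟩ | ⟨a, ha, rfl⟩)
      · obtain ⟨a, ha⟩ := (mem_cycleFactorsFinset_iff.1 hc).1.nonempty_support
        refine ⟨a, ?_⟩
        rw [orb_eq_support_cycleOf (mem_cycleFactorsFinset_support_le hc ha),
          ← cycle_is_cycleOf ha hc]
      · exact ⟨a, orb_of_notMem_support ha⟩
  have hdisj : Disjoint (w.cycleFactorsFinset.image support) (w.supportᶜ.image singleton) := by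
    rw [Finset.disjoint_left]
    intro O h1 h2
    obtain ⟨c, hc, rfl⟩ := Finset.mem_image.1 h1
    obtain ⟨a, ha, hac⟩ := Finset.mem_image.1 h2
    exact Finset.mem_compl.1 ha (mem_cycleFactorsFinset_support_le hc
      (hac ▸ Finset.mem_singleton_self a))
  have hinj : Set.InjOn support (w.cycleFactorsFinset : Set (Perm α)) := by
    intro c hc d hd hcd
    obtain ⟨a, ha⟩ := (mem_cycleFactorsFinset_iff.1 hc).1.nonempty_support
    rw [cycle_is_cycleOf ha hc, cycle_is_cycleOf (hcd ▸ ha) hd]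
  rw [cycleProd, h, Finset.prod_union hdisj, Finset.prod_image hinj,
    Finset.prod_image (Finset.singleton_injective.injOn), parts_partition, Multiset.map_add,
    Multiset.prod_add, Multiset.map_replicate, Multiset.prod_replicate, cycleType_def,
    Multiset.map_map]
  congr 1
  simp [Finset.card_compl]

end CycleType

end Orbits

/-! ### Linearity of the cut-and-join operator -/

section CutJoinLinear

variable {R A : Type*} [CommRing R] [Algebra ℚ R] [CommRing A] [Algebra A R]
  {t : ℕ+ → R} {D : ℕ → Derivation A R R} {M : ℕ}

lemma cutJoin_sum {ι : Type*} (s : Finset ι) (x : ι → R) :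
    cutJoin t D M (∑ i ∈ s, x i) = ∑ i ∈ s, cutJoin t D M (x i) := by
  simp_rw [cutJoin, map_sum, Finset.mul_sum, ← Finset.sum_add_distrib]
  rw [Finset.sum_congr rfl fun i _ => Finset.sum_comm, Finset.sum_comm]

lemma cutJoin_mul_right (x : R) {c : R} (hc : ∀ i, D i c = 0) :
    cutJoin t D M (x * c) = cutJoin t D M x * c := by
  have h : ∀ i x, D i (x * c) = D i x * c := fun i x => by
    rw [Derivation.leibniz, hc, smul_zero, zero_add, smul_eq_mul, mul_comm]
  simp_rw [cutJoin, h, Finset.sum_mul]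
  exact Finset.sum_congr rfl fun i _ => Finset.sum_congr rfl fun j _ => by ring

end CutJoinLinear

/-! ### The time derivatives and the eigenvalue `κ_λ` -/

section TimeDerivations

open MvPowerSeries

/-- The derivation `∂ / ∂ t_{i + 1}`. -/
def timeDeriv (i : ℕ) : Derivation ℂ TimeSeries TimeSeries := pderiv ℂ (Sum.inl i.succPNat)

lemma timeDeriv_tVar (i : ℕ) (k : ℕ+) : timeDeriv i (tVar k) = if (k : ℕ) = i + 1 then 1 else 0 := by
  by_cases h : (k : ℕ) = i + 1
  · have h' : k = i.succPNat := PNat.eq h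
    rw [if_pos h, h']
    exact pderiv_X_self
  · rw [if_neg h]
    refine pderiv_X_of_ne fun h' => h ?_
    rw [Sum.inl.inj h']
    rfl

lemma timeDeriv_tbarVar (i : ℕ) (k : ℕ+) : timeDeriv i ((-tbarVar) k) = 0 := by
  rw [Pi.neg_apply, map_neg, neg_eq_zero]
  exact pderiv_X_of_ne (by simp)

lemma timeDeriv_psum_tVar (i k : ℕ) :
    timeDeriv i (psum tVar k) = if k = i + 1 then (k : TimeSeries) else 0 := by
  rcases Nat.eq_zero_or_pos k with rfl | hk
  · simp
  have h := (congrArg (timeDeriv i) (extendZero_pos tVar ⟨k, hk⟩)).trans (timeDeriv_tVar i ⟨k, hk⟩)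
  rw [psum, Derivation.leibniz, Derivation.map_natCast, smul_zero, add_zero, smul_eq_mul]
  rw [PNat.mk_coe] at h
  rw [h, mul_ite, mul_one, mul_zero]

lemma timeDeriv_psum_tbarVar (i k : ℕ) : timeDeriv i (psum (-tbarVar) k) = 0 := by
  rcases Nat.eq_zero_or_pos k with rfl | hk
  · simp
  have h := (congrArg (timeDeriv i) (extendZero_pos (-tbarVar) ⟨k, hk⟩)).trans
    (timeDeriv_tbarVar i ⟨k, hk⟩)
  rw [PNat.mk_coe] at h
  rw [psum, Derivation.leibniz, Derivation.map_natCast, h, smul_zero, smul_zero, add_zero]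

lemma timeDeriv_completeSymInt_tVar (i : ℕ) (n : ℤ) :
    timeDeriv i (completeSymInt tVar n) = completeSymInt tVar (n - i - 1) := by
  rw [derivation_completeSymInt (timeDeriv i) tVar (M := n.toNat + i + 1) (by omega),
    Finset.sum_eq_single (i + 1)]
  · have h := (extendZero_pos (fun k => timeDeriv i (tVar k)) i.succPNat).trans
      (timeDeriv_tVar i i.succPNat)
    rw [Nat.succPNat_coe, if_pos rfl] at h
    rw [h, one_mul]
    congr 1
    push_cast
    ring
  · intro k _ hk
    rcases Nat.eq_zero_or_pos k with rfl | hk0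
    · simp
    have h := (extendZero_pos (fun k => timeDeriv i (tVar k)) ⟨k, hk0⟩).trans
      (timeDeriv_tVar i ⟨k, hk0⟩)
    rw [PNat.mk_coe, if_neg hk] at h
    rw [h, zero_mul]
  · intro h
    exact absurd (Finset.mem_range.2 (by omega)) h

lemma timeDeriv_schur_tbarVar (i : ℕ) (lam : YoungDiagram) :
    timeDeriv i (schur (-tbarVar) lam) = 0 := by
  rw [schur_eq_jt_colLen, derivation_jt (timeDeriv i) (-tbarVar)
    _ (M := lam.colLen 0 + lam.card) (fun j => ?_)]
  · refine Finset.sum_eq_zero fun k _ => ?_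
    rcases Nat.eq_zero_or_pos k with rfl | hk
    · simp
    have h := (extendZero_pos (fun k => timeDeriv i ((-tbarVar) k)) ⟨k, hk⟩).trans
      (timeDeriv_tbarVar i ⟨k, hk⟩)
    rw [PNat.mk_coe] at h
    rw [h, zero_mul]
  · have h1 := card_eq_sum_rowLen lam (le_refl _)
    have h2 := Finset.single_le_sum (f := fun i => lam.rowLen i) (fun _ _ => Nat.zero_le _)
      (Finset.mem_range.2 j.2)
    push_cast
    omega

/-- Termwise, `(λ_i - i)(λ_i - i - 1) - i (i + 1) = λ_i (λ_i - 2i - 1)` with rows numbered from `0`.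
-/
lemma cutJoinEigenvalue_diagram (lam : YoungDiagram) :
    cutJoinEigenvalue (fun i : Fin (lam.colLen 0) => (lam.rowLen i : ℤ) - (i : ℕ)) = kappa lam := by
  rw [kappa_eq_sum, cutJoinEigenvalue, ← Finset.sum_sub_distrib, ← Fin.sum_univ_eq_sum_range]
  exact Finset.sum_congr rfl fun i _ => by ring

/-- Schur functions are eigenvectors of the cut-and-join operator. -/
lemma cutJoin_schur (lam : YoungDiagram) {M : ℕ} (hM : lam.colLen 0 + lam.card ≤ M) :
    cutJoin tVar timeDeriv M (schur tVar lam) = (kappa lam : TimeSeries) * schur tVar lam := by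
  rw [schur_eq_jt_colLen, cutJoin_jt timeDeriv_completeSymInt_tVar, cutJoinEigenvalue_diagram]
  intro j
  have h1 := card_eq_sum_rowLen lam (le_refl _)
  have h2 := Finset.single_le_sum (f := fun i => lam.rowLen i) (fun _ _ => Nat.zero_le _)
    (Finset.mem_range.2 j.2)
  omega

end TimeDerivations

lemma const_natCast (n : ℕ) : const (n : ℂ) = n := map_natCast MvPowerSeries.C n

lemma const_intCast (n : ℤ) : const (n : ℂ) = n := map_intCast MvPowerSeries.C n

lemma const_pow (c : ℂ) (n : ℕ) : const (c ^ n) = const c ^ n := map_pow MvPowerSeries.C c n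

lemma const_mul (a b : ℂ) : const (a * b) = const a * const b := map_mul MvPowerSeries.C a b

lemma const_ne_zero {c : ℂ} (hc : c ≠ 0) : const c ≠ 0 :=
  (map_ne_zero_iff MvPowerSeries.C (MvPowerSeries.C_injective)).2 hc

/-! ### Counting factorizations into transpositions -/

section Factorizations

open Equiv Equiv.Perm

/-- The transpositions of the symmetric group. -/
abbrev Transposition (α : Type*) [DecidableEq α] : Type _ := {w : Perm α // w.IsSwap}

instance {α : Type*} [DecidableEq α] [Fintype α] : Fintype (Transposition α) := Fintype.ofFinite _

/-- Every transposition arises from exactly two ordered pairs. -/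
lemma sum_swap {α R : Type*} [Fintype α] [DecidableEq α] [CommRing R] (F : Perm α → R) :
    ∑ x, ∑ y ∈ Finset.univ.erase x, F (swap x y) = 2 * ∑ τ : Transposition α, F τ := by
  have h1 : ∀ x, ∀ y ∈ Finset.univ.erase x, F (swap x y) =
      ∑ τ : Transposition α, if τ.1 = swap x y then F τ else 0 := by
    intro x y hy
    rw [Finset.sum_eq_single ⟨swap x y, x, y, (Finset.ne_of_mem_erase hy).symm, rfl⟩]
    · rw [if_pos rfl]
    · intro τ _ hτ
      rw [if_neg fun h => hτ (Subtype.ext h)]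
    · simp
  rw [Finset.sum_congr rfl fun x _ => Finset.sum_congr rfl (h1 x),
    Finset.sum_congr rfl fun x _ => Finset.sum_comm, Finset.sum_comm, Finset.mul_sum]
  refine Finset.sum_congr rfl fun τ _ => ?_
  obtain ⟨_, a, b, hab, rfl⟩ := τ
  have h2 : ∀ x y, x ≠ y → swap a b = swap x y → (x = a ∧ y = b) ∨ (x = b ∧ y = a) := by
    intro x y hxy h
    have hx : swap a b x = y := by rw [h, swap_apply_left]
    rcases eq_or_ne x a with rfl | hxa
    · rw [swap_apply_left] at hx
      exact Or.inl ⟨rfl, hx.symm⟩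
    · rcases eq_or_ne x b with rfl | hxb
      · rw [swap_apply_right] at hx
        exact Or.inr ⟨rfl, hx.symm⟩
      · rw [swap_apply_of_ne_of_ne hxa hxb] at hx
        exact absurd hx hxy
  have h3 : ∀ x, ∑ y ∈ Finset.univ.erase x, (if swap a b = swap x y then F (swap a b) else 0) =
      if x = a ∨ x = b then F (swap a b) else 0 := by
    intro x
    by_cases hx : x = a ∨ x = b
    · rw [if_pos hx, Finset.sum_eq_single (swap a b x)]
      · rw [if_pos]
        rcases hx with rfl | rfl
        · rw [swap_apply_left]
        · rw [swap_apply_right, swap_comm]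
      · intro y hy hy'
        rw [if_neg]
        intro h
        exact hy' (by rw [h, swap_apply_left])
      · intro h
        refine absurd (Finset.mem_erase.2 ⟨?_, Finset.mem_univ _⟩) h
        rcases hx with rfl | rfl
        · rw [swap_apply_left]; exact hab.symm
        · rw [swap_apply_right]; exact hab
    · rw [if_neg hx]
      refine Finset.sum_eq_zero fun y hy => if_neg fun h => hx ?_
      exact (h2 x y (Finset.ne_of_mem_erase hy).symm h).imp And.left And.left
  rw [Finset.sum_congr rfl fun x _ => h3 x, ← Finset.sum_filter, Finset.filter_or,
    Finset.filter_eq', Finset.filter_eq', if_pos (Finset.mem_univ _), if_pos (Finset.mem_univ _),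
    Finset.sum_union (Finset.disjoint_singleton.2 hab), Finset.sum_singleton,
    Finset.sum_singleton, two_mul]

/-- The product `ρ τ₁ ⋯ τ_r`. -/
def mulTranspositions {d r : ℕ} (w : Perm (Fin d)) (τ : Fin r → Transposition (Fin d)) :
    Perm (Fin d) := w * (List.ofFn fun i => (τ i).1).prod

lemma sum_mulTranspositions_succ {R : Type*} [CommRing R] {d r : ℕ} (F : Perm (Fin d) → R)
    (w : Perm (Fin d)) : ∑ τ : Fin (r + 1) → Transposition (Fin d), F (mulTranspositions w τ) =
      ∑ τ : Fin r → Transposition (Fin d), ∑ τ' : Transposition (Fin d),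
        F (mulTranspositions w τ * τ'.1) := by
  rw [← (Fin.snocEquiv fun _ => Transposition (Fin d)).sum_comp, Fintype.sum_prod_type,
    Finset.sum_comm]
  refine Finset.sum_congr rfl fun τ _ => Finset.sum_congr rfl fun τ' _ => ?_
  rw [mulTranspositions, mulTranspositions, List.ofFn_succ_last]
  simp [mul_assoc]

lemma cutJoin_cycleProd_mulTranspositions {d r M : ℕ} (hM : d ≤ M) (w : Perm (Fin d)) :
    cutJoin tVar timeDeriv M
      (∑ τ : Fin r → Transposition (Fin d), cycleProd (psum tVar) (mulTranspositions w τ)) =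
      2 * ∑ τ : Fin (r + 1) → Transposition (Fin d),
        cycleProd (psum tVar) (mulTranspositions w τ) := by
  rw [cutJoin_sum, sum_mulTranspositions_succ, Finset.mul_sum]
  refine Finset.sum_congr rfl fun τ _ => ?_
  rw [cutJoin_cycleProd timeDeriv_psum_tVar _ (by simpa using hM),
    ← sum_swap fun v => cycleProd (psum tVar) (mulTranspositions w τ * v)]

/-- The product of the two power sums of index `k` is the power sum of the times `k t_k y_k`, so
this specializes the generic cycle index. -/
lemma sum_cycleProd_mul (y : ℕ+ → TimeSeries) (d : ℕ) :
    ∑ w : Perm (Fin d), cycleProd (psum tVar) w * cycleProd (psum y) w =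
      (d.factorial : TimeSeries) * completeSym (productTimes y) d := by
  let φ : MvPolynomial ℕ+ ℚ →+* TimeSeries := (MvPolynomial.aeval (productTimes y)).toRingHom
  have hφ : (fun k : ℕ+ => φ (MvPolynomial.X k)) = productTimes y :=
    funext fun k => MvPolynomial.aeval_X _ _
  have h1 : ∀ k, psum tVar k * psum y k = φ (psum MvPolynomial.X k) := by
    intro k
    rw [← psum_map, hφ]
    rcases Nat.eq_zero_or_pos k with rfl | hk
    · simp
    · have e1 := extendZero_pos tVar ⟨k, hk⟩
      have e2 := extendZero_pos y ⟨k, hk⟩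
      have e3 := extendZero_pos (productTimes y) ⟨k, hk⟩
      have e4 : productTimes y ⟨k, hk⟩ = tVar ⟨k, hk⟩ * ((k : TimeSeries) * y ⟨k, hk⟩) := rfl
      rw [e4] at e3
      rw [PNat.mk_coe] at e1 e2 e3
      rw [psum, psum, psum, e1, e2, e3]
      ring
  have h2 := congrArg φ (sum_cycleProd_X d)
  rw [map_sum, map_mul, map_natCast, ← completeSymInt_natCast, ← completeSymInt_map, hφ,
    completeSymInt_natCast] at h2
  rw [← h2]
  refine Finset.sum_congr rfl fun w _ => ?_
  rw [← cycleProd_mul, cycleProd_map]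
  simp_rw [h1]

/-- The sum of `κ_λ^r s_λ s_λ` over the partitions of `d`, as a sum over permutations. -/
lemma sum_kappa_pow_schur (d r : ℕ) :
    (d.factorial : TimeSeries) * ∑ lam ∈ diagrams d,
      (kappa lam : TimeSeries) ^ r * schur tVar lam * schur (-tbarVar) lam =
    2 ^ r * ∑ w : Perm (Fin d), (∑ τ : Fin r → Transposition (Fin d),
      cycleProd (psum tVar) (mulTranspositions w τ)) * cycleProd (psum (-tbarVar)) w := by
  induction r with
  | zero =>
    simp only [pow_zero, one_mul, Finset.univ_unique, Finset.sum_singleton, mulTranspositions,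
      List.ofFn_zero, List.prod_nil, mul_one]
    -- For `r = 0`, the Cauchy identity and the cycle index have the common value `d! h_d` at the
    -- product times.
    rw [sum_schur_mul_schur, sum_cycleProd_mul]
  | succ r ih =>
    obtain ⟨M, hM⟩ : ∃ M, d ≤ M ∧ ∀ lam ∈ diagrams d, lam.colLen 0 + lam.card ≤ M :=
      ⟨d + ∑ lam ∈ diagrams d, (lam.colLen 0 + lam.card), Nat.le_add_right _ _, fun lam hlam =>
        (Finset.single_le_sum (f := fun lam : YoungDiagram => lam.colLen 0 + lam.card)
          (fun _ _ => Nat.zero_le _) hlam).trans (Nat.le_add_left _ _)⟩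
    -- Acting on the `t`-dependence alone, the operator produces one more factor `κ_λ` on the left
    -- and one more transposition, counted twice, on the right.
    have h := congrArg (cutJoin tVar timeDeriv M) ih
    rw [mul_comm, cutJoin_mul_right _ fun i => Derivation.map_natCast _ _, cutJoin_sum,
      mul_comm (2 ^ r : TimeSeries), cutJoin_mul_right _ fun i => by
        rw [Derivation.leibniz_pow, ← Nat.cast_two, Derivation.map_natCast, smul_zero, smul_zero],
      cutJoin_sum] at h
    have h1 : ∀ lam ∈ diagrams d, cutJoin tVar timeDeriv M
        ((kappa lam : TimeSeries) ^ r * schur tVar lam * schur (-tbarVar) lam) =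
        (kappa lam : TimeSeries) ^ (r + 1) * schur tVar lam * schur (-tbarVar) lam := by
      intro lam hlam
      rw [cutJoin_mul_right _ fun i => timeDeriv_schur_tbarVar i lam, mul_comm (_ ^ r),
        cutJoin_mul_right _ fun i => by
          rw [Derivation.leibniz_pow, Derivation.map_intCast, smul_zero, smul_zero],
        cutJoin_schur lam (hM.2 lam hlam)]
      ring
    have h2 : ∀ w : Perm (Fin d), cutJoin tVar timeDeriv M
        ((∑ τ : Fin r → Transposition (Fin d), cycleProd (psum tVar) (mulTranspositions w τ)) *
          cycleProd (psum (-tbarVar)) w) = 2 * ((∑ τ : Fin (r + 1) → Transposition (Fin d),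
            cycleProd (psum tVar) (mulTranspositions w τ)) * cycleProd (psum (-tbarVar)) w) := by
      intro w
      rw [cutJoin_mul_right _ fun i => by
        rw [derivation_cycleProd]
        exact Finset.sum_eq_zero fun O _ => by rw [timeDeriv_psum_tbarVar, zero_mul],
        cutJoin_cycleProd_mulTranspositions hM.1, mul_assoc]
    rw [Finset.sum_congr rfl h1, Finset.sum_congr rfl fun w _ => h2 w, ← Finset.mul_sum] at h
    rw [mul_comm, h]
    ring

/-- The partition of `d` given by the cycle lengths. -/
def cyclePartition {d : ℕ} (w : Perm (Fin d)) : d.Partition :=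
  ⟨w.partition.parts, w.partition.parts_pos, w.partition.parts_sum.trans (Fintype.card_fin d)⟩

lemma cycleProd_eq_powerSum {R : Type*} [CommRing R] [Algebra ℚ R] {d : ℕ} (t : ℕ+ → R)
    (w : Perm (Fin d)) : cycleProd (psum t) w = powerSum t (cyclePartition w) :=
  cycleProd_eq_prod_partition _ _

lemma cyclePartition_inv {d : ℕ} (w : Perm (Fin d)) : cyclePartition w⁻¹ = cyclePartition w := by
  apply Nat.Partition.ext
  change w⁻¹.partition.parts = w.partition.parts
  rw [parts_partition, parts_partition, cycleType_inv, support_inv]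

-- The last permutation `σ` is determined by the others as the inverse of `ρ τ₁ ⋯ τ_r`, and
-- inversion preserves the cycle type.
open Classical in
lemma factorial_mul_doubleHurwitz (d r : ℕ) (mubar mu : d.Partition) :
    (d.factorial : ℚ) * doubleHurwitz d r mubar mu =
      (Finset.univ.filter fun x : Perm (Fin d) × (Fin r → Transposition (Fin d)) =>
        (cyclePartition x.1, cyclePartition (mulTranspositions x.1 x.2)) = (mubar, mu)).card := by
  rw [doubleHurwitz, mul_div_cancel₀ _ (by positivity)]
  congr 1
  let f : Perm (Fin d) × (Fin r → Transposition (Fin d)) →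
      Perm (Fin d) × (Fin r → Perm (Fin d)) × Perm (Fin d) :=
    fun x => (x.1, fun i => (x.2 i).1, (mulTranspositions x.1 x.2)⁻¹)
  have hf : Function.Injective f := by
    rintro ⟨w, τ⟩ ⟨w', τ'⟩ h
    simp only [f, Prod.mk.injEq] at h
    exact Prod.ext h.1 (funext fun i => Subtype.ext (congrFun h.2.1 i))
  rw [← Set.ncard_coe_finset, ← Set.ncard_image_of_injective _ hf]
  congr 1
  ext ⟨w, τ, v⟩
  simp only [Set.mem_ofPred_eq, Set.mem_image, Finset.mem_coe, Finset.mem_filter, Finset.mem_univ,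
    true_and, Prod.mk.injEq]
  constructor
  · rintro ⟨h1, h2, h3, h4⟩
    have h5 : v = (w * (List.ofFn τ).prod)⁻¹ := (inv_eq_of_mul_eq_one_right h4).symm
    refine ⟨(w, fun i => ⟨τ i, h2 i⟩), ⟨Nat.Partition.ext h1, ?_⟩, ?_⟩
    · rw [← cyclePartition_inv]
      refine Nat.Partition.ext ?_
      rw [← h3, h5]
      rfl
    · rw [h5]
      rfl
  · rintro ⟨⟨w', τ'⟩, ⟨h1, h2⟩, h3⟩
    simp only [f, Prod.mk.injEq] at h3
    obtain ⟨rfl, rfl, rfl⟩ := h3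
    refine ⟨congrArg Nat.Partition.parts h1, fun i => (τ' i).2, ?_, ?_⟩
    · rw [← cyclePartition_inv] at h2
      exact congrArg Nat.Partition.parts h2
    · exact mul_inv_cancel _

/-- The cut-and-join formula for the generating function of double Hurwitz numbers. -/
lemma sum_kappa_pow_eq_sum_doubleHurwitz (d r : ℕ) :
    ∑ lam ∈ diagrams d, const (((kappa lam : ℂ) / 2) ^ r) * schur tVar lam * schur (-tbarVar) lam =
      ∑ x : d.Partition × d.Partition, const (doubleHurwitz d r x.1 x.2 : ℂ) *
        powerSum tVar x.2 * powerSum (-tbarVar) x.1 := by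
  classical
  have hd : const (d.factorial : ℂ) ≠ 0 := const_ne_zero (by exact_mod_cast d.factorial_ne_zero)
  have h2 : const ((2 : ℂ) ^ r) ≠ 0 := const_ne_zero (pow_ne_zero r two_ne_zero)
  refine mul_left_cancel₀ hd (mul_left_cancel₀ h2 ?_)
  have h := sum_kappa_pow_schur d r
  have hl : const ((2 : ℂ) ^ r) * (const (d.factorial : ℂ) * ∑ lam ∈ diagrams d,
      const (((kappa lam : ℂ) / 2) ^ r) * schur tVar lam * schur (-tbarVar) lam) =
      (d.factorial : TimeSeries) * ∑ lam ∈ diagrams d,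
      (kappa lam : TimeSeries) ^ r * schur tVar lam * schur (-tbarVar) lam := by
    simp_rw [Finset.mul_sum]
    refine Finset.sum_congr rfl fun lam _ => ?_
    have h3 : const ((2 : ℂ) ^ r) * const (((kappa lam : ℂ) / 2) ^ r) =
        (kappa lam : TimeSeries) ^ r := by
      rw [← const_mul, ← mul_pow, mul_div_cancel₀ _ two_ne_zero, const_pow, const_intCast]
    rw [← h3, const_natCast]
    ring
  have h7 : const (2 : ℂ) = 2 := map_ofNat MvPowerSeries.C 2
  rw [hl, h, const_pow, h7]
  congr 1
  have h4 : ∀ x : d.Partition × d.Partition, const (d.factorial : ℂ) *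
      (const (doubleHurwitz d r x.1 x.2 : ℂ) * powerSum tVar x.2 * powerSum (-tbarVar) x.1) =
      ∑ z : Perm (Fin d) × (Fin r → Transposition (Fin d)) with
        (cyclePartition z.1, cyclePartition (mulTranspositions z.1 z.2)) = x,
        powerSum tVar (cyclePartition (mulTranspositions z.1 z.2)) *
          powerSum (-tbarVar) (cyclePartition z.1) := by
    intro x
    have h5 := factorial_mul_doubleHurwitz d r x.1 x.2
    rw [← mul_assoc, ← mul_assoc, ← const_mul]
    have h6 : (d.factorial : ℂ) * (doubleHurwitz d r x.1 x.2 : ℂ) =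
        (((d.factorial : ℚ) * doubleHurwitz d r x.1 x.2 : ℚ) : ℂ) := by push_cast; rfl
    rw [h6, h5, Rat.cast_natCast, const_natCast, mul_assoc, ← nsmul_eq_mul, ← Finset.sum_const]
    refine Finset.sum_congr rfl fun z hz => ?_
    rw [← (Finset.mem_filter.1 hz).2]
  rw [Finset.mul_sum, Finset.sum_congr rfl fun x _ => h4 x, Finset.sum_fiberwise,
    Fintype.sum_prod_type]
  refine Finset.sum_congr rfl fun w _ => ?_
  rw [Finset.sum_mul]
  refine Finset.sum_congr rfl fun τ _ => ?_
  rw [cycleProd_eq_powerSum, cycleProd_eq_powerSum]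

end Factorizations

/-! ### Weighted homogeneity in the times `t` -/

section Homogeneity

open MvPowerSeries

/-- The weighted degree in the times `t`, where `t_k` has degree `k`. -/
def timeWeight : (ℕ+ ⊕ ℕ+ →₀ ℕ) →+ ℕ :=
  Finsupp.liftAddHom fun v => (AddMonoidHom.mulLeft (Sum.elim (fun k : ℕ+ => (k : ℕ)) 0 v))

lemma timeWeight_single (v : ℕ+ ⊕ ℕ+) :
    timeWeight (Finsupp.single v 1) = Sum.elim (fun k : ℕ+ => (k : ℕ)) 0 v := by
  simp [timeWeight]

/-- The series `f` is homogeneous of degree `d` in the times `t`. -/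
def IsTimeHomogeneous (d : ℕ) (f : TimeSeries) : Prop := ∀ e, coeff e f ≠ 0 → timeWeight e = d

lemma isTimeHomogeneous_natCast (n : ℕ) : IsTimeHomogeneous 0 (n : TimeSeries) := by
  classical
  intro e he
  rw [← const_natCast, const, coeff_C] at he
  rw [show e = 0 by by_contra h; exact he (if_neg h), map_zero]

lemma IsTimeHomogeneous.mul {a b : ℕ} {f g : TimeSeries} (hf : IsTimeHomogeneous a f)
    (hg : IsTimeHomogeneous b g) : IsTimeHomogeneous (a + b) (f * g) := by
  intro e he
  obtain ⟨e₁, e₂, rfl, h1, h2⟩ := exists_of_coeff_mul_ne_zero he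
  rw [map_add, hf _ h1, hg _ h2]

lemma isTimeHomogeneous_X (v : ℕ+ ⊕ ℕ+) :
    IsTimeHomogeneous (Sum.elim (fun k : ℕ+ => (k : ℕ)) 0 v) (X v : TimeSeries) := by
  classical
  intro e he
  rw [coeff_X] at he
  rw [show e = Finsupp.single v 1 by by_contra h; exact he (if_neg h), timeWeight_single]

lemma IsTimeHomogeneous.extendZero {y : ℕ+ → TimeSeries} {c : ℕ}
    (hy : ∀ k : ℕ+, IsTimeHomogeneous (c * k) (y k)) (k : ℕ) :
    IsTimeHomogeneous (c * k) (extendZero y k) := by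
  rcases Nat.eq_zero_or_pos k with rfl | hk
  · intro e he
    simp at he
  · have h := extendZero_pos y ⟨k, hk⟩
    rw [PNat.mk_coe] at h
    rw [h]
    exact hy ⟨k, hk⟩

lemma IsTimeHomogeneous.powerSum {y : ℕ+ → TimeSeries} {c : ℕ}
    (hy : ∀ k : ℕ+, IsTimeHomogeneous (c * k) (y k)) {d : ℕ} (mu : d.Partition) :
    IsTimeHomogeneous (c * d) (powerSum y mu) := by
  have key : ∀ s : Multiset ℕ, IsTimeHomogeneous (c * s.sum)
      (s.map fun k : ℕ => (k : TimeSeries) * TodaHurwitz.extendZero y k).prod := by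
    intro s
    induction s using Multiset.induction_on with
    | empty => simpa using isTimeHomogeneous_natCast 1
    | cons k s ih =>
      rw [Multiset.map_cons, Multiset.prod_cons, Multiset.sum_cons, mul_add]
      refine IsTimeHomogeneous.mul ?_ ih
      simpa using (isTimeHomogeneous_natCast k).mul (IsTimeHomogeneous.extendZero hy k)
  have := key mu.parts
  rwa [mu.parts_sum] at this

/-- The variables `t̄` have weight `0`; the weight in `t` alone already recovers `d` from a
monomial. -/
lemma isTimeHomogeneous_powerSum_mul {d : ℕ} (mu mubar : d.Partition) :
    IsTimeHomogeneous d (powerSum tVar mu * powerSum (-tbarVar) mubar) := by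
  have h1 : IsTimeHomogeneous (1 * d) (powerSum tVar mu) :=
    IsTimeHomogeneous.powerSum (fun k => by rw [one_mul]; exact isTimeHomogeneous_X (Sum.inl k)) mu
  have h2 : IsTimeHomogeneous (0 * d) (powerSum (-tbarVar) mubar) :=
    IsTimeHomogeneous.powerSum (fun k => by
      rw [zero_mul]
      intro e he
      rw [Pi.neg_apply, map_neg, neg_ne_zero] at he
      exact isTimeHomogeneous_X (Sum.inr k) e he) mubar
  simpa using h1.mul h2

end Homogeneity

/-! ### Resummation into the Hurwitz generating function -/

section Expansion

open MvPowerSeries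

/-- At most `d!^{r+2}` tuples are counted, and the count is divided by `d!`. Growth that is
geometric in `r` is beaten by the `1 / r!` of the generating function. -/
lemma doubleHurwitz_le (d r : ℕ) (mubar mu : d.Partition) :
    ‖(doubleHurwitz d r mubar mu : ℂ)‖ ≤ (d.factorial : ℝ) * (d.factorial : ℝ) ^ r := by
  have h : ∀ n : ℕ, n ≤ d.factorial * (d.factorial ^ r * d.factorial) →
      ‖(((n : ℚ) / (d.factorial : ℚ) : ℚ) : ℂ)‖ ≤ (d.factorial : ℝ) * (d.factorial : ℝ) ^ r := by
    intro n hn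
    have hd : (0 : ℝ) < d.factorial := by exact_mod_cast d.factorial_pos
    rw [Rat.cast_div, Rat.cast_natCast, Rat.cast_natCast, norm_div, Complex.norm_natCast,
      Complex.norm_natCast, div_le_iff₀ hd]
    have : (n : ℝ) ≤ d.factorial * (d.factorial ^ r * d.factorial) := by exact_mod_cast hn
    linarith
  refine h _ ?_
  refine (Set.ncard_le_card _).trans (le_of_eq ?_)
  simp [Fintype.card_perm]

lemma hasSum_sigma_of_fiber {ι : Type*} {κ : ι → Type*} {f : (Σ i, κ i) → ℂ} {a : ℂ} (i : ι)
    (h : HasSum (fun x => f ⟨i, x⟩) a) (h0 : ∀ j, j ≠ i → ∀ x, f ⟨j, x⟩ = 0) : HasSum f a := by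
  refine ((sigma_mk_injective (i := i)).hasSum_iff ?_).1 h
  rintro ⟨j, x⟩ hx
  refine h0 j (fun hj => hx ?_) x
  subst hj
  exact ⟨x, rfl⟩

/-- The part of the expansion in Schur functions of degree `d`. -/
def schurPart (β q : ℂ) (d : ℕ) : TimeSeries := ∑ lam ∈ diagrams d,
  const (Complex.exp (β * (kappa lam : ℂ) / 2) * q ^ lam.card) * schur tVar lam *
    schur (-tbarVar) lam

/-- The general term of the generating function of double Hurwitz numbers. -/
def hurwitzTerm (β q : ℂ) (d r : ℕ) (x : d.Partition × d.Partition) : TimeSeries :=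
  const ((doubleHurwitz d r x.1 x.2 : ℂ) * (β ^ r / (r.factorial : ℂ)) * q ^ d) *
    powerSum tVar x.2 * powerSum (-tbarVar) x.1

lemma coeff_hurwitzTerm (β q : ℂ) (d r : ℕ) (x : d.Partition × d.Partition)
    (e : ℕ+ ⊕ ℕ+ →₀ ℕ) : coeff e (hurwitzTerm β q d r x) =
      (doubleHurwitz d r x.1 x.2 : ℂ) * (β ^ r / (r.factorial : ℂ)) * q ^ d *
        coeff e (powerSum tVar x.2 * powerSum (-tbarVar) x.1) := by
  rw [hurwitzTerm, mul_assoc]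
  exact coeff_C_mul _ _ _

lemma sum_hurwitzTerm (β q : ℂ) (d r : ℕ) : ∑ x, hurwitzTerm β q d r x =
    ∑ lam ∈ diagrams d, const ((β * (kappa lam : ℂ) / 2) ^ r / (r.factorial : ℂ) * q ^ lam.card) *
      schur tVar lam * schur (-tbarVar) lam := by
  have h := congrArg (fun f => const (β ^ r / (r.factorial : ℂ) * q ^ d) * f)
    (sum_kappa_pow_eq_sum_doubleHurwitz d r)
  simp only [Finset.mul_sum] at h
  rw [Finset.sum_congr rfl fun x _ => ?_, ← h]
  · refine Finset.sum_congr rfl fun lam hlam => ?_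
    rw [← mul_assoc, ← mul_assoc, ← const_mul, mem_diagrams.1 hlam]
    congr 3
    rw [mul_div_assoc, mul_pow]
    ring
  · rw [hurwitzTerm, ← mul_assoc, ← mul_assoc, ← const_mul]
    congr 3
    ring

/-- On the Schur side the sum over `r` is the exponential series of `βκ_λ/2`, for each of the
finitely many `λ` of size `d`. -/
lemma hasSum_sum_hurwitzTerm (β q : ℂ) (d : ℕ) :
    HasSum (fun r => ∑ x, hurwitzTerm β q d r x) (schurPart β q d) := by
  simp_rw [sum_hurwitzTerm]
  refine hasSum_sum fun lam _ => ?_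
  rw [WithPiTopology.hasSum_iff_hasSum_coeff]
  intro e
  have h : ∀ c : ℂ, coeff e (const c * schur tVar lam * schur (-tbarVar) lam) =
      c * (coeff e (schur tVar lam * schur (-tbarVar) lam)) := by
    intro c
    rw [mul_assoc]
    exact coeff_C_mul _ _ _
  simp_rw [h]
  refine (HasSum.mul_right _ ?_).mul_right _
  rw [Complex.exp_eq_exp_ℂ]
  exact NormedSpace.expSeries_div_hasSum_exp _

lemma hasSum_coeff_hurwitzTerm (β q : ℂ) (d : ℕ) (e : ℕ+ ⊕ ℕ+ →₀ ℕ) :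
    HasSum (fun x : ℕ × d.Partition × d.Partition => coeff e (hurwitzTerm β q d x.1 x.2))
      (coeff e (schurPart β q d)) := by
  have hs : Summable fun x : ℕ × d.Partition × d.Partition =>
      coeff e (hurwitzTerm β q d x.1 x.2) := by
    have h1 : Summable fun x : ℕ × d.Partition × d.Partition =>
        ((d.factorial * ‖β‖) ^ x.1 / (x.1.factorial : ℝ)) * (d.factorial * ‖q ^ d‖ *
          ‖coeff e (powerSum tVar x.2.2 * powerSum (-tbarVar) x.2.1)‖) :=
      (Real.summable_pow_div_factorial (d.factorial * ‖β‖)).mul_of_nonneg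
        (g := fun x : d.Partition × d.Partition => d.factorial * ‖q ^ d‖ *
          ‖coeff e (powerSum tVar x.2 * powerSum (-tbarVar) x.1)‖)
        (Summable.of_finite) (fun _ => by positivity) (fun _ => by positivity)
    refine Summable.of_norm_bounded h1 fun x => ?_
    rw [coeff_hurwitzTerm, norm_mul, norm_mul, norm_mul, norm_div, norm_pow, Complex.norm_natCast]
    calc _ ≤ (d.factorial : ℝ) * (d.factorial : ℝ) ^ x.1 * (‖β‖ ^ x.1 / (x.1.factorial : ℝ)) *
        ‖q ^ d‖ * ‖coeff e (powerSum tVar x.2.2 * powerSum (-tbarVar) x.2.1)‖ := by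
          gcongr
          exact doubleHurwitz_le _ _ _ _
      _ = _ := by rw [mul_pow]; ring
  have h2 := hs.hasSum.prod_fiberwise fun r => hasSum_fintype _
  -- Absolute convergence of the joint sum allows summing over the two partitions first; the
  -- iterated sum over `r` is then known.
  have h3 := WithPiTopology.hasSum_iff_hasSum_coeff.1 (hasSum_sum_hurwitzTerm β q d) e
  simp only [map_sum] at h3
  rw [h3.unique h2]
  exact hs.hasSum

lemma coeff_schurPart_of_ne (β q : ℂ) {d : ℕ} {e : ℕ+ ⊕ ℕ+ →₀ ℕ} (h : d ≠ timeWeight e) :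
    coeff e (schurPart β q d) = 0 := by
  have h1 := hasSum_coeff_hurwitzTerm β q d e
  have h2 : ∀ x : ℕ × d.Partition × d.Partition, coeff e (hurwitzTerm β q d x.1 x.2) = 0 := by
    intro x
    rw [coeff_hurwitzTerm, mul_eq_zero]
    right
    by_contra hne
    exact h (isTimeHomogeneous_powerSum_mul _ _ e hne).symm
  simp_rw [h2] at h1
  exact h1.unique hasSum_zero

lemma hasSum_schurPart {β q : ℂ} {Z : TimeSeries}
    (h : HasSum (fun lam : YoungDiagram => const (Complex.exp (β * (kappa lam : ℂ) / 2) *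
      q ^ lam.card) * schur tVar lam * schur (-tbarVar) lam) Z) :
    HasSum (schurPart β q) Z := by
  rw [WithPiTopology.hasSum_iff_hasSum_coeff] at h ⊢
  intro e
  have h1 := (Equiv.sigmaFiberEquiv YoungDiagram.card).hasSum_iff.2 (h e)
  refine HasSum.sigma h1 fun d => ?_
  rw [schurPart, map_sum, ← (Equiv.subtypeEquivRight fun lam => mem_diagrams (d := d)
    (lam := lam)).hasSum_iff]
  exact Finset.hasSum (diagrams d) _

/-- The expansion in Schur functions is the generating function of double Hurwitz numbers. -/
lemma hasSum_hurwitzTerm {β q : ℂ} {Z : TimeSeries}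
    (h : HasSum (fun lam : YoungDiagram => const (Complex.exp (β * (kappa lam : ℂ) / 2) *
      q ^ lam.card) * schur tVar lam * schur (-tbarVar) lam) Z) :
    HasSum (fun x : Σ d : ℕ, ℕ × d.Partition × d.Partition => hurwitzTerm β q x.1 x.2.1 x.2.2)
      Z := by
  rw [WithPiTopology.hasSum_iff_hasSum_coeff]
  intro e
  have h1 := WithPiTopology.hasSum_iff_hasSum_coeff.1 (hasSum_schurPart h) e
  -- The coefficient of a monomial sees only `d` equal to its weight, so the sum over `d` needs no
  -- estimate.
  have h2 := h1.unique (hasSum_single (timeWeight e) fun d hd => coeff_schurPart_of_ne β q hd)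
  rw [h2]
  refine hasSum_sigma_of_fiber (timeWeight e) (hasSum_coeff_hurwitzTerm β q _ e) ?_
  intro d hd x
  rw [coeff_hurwitzTerm, mul_eq_zero]
  right
  by_contra hne
  exact hd (isTimeHomogeneous_powerSum_mul _ _ e hne).symm

end Expansion

end

end TodaHurwitz
-- The theorem
open TodaHurwitz
theorem mainTheorem1 (β Q : ℂ) (hQ : Q ≠ 0) (s : ℤ) :
    TauConverges β Q ∧
    ∃ Z : TimeSeries,
      todaTau (hurwitzElement β Q) s =
        const
          (Complex.exp (β * ((s : ℂ) * ((s : ℂ) + 1) * (2 * (s : ℂ) + 1)) / 12) *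
            Q ^ (s * (s + 1) / 2)) * Z ∧
      HasSum
        (fun lam : YoungDiagram =>
          const
            (Complex.exp (β * (kappa lam : ℂ) / 2) *
              (Complex.exp (β * ((s : ℂ) + 1 / 2)) * Q) ^ lam.card) *
            schur tVar lam *
            schur (-tbarVar) lam) Z ∧
      HasSum
        (fun x : Σ d : ℕ, ℕ × d.Partition × d.Partition =>
          const
            ((doubleHurwitz x.1 x.2.1 x.2.2.1 x.2.2.2 : ℂ) *
              (β ^ x.2.1 / (x.2.1.factorial : ℂ)) *
              (Complex.exp (β * ((s : ℂ) + 1 / 2)) * Q) ^ x.1) *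
            powerSum tVar x.2.2.2 *
            powerSum (-tbarVar) x.2.2.1) Z := by
  have hc : Complex.exp (β * ((s : ℂ) * ((s : ℂ) + 1) * (2 * (s : ℂ) + 1)) / 12) *
      Q ^ (s * (s + 1) / 2) ≠ 0 := mul_ne_zero (Complex.exp_ne_zero _) (zpow_ne_zero _ hQ)
  -- The charge-dependent prefactor is a nonzero constant, so `Z` is the tau function divided by it.
  have h := (hasSum_todaTau β Q hQ s).mul_left (const (Complex.exp
    (β * ((s : ℂ) * ((s : ℂ) + 1) * (2 * (s : ℂ) + 1)) / 12) * Q ^ (s * (s + 1) / 2))⁻¹)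
  have h1 : ∀ f : TimeSeries, const (Complex.exp
      (β * ((s : ℂ) * ((s : ℂ) + 1) * (2 * (s : ℂ) + 1)) / 12) * Q ^ (s * (s + 1) / 2))⁻¹ *
      (const (Complex.exp (β * ((s : ℂ) * ((s : ℂ) + 1) * (2 * (s : ℂ) + 1)) / 12) *
        Q ^ (s * (s + 1) / 2)) * f) = f := by
    intro f
    rw [← mul_assoc, ← const_mul, inv_mul_cancel₀ hc, const, map_one, one_mul]
  simp_rw [h1] at h
  refine ⟨tauConverges β Q, _, ?_, h, hasSum_hurwitzTerm h⟩
  rw [← mul_assoc, ← const_mul, mul_inv_cancel₀ hc, const, map_one, one_mul]
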